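/- **Setting.** The massive Thirring model (MTM) is $$\mathrm i(u_t+u_x)+v+|v|^2u=0,\qquad \mathrm i(v_t-v_x)+u+|u|^2v=0 ,\qquad (x,t)\in\mathbb R^2 .$$ Put $\Theta(x,t;\lambda)=\tfrac14(\lambda-\lambda^{-1})x+\tfrac14(\lambda+\lambda^{-1})t$. The scattering data consist of a reflection coefficient $\gamma:\mathbb R\to\mathbb C$, distinct points $\lambda_1,\dots,\lambda_N$ with $\operatorname{Im}\lambda_k>0$, integers $m_1,\dots,m_N\ge 0$, and a function $f$ analytic and non-zero at each $\lambda_k$. The Riemann–Hilbert problem at $(x,t)$ asks for a $2\times2$ matrix function $\mathbf M(\lambda)$, with columns $\mathbf M_1,\mathbf M_2$, such that * $\mathbf M$ is analytic off $\mathbb R\cup\{\lambda_k,\bar\lambda_k\}_{k=1}^N$ and has poles of order exactly $m_k+1$ at $\lambda_k$ (in $\mathbf M_2$ only) and at $\bar\lambda_k$ (in $\mathbf M_1$ only); * for all $k$ and $0\le n_k\le m_k$, $$\operatorname*{Res}_{\lambda_k}(\lambda-\lambda_k)^{n_k}\mathbf M=\Big(\mathbf 0,\ \tfrac{[f(\lambda)e^{2\mathrm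 i\Theta}\mathbf M_1]^{(m_k-n_k)}|_{\lambda=\lambda_k}}{(m_k-n_k)!}\Big),\qquad \operatorname*{Res}_{\bar\lambda_k}(\lambda-\bar\lambda_k)^{n_k}\mathbf M=\Big(-\tfrac{[\lambda\overline{f(\bar\lambda)}e^{-2\mathrm i\Theta}\mathbf M_2]^{(m_k-n_k)}|_{\lambda=\bar\lambda_k}}{(m_k-n_k)!},\ \mathbf 0\Big);$$ * $\mathbf M$ has continuous boundary values $\mathbf M_\pm$ on $\mathbb R$ from the upper and lower half planes, and for $\lambda\in\mathbb R\setminus\{0\}$ $$\mathbf M_+=\mathbf M_-\begin{pmatrix}1&\gamma e^{2\mathrm i\Theta}\\ \lambda\bar\gamma e^{-2\mathrm i\Theta}&1+\lambda|\gamma|^2\end{pmatrix};$$ * $\mathbf M=\mathbf I+O(\lambda^{-1})$ as $\lambda\to\infty$, $\lambda\notin\mathbb R$. Let $F_1=f(\lambda)e^{2\mathrm i\Theta}\mathbf M_{11}$ and $F_2=\lambda\overline{f(\bar\lambda)}e^{-2\mathrm i\Theta}\mathbf M_{22}$. For a function $F$ in the place of $F_1$, respectively $F_2$, let $$G_1(\lambda)=F(\lambda)-f(\lambda)e^{2\mathrm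 i\Theta(\lambda)}+\sum_{k,l=1}^N\frac1{m_k!\,m_l!}\,\partial_\mu^{m_k}\partial_\nu^{m_l}\Big[\frac{\mu f(\lambda)\overline{f(\bar\mu)}e^{2\mathrm i(\Theta(\lambda)-\Theta(\mu))}F(\nu)}{(\lambda-\mu)(\mu-\nu)}\Big]\Big|_{\mu=\bar\lambda_k,\ \nu=\lambda_l},$$ $$G_2(\lambda)=F(\lambda)-\lambda\overline{f(\bar\lambda)}e^{-2\mathrm i\Theta(\lambda)}+\sum_{k,l=1}^N\frac1{m_k!\,m_l!}\,\partial_\nu^{m_l}\partial_\mu^{m_k}\Big[\frac{\lambda \overline{f(\bar\lambda)}f(\nu)e^{2\mathrm i(\Theta(\nu)-\Theta(\lambda))}F(\mu)}{(\lambda-\nu)(\nu-\mu)}\Big]\Big|_{\mu=\bar\lambda_k,\ \nu=\lambda_l}.$$ **Theorem (reflectionless $N$-multipole solutions).** Let $\gamma(\lambda)=0$ for all $\lambda\in\mathbb R\setminus\{0\}$. Then for every $(x,t)\in\mathbb R^2$ the Riemann–Hilbert problem has a solution $\mathbf M(x,t;\cdot)$, unique off $\mathbb R\cup\{\lambda_k,\bar\lambda_k\}_{k=1}^N$.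 The limits $$u(x,t)=\overline{\lim_{\lambda\to0}\mathbf M_{12}(x,t;\lambda)},\qquad v(x,t)=\lim_{\lambda\to0}\mathbf M_{21}(x,t;\lambda)$$ (with $\lambda\notin\mathbb R$) exist, $(u,v)$ is a $C^1$ solution of the MTM, and $$u(x,t)=\overline{\sum_{k=1}^N\sum_{n_k=0}^{m_k}\frac{F_1^{(m_k-n_k)}(x,t;\lambda_k)}{(-\lambda_k)^{n_k+1}(m_k-n_k)!}},\qquad v(x,t)=-\sum_{k=1}^N\sum_{n_k=0}^{m_k}\frac{F_2^{(m_k-n_k)}(x,t;\bar\lambda_k)}{(-\bar\lambda_k)^{n_k+1}(m_k-n_k)!}.$$ Moreover the numbers $F_1^{(j)}(x,t;\lambda_k)$ and $F_2^{(j)}(x,t;\bar\lambda_k)$ ($1\le k\le N$, $0\le j\le m_k$) are the unique solutions of the linear algebraic systems $$\frac{G_1^{(j)}(x,t;\lambda_k)}{j!}=0\qquad\text{and}\qquad \frac{G_2^{(j)}(x,t;\bar\lambda_k)}{j!}=0\qquad(1\le k\le N,\ 0\le j\le m_k),$$ respectively: a function $F$ analytic at all $\lambda_k$ satisfies the first system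 if and only if $F^{(j)}(\lambda_k)=F_1^{(j)}(x,t;\lambda_k)$ for all these $k,j$, and a function $F$ analytic at all $\bar\lambda_k$ satisfies the second if and only if $F^{(j)}(\bar\lambda_k)=F_2^{(j)}(x,t;\bar\lambda_k)$ for all these $k,j$. -/

import Mathlib

open Filter Topology ComplexConjugate

namespace MTM

noncomputable section

/-- A classical solution of the massive Thirring model on the plane:
`i (u_t + u_x) + v + |v|^2 u = 0` and `i (v_t - v_x) + u + |u|^2 v = 0`. -/
structure IsMTMSolution (u v : ℝ → ℝ → ℂ) : Prop where
  contDiff_u : ContDiff ℝ 1 (fun p : ℝ × ℝ => u p.1 p.2)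
  contDiff_v : ContDiff ℝ 1 (fun p : ℝ × ℝ => v p.1 p.2)
  eq_u : ∀ x t : ℝ,
    Complex.I * (deriv (fun s => u x s) t + deriv (fun y => u y t) x)
      + v x t + (‖v x t‖ : ℂ) ^ 2 * u x t = 0
  eq_v : ∀ x t : ℝ,
    Complex.I * (deriv (fun s => v x s) t - deriv (fun y => v y t) x)
      + u x t + (‖u x t‖ : ℂ) ^ 2 * v x t = 0

/-- Discrete scattering data: points `lam k`, pole orders `m k + 1`, and a function `f` (only its
germs at the points `lam k` matter) which carries the residue constants `f^(n) (lam k)`. -/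
structure DiscreteData (N : ℕ) where
  lam : Fin N → ℂ
  m : Fin N → ℕ
  f : ℂ → ℂ

/-- The phase `Θ(x,t;λ) = (λ - λ⁻¹) x / 4 + (λ + λ⁻¹) t / 4`. -/
def Theta (x t : ℝ) (z : ℂ) : ℂ :=
  (z - z⁻¹) * x / 4 + (z + z⁻¹) * t / 4

/-- The jump matrix on the real line, for the reflection coefficient `γ`. -/
def jumpMatrix (γ : ℝ → ℂ) (x t s : ℝ) : Matrix (Fin 2) (Fin 2) ℂ :=
  !![1, γ s * Complex.exp (2 * Complex.I * Theta x t s);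
     s * conj (γ s) * Complex.exp (-(2 * Complex.I * Theta x t s)), 1 + s * (‖γ s‖ : ℂ) ^ 2]

/-- `c` is the residue at `a` of `g` (for `g` holomorphic on a punctured neighbourhood of `a`):
`(2πi)⁻¹ ∮ g` over all sufficiently small positively oriented circles around `a`. -/
def HasResidueAt (g : ℂ → ℂ) (a c : ℂ) : Prop :=
  ∀ᶠ r : ℝ in 𝓝[>] 0, (2 * (Real.pi : ℂ) * Complex.I)⁻¹ * (∮ z in C(a, r), g z) = c

namespace DiscreteData

variable {N : ℕ} (D : DiscreteData N)

/-- The real line together with the poles `lam k` and their conjugates. -/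
def singularSet : Set ℂ :=
  {z | z.im = 0} ∪ Set.range D.lam ∪ Set.range (fun k => conj (D.lam k))

/-- `f(λ) e^{2iΘ(x,t;λ)}`. -/
def weight (x t : ℝ) (z : ℂ) : ℂ :=
  D.f z * Complex.exp (2 * Complex.I * Theta x t z)

/-- `λ conj(f(conj λ)) e^{-2iΘ(x,t;λ)}`. -/
def weightBar (x t : ℝ) (z : ℂ) : ℂ :=
  z * conj (D.f (conj z)) * Complex.exp (-(2 * Complex.I * Theta x t z))

/-- The `2 × 2` matrix Riemann--Hilbert problem at the point `(x,t)`. The columns of `M` are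
`fun z i => M z i 0` and `fun z i => M z i 1`. The residue conditions involve derivatives of the
first column at `lam k` and of the second column at `conj (lam k)`; these columns are regular
there, and `M` carries their (analytic) values at these points. -/
structure IsRHPSolution (γ : ℝ → ℂ) (x t : ℝ) (M : ℂ → Matrix (Fin 2) (Fin 2) ℂ) : Prop where
  /-- analyticity -/
  analytic : ∀ i j : Fin 2, DifferentiableOn ℂ (fun z => M z i j) (D.singularSet)ᶜ
  analytic_lam : ∀ k, AnalyticAt ℂ (fun z (i : Fin 2) => M z i 0) (D.lam k)
  analytic_lamBar : ∀ k, AnalyticAt ℂ (fun z (i : Fin 2) => M z i 1) (conj (D.lam k))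
  /-- poles of order `m k + 1` -/
  order_lam : ∀ k, meromorphicOrderAt (fun z (i : Fin 2) => M z i 1) (D.lam k)
      = ((-((D.m k : ℤ) + 1) : ℤ) : WithTop ℤ)
  order_lamBar : ∀ k, meromorphicOrderAt (fun z (i : Fin 2) => M z i 0) (conj (D.lam k))
      = ((-((D.m k : ℤ) + 1) : ℤ) : WithTop ℤ)
  /-- residue conditions at `lam k` -/
  residue_lam : ∀ k, ∀ n ≤ D.m k, ∀ i : Fin 2,
    HasResidueAt (fun z => (z - D.lam k) ^ n * M z i 0) (D.lam k) 0 ∧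
    HasResidueAt (fun z => (z - D.lam k) ^ n * M z i 1) (D.lam k)
      (iteratedDeriv (D.m k - n) (fun z => D.weight x t z * M z i 0) (D.lam k)
        / ((D.m k - n).factorial : ℂ))
  /-- residue conditions at `conj (lam k)` -/
  residue_lamBar : ∀ k, ∀ n ≤ D.m k, ∀ i : Fin 2,
    HasResidueAt (fun z => (z - conj (D.lam k)) ^ n * M z i 0) (conj (D.lam k))
      (-(iteratedDeriv (D.m k - n) (fun z => D.weightBar x t z * M z i 1) (conj (D.lam k))
        / ((D.m k - n).factorial : ℂ))) ∧
    HasResidueAt (fun z => (z - conj (D.lam k)) ^ n * M z i 1) (conj (D.lam k)) 0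
  /-- continuous boundary values on the real line from the two half planes, and the jump -/
  jump : ∃ Mp Mm : ℝ → Matrix (Fin 2) (Fin 2) ℂ, Continuous Mp ∧ Continuous Mm ∧
    (∀ s : ℝ, Tendsto M (𝓝[{z : ℂ | 0 < z.im}] (s : ℂ)) (𝓝 (Mp s))) ∧
    (∀ s : ℝ, Tendsto M (𝓝[{z : ℂ | z.im < 0}] (s : ℂ)) (𝓝 (Mm s))) ∧
    ∀ s : ℝ, s ≠ 0 → Mp s = Mm s * jumpMatrix γ x t s
  /-- normalization `M = I + O(1/λ)` -/
  normalization : ∀ i j : Fin 2,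
    (fun z : ℂ => M z i j - (1 : Matrix (Fin 2) (Fin 2) ℂ) i j)
      =O[Bornology.cobounded ℂ ⊓ 𝓟 {z : ℂ | z.im ≠ 0}] (fun z : ℂ => z⁻¹)

/-- `F₁ = f e^{2iΘ} M₁₁`. -/
def F1 (x t : ℝ) (M : ℂ → Matrix (Fin 2) (Fin 2) ℂ) (z : ℂ) : ℂ :=
  D.weight x t z * M z 0 0

/-- `F₂ = λ conj(f(conj λ)) e^{-2iΘ} M₂₂`. -/
def F2 (x t : ℝ) (M : ℂ → Matrix (Fin 2) (Fin 2) ℂ) (z : ℂ) : ℂ :=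
  D.weightBar x t z * M z 1 1

/-- `G₁(x,t;λ)`, as an expression in the unknown function `F` in the place of `F₁`. -/
def G1 (x t : ℝ) (F : ℂ → ℂ) (z : ℂ) : ℂ :=
  F z - D.weight x t z
    + ∑ k : Fin N, ∑ l : Fin N, 1 / (((D.m k).factorial : ℂ) * ((D.m l).factorial : ℂ)) *
      iteratedDeriv (D.m k) (fun μ =>
        iteratedDeriv (D.m l) (fun ν =>
          μ * D.f z * conj (D.f (conj μ))
            * Complex.exp (2 * Complex.I * (Theta x t z - Theta x t μ)) * F ν
            / ((z - μ) * (μ - ν))) (D.lam l)) (conj (D.lam k))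

/-- `G₂(x,t;λ)`, as an expression in the unknown function `F` in the place of `F₂`. -/
def G2 (x t : ℝ) (F : ℂ → ℂ) (z : ℂ) : ℂ :=
  F z - D.weightBar x t z
    + ∑ k : Fin N, ∑ l : Fin N, 1 / (((D.m k).factorial : ℂ) * ((D.m l).factorial : ℂ)) *
      iteratedDeriv (D.m l) (fun ν =>
        iteratedDeriv (D.m k) (fun μ =>
          z * conj (D.f (conj z)) * D.f ν
            * Complex.exp (2 * Complex.I * (Theta x t ν - Theta x t z)) * F μ
            / ((z - ν) * (ν - μ))) (conj (D.lam k))) (D.lam l)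

/-- The first algebraic system, `G₁^(j)(λ_k) / j! = 0` for all `k` and `j = 0, …, m_k`. -/
def System1 (x t : ℝ) (F : ℂ → ℂ) : Prop :=
  ∀ k, ∀ j ≤ D.m k, iteratedDeriv j (D.G1 x t F) (D.lam k) / (j.factorial : ℂ) = 0

/-- The second algebraic system, `G₂^(j)(conj λ_k) / j! = 0` for all `k` and `j = 0, …, m_k`. -/
def System2 (x t : ℝ) (F : ℂ → ℂ) : Prop :=
  ∀ k, ∀ j ≤ D.m k, iteratedDeriv j (D.G2 x t F) (conj (D.lam k)) / (j.factorial : ℂ) = 0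

end DiscreteData

end

end MTM

/-! Without reflection the jump is the identity, so a solution extends analytically across the real
line and each row of the matrix becomes a rational pair `(n₁, n₂)`. The residue conditions say that
`n₂` has the principal part of `w₁ n₁ / (z - a k)^(m k + 1)` at `a k`, and symmetrically for `n₁` at
the conjugate points with the weight `w₂ z = -(z * conj (w₁ (conj z)))`. This is the structure
`IsRow`. Write `n^*` for `z ↦ conj (n (conj z))`.

Everything rests on a vanishing lemma, `IsRow.eventuallyEq_zero`. The symmetry of the weights makes
the poles of `n₁ n₁^* + z n₂ n₂^*` cancel. For a row that decays at infinity this function is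
therefore zero by Liouville. At a real point `s > 0` it equals `|n₁|² + s |n₂|²`, so the row
vanishes on a half-line and hence identically. Uniqueness follows at once. Existence follows too:
the coefficients of the partial fractions solve a square linear system, whose kernel consists of
decaying rows (`coeffMatrix_det_ne_zero`). Eliminating one column from that system gives the
equations for `G₁` and `G₂`.

The coefficients are C¹ in `(x, t)` by Cramer's rule. In the light-cone directions the logarithmic
derivatives of the weight are `iz` and `i/z`. Differentiating a row and correcting by such a
multiple of its second entry gives again a row (`isRow_deriv`). Subtracting the right combination of
the two original rows makes it decay, hence vanish, which is a Lax pair in disguise. Evaluated at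
zero and infinity, this gives `LaxData.deriv_xi` and `LaxData.deriv_eta`. With the determinant and
the pairing evaluated at the origin (`IsRow.relations`), these are the two equations of the model.
-/

namespace MTM

/-! ### Removable singularities and principal parts. -/

noncomputable section

/-- `g` has a removable singularity at `a`. -/
def RegAt (g : ℂ → ℂ) (a : ℂ) : Prop :=
  ∃ h : ℂ → ℂ, AnalyticAt ℂ h a ∧ g =ᶠ[𝓝[≠] a] h

namespace RegAt

variable {g g' : ℂ → ℂ} {a : ℂ}

theorem of_analyticAt (h : AnalyticAt ℂ g a) : RegAt g a := ⟨g, h, EventuallyEq.rfl⟩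

theorem congr (h : RegAt g a) (he : g' =ᶠ[𝓝[≠] a] g) : RegAt g' a := by
  obtain ⟨k, hk, e⟩ := h
  exact ⟨k, hk, he.trans e⟩

theorem add (h : RegAt g a) (h' : RegAt g' a) : RegAt (fun z => g z + g' z) a := by
  obtain ⟨k, hk, e⟩ := h
  obtain ⟨k', hk', e'⟩ := h'
  exact ⟨fun z => k z + k' z, hk.fun_add hk', by
    filter_upwards [e, e'] with z h1 h2; rw [h1, h2]⟩

theorem mul (h : RegAt g a) (h' : RegAt g' a) : RegAt (fun z => g z * g' z) a := by
  obtain ⟨k, hk, e⟩ := h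
  obtain ⟨k', hk', e'⟩ := h'
  exact ⟨fun z => k z * k' z, hk.fun_mul hk', by
    filter_upwards [e, e'] with z h1 h2; rw [h1, h2]⟩

theorem const (c : ℂ) : RegAt (fun _ => c) a := of_analyticAt analyticAt_const

theorem neg (h : RegAt g a) : RegAt (fun z => -g z) a :=
  ((const (-1)).mul h).congr (Eventually.of_forall fun z => by ring)

theorem sub (h : RegAt g a) (h' : RegAt g' a) : RegAt (fun z => g z - g' z) a :=
  (h.add h'.neg).congr (Eventually.of_forall fun z => by ring)

theorem sum {ι : Type*} (s : Finset ι) {G : ι → ℂ → ℂ} (h : ∀ i ∈ s, RegAt (G i) a) :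
    RegAt (fun z => ∑ i ∈ s, G i z) a := by
  classical
  induction s using Finset.induction_on with
  | empty => simpa using const 0
  | insert i s hi ih =>
    simp only [Finset.sum_insert hi]
    exact (h i (by simp)).add (ih fun j hj => h j (by simp [hj]))

end RegAt

theorem analyticAt_conj_conj {g : ℂ → ℂ} {a : ℂ} (h : AnalyticAt ℂ g (conj a)) :
    AnalyticAt ℂ (fun z => conj (g (conj z))) a := by
  rw [Complex.analyticAt_iff_eventually_differentiableAt] at h ⊢
  have hc : Tendsto (fun z : ℂ => conj z) (𝓝 a) (𝓝 (conj a)) :=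
    Complex.continuous_conj.continuousAt
  filter_upwards [hc.eventually h] with z hz
  simpa [Function.comp_def] using hz.conj_conj

theorem tendsto_conj_nhdsNE (a : ℂ) :
    Tendsto (fun z : ℂ => conj z) (𝓝[≠] a) (𝓝[≠] (conj a)) := by
  refine tendsto_nhdsWithin_iff.2 ⟨Complex.continuous_conj.continuousAt.tendsto.mono_left
    nhdsWithin_le_nhds, ?_⟩
  filter_upwards [self_mem_nhdsWithin] with z hz h
  exact hz ((starRingEnd ℂ).injective h)

theorem RegAt.conj_conj {g : ℂ → ℂ} {a : ℂ} (h : RegAt g (conj a)) :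
    RegAt (fun z => conj (g (conj z))) a := by
  obtain ⟨k, hk, e⟩ := h
  refine ⟨_, analyticAt_conj_conj hk, ?_⟩
  filter_upwards [(tendsto_conj_nhdsNE a).eventually e] with z hz
  rw [hz]

/-- Both sides say that `g` vanishes to order at least `n` at `a`. Through this lemma a condition on
poles becomes a finite list of equations between Taylor coefficients. -/
theorem regAt_div_pow_iff {g : ℂ → ℂ} {a : ℂ} (hg : AnalyticAt ℂ g a) (n : ℕ) :
    RegAt (fun z => g z / (z - a) ^ n) a ↔ ∀ j < n, iteratedDeriv j g a = 0 := by
  rw [← natCast_le_analyticOrderAt_iff_iteratedDeriv_eq_zero hg, natCast_le_analyticOrderAt hg]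
  constructor
  · rintro ⟨h, hh, e⟩
    refine ⟨h, hh, ?_⟩
    have hc : ContinuousAt (fun z => (z - a) ^ n • h z) a := by
      have := hh.continuousAt
      fun_prop
    refine (hg.continuousAt.eventuallyEq_nhds_iff_eventuallyEq_nhdsNE hc).1 ?_
    filter_upwards [e, self_mem_nhdsWithin] with z hz hne
    have : (z - a) ^ n ≠ 0 := pow_ne_zero _ (sub_ne_zero.2 hne)
    rw [smul_eq_mul, ← hz]
    field_simp
  · rintro ⟨h, hh, e⟩
    refine ⟨h, hh, ?_⟩
    filter_upwards [e.filter_mono nhdsWithin_le_nhds, self_mem_nhdsWithin] with z hz hne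
    have : (z - a) ^ n ≠ 0 := pow_ne_zero _ (sub_ne_zero.2 hne)
    rw [hz, smul_eq_mul]
    field_simp

/-- The principal part at `a` of `g(z) / (z - a)^(m+1)`. -/
def princ (a : ℂ) (m : ℕ) (g : ℂ → ℂ) (z : ℂ) : ℂ :=
  ∑ n ∈ Finset.range (m + 1),
    iteratedDeriv (m - n) g a / ((m - n).factorial : ℂ) * ((z - a) ^ (n + 1))⁻¹

/-- Dividing Taylor's formula of order `m + 1` by `(z - a)^(m + 1)` leaves `princ` plus an analytic
remainder; the reflected sum only matches the Taylor index `m - n` with the pole order `n + 1`. -/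
theorem regAt_princ_sub {g : ℂ → ℂ} {a : ℂ} (hg : AnalyticAt ℂ g a) (m : ℕ) :
    RegAt (fun z => princ a m g z - g z / (z - a) ^ (m + 1)) a := by
  have hg' : AnalyticAt ℂ (fun z => g (a + z)) 0 := by
    refine AnalyticAt.fun_comp (g := g) (f := fun z => a + z) (by simpa using hg) (by fun_prop)
  obtain ⟨F, hF, e⟩ := hg'.exists_eq_sum_add_pow_mul (m + 1)
  refine ⟨fun z => -F (z - a), ?_, ?_⟩
  · refine AnalyticAt.neg ?_
    exact AnalyticAt.fun_comp (g := F) (f := fun z => z - a) (by simpa using hF) (by fun_prop)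
  filter_upwards [self_mem_nhdsWithin] with z hne
  have h0 : z - a ≠ 0 := sub_ne_zero.2 hne
  have h1 := e (z - a)
  simp only [iteratedDeriv_comp_const_add, add_zero, smul_eq_mul, add_sub_cancel] at h1
  rw [h1, add_div, mul_div_cancel_left₀ _ (pow_ne_zero _ h0), princ, Finset.sum_div,
    ← Finset.sum_range_reflect]
  rw [sub_eq_iff_eq_add, neg_add_cancel_comm_assoc]
  refine Finset.sum_congr rfl fun j hj => ?_
  have hj' : j ≤ m := by simpa [Nat.lt_succ_iff] using hj
  have e1 : m - (m + 1 - 1 - j) = j := by omega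
  have e2 : m + 1 - 1 - j + 1 = m + 1 - j := by omega
  rw [e1, e2]
  have : (z - a) ^ (m + 1) = (z - a) ^ (m + 1 - j) * (z - a) ^ j := by
    rw [← pow_add]; congr 1; omega
  rw [this]
  have := Nat.factorial_ne_zero j
  field_simp

theorem iteratedDeriv_inv_const_sub (n : ℕ) (z a : ℂ) :
    iteratedDeriv n (fun ν => (z - ν)⁻¹) a = n.factorial * ((z - a) ^ (n + 1))⁻¹ := by
  have := congrFun (iteratedDeriv_comp_const_sub n (Inv.inv : ℂ → ℂ) z) a
  rw [this, iteratedDeriv_eq_iterate, iter_deriv_inv, smul_eq_mul]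
  have e : (-1 - n : ℤ) = -((n + 1 : ℕ) : ℤ) := by push_cast; ring
  rw [e, zpow_neg, zpow_natCast, ← mul_assoc, ← mul_assoc, ← mul_pow]
  simp

/-- Leibniz' rule, since the derivatives of `(z - ν)⁻¹` in `ν` are factorials times inverse powers
of `z - ν`. It identifies the parameter derivatives in `G₁` and `G₂` with principal parts. -/
theorem iteratedDeriv_div_const_sub {g : ℂ → ℂ} {a : ℂ} (hg : AnalyticAt ℂ g a) (m : ℕ) {z : ℂ}
    (h : z ≠ a) :
    iteratedDeriv m (fun ν => g ν / (z - ν)) a = m.factorial * princ a m g z := by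
  have hi : AnalyticAt ℂ (fun ν => (z - ν)⁻¹) a :=
    AnalyticAt.fun_inv (by fun_prop) (sub_ne_zero.2 h)
  simp only [div_eq_mul_inv]
  rw [iteratedDeriv_fun_mul hg.contDiffAt hi.contDiffAt, princ, ← Finset.sum_range_reflect,
    Finset.mul_sum]
  refine Finset.sum_congr rfl fun j hj => ?_
  have hj' : j ≤ m := by simpa [Nat.lt_succ_iff] using hj
  have e0 : m + 1 - 1 - j = m - j := by omega
  have e1 : m - (m - j) = j := by omega
  rw [e0, iteratedDeriv_inv_const_sub, e1, Nat.cast_choose ℂ (Nat.sub_le m j), e1]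
  have h1 := Nat.factorial_ne_zero j
  have h2 := Nat.factorial_ne_zero (m - j)
  field_simp

theorem princ_sum {ι : Type*} (s : Finset ι) {G : ι → ℂ → ℂ} {a : ℂ} (m : ℕ)
    (h : ∀ i ∈ s, AnalyticAt ℂ (G i) a) (z : ℂ) :
    princ a m (fun y => ∑ i ∈ s, G i y) z = ∑ i ∈ s, princ a m (G i) z := by
  unfold princ
  rw [Finset.sum_comm]
  refine Finset.sum_congr rfl fun n _ => ?_
  rw [iteratedDeriv_fun_sum fun i hi => (h i hi).contDiffAt, Finset.sum_div, Finset.sum_mul]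

theorem princ_neg {g : ℂ → ℂ} {a : ℂ} (m : ℕ) (z : ℂ) :
    princ a m (fun y => -g y) z = -princ a m g z := by
  simp [princ, neg_div]

theorem analyticAt_princ {g : ℂ → ℂ} {a : ℂ} {m : ℕ} {z : ℂ} (h : z ≠ a) :
    AnalyticAt ℂ (princ a m g) z := by
  unfold princ
  refine Finset.analyticAt_fun_sum _ fun n _ => analyticAt_const.fun_mul (AnalyticAt.fun_inv
    (by fun_prop) (pow_ne_zero _ (sub_ne_zero.2 h)))

end

/-! ### Liouville's theorem, rows, and the vanishing lemma. -/

noncomputable section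

/-- The filter of non-real complex numbers tending to infinity. -/
def nonrealAtInfinity : Filter ℂ := Bornology.cobounded ℂ ⊓ 𝓟 {z : ℂ | z.im ≠ 0}

/-- The function `g` with its removable singularities removed. -/
def fill (g : ℂ → ℂ) (z : ℂ) : ℂ := limUnder (𝓝[≠] z) g

/-- At a point `y ≠ a` close to `a`, `g` agrees with `h` around `y` as well, so the limit that
defines `fill g` is `h y` on a full neighbourhood and not only at `a`. -/
theorem fill_eventuallyEq {g h : ℂ → ℂ} {a : ℂ} (hh : AnalyticAt ℂ h a) (e : g =ᶠ[𝓝[≠] a] h) :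
    fill g =ᶠ[𝓝 a] h := by
  have key : ∀ y, AnalyticAt ℂ h y → g =ᶠ[𝓝[≠] y] h → fill g y = h y := fun y hy ey =>
    Tendsto.limUnder_eq ((hy.continuousAt.tendsto.mono_left nhdsWithin_le_nhds).congr' ey.symm)
  have e3 := eventually_eventually_nhdsWithin.2 e
  rw [eventually_nhdsWithin_iff] at e3
  filter_upwards [hh.eventually_analyticAt, e3] with y hy h3
  refine key y hy ?_
  rcases eq_or_ne y a with rfl | hne
  · exact e
  · have := h3 hne
    rw [isOpen_compl_singleton.nhdsWithin_eq hne] at this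
    exact this.filter_mono nhdsWithin_le_nhds

theorem RegAt.analyticAt_fill {g : ℂ → ℂ} {a : ℂ} (h : RegAt g a) : AnalyticAt ℂ (fill g) a := by
  obtain ⟨k, hk, e⟩ := h
  exact hk.congr (fill_eventuallyEq hk e).symm

theorem RegAt.eventuallyEq_fill {g : ℂ → ℂ} {a : ℂ} (h : RegAt g a) : g =ᶠ[𝓝[≠] a] fill g := by
  obtain ⟨k, hk, e⟩ := h
  exact e.trans ((fill_eventuallyEq hk e).symm.filter_mono nhdsWithin_le_nhds)

theorem RegAt.tendsto_fill {g : ℂ → ℂ} {a : ℂ} (h : RegAt g a) :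
    Tendsto g (𝓝[≠] a) (𝓝 (fill g a)) :=
  (h.analyticAt_fill.continuousAt.tendsto.mono_left nhdsWithin_le_nhds).congr'
    h.eventuallyEq_fill.symm

theorem tendsto_add_mul_I_nhdsNE (z : ℂ) :
    Tendsto (fun ε : ℝ => z + ε * Complex.I) (𝓝[>] 0) (𝓝[≠] z) := by
  refine tendsto_nhdsWithin_iff.2 ⟨?_, ?_⟩
  · have : Continuous fun ε : ℝ => z + ε * Complex.I := by fun_prop
    simpa using (this.tendsto 0).mono_left nhdsWithin_le_nhds
  · filter_upwards [self_mem_nhdsWithin] with ε hε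
    have : (0 : ℝ) < ε := hε
    simp [this.ne']

/-- **Liouville's theorem** for functions with removable singularities and a limit at infinity off
the real line. -/
theorem eventuallyEq_const_of_tendsto {g : ℂ → ℂ} {L : ℂ} (h : ∀ z, RegAt g z)
    (ht : Tendsto g nonrealAtInfinity (𝓝 L)) (z : ℂ) : g =ᶠ[𝓝[≠] z] fun _ => L := by
  have hd : Differentiable ℂ (fill g) := fun z => (h z).analyticAt_fill.differentiableAt
  have hT : Tendsto (fill g) (cocompact ℂ) (𝓝 L) := by
    rw [← Metric.cobounded_eq_cocompact, Metric.tendsto_nhds]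
    intro ε hε
    have h1 := (Metric.tendsto_nhds.1 ht) (ε / 2) (by positivity)
    rw [nonrealAtInfinity, eventually_inf_principal, (Metric.hasBasis_cobounded_compl_closedBall (0 : ℂ)).eventually_iff] at h1
    obtain ⟨R, -, hR⟩ := h1
    filter_upwards [(Metric.hasBasis_cobounded_compl_closedBall (0 : ℂ)).mem_of_mem (i := R) trivial]
      with y hy
    -- The limit at infinity is known off the real line only, so a possibly real point `y` is
    -- approached vertically; `hnr` keeps the approximating points non-real.
    have h2 := ((h y).tendsto_fill.comp (tendsto_add_mul_I_nhdsNE y)).dist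
      (tendsto_const_nhds (x := L))
    refine lt_of_le_of_lt (le_of_tendsto h2 ?_) (half_lt_self hε)
    have hnr : ∀ᶠ ε : ℝ in 𝓝[>] 0, ε ≠ -y.im := by
      rcases lt_or_ge 0 (-y.im) with h0 | h0
      · filter_upwards [Ioo_mem_nhdsGT h0] with e he using he.2.ne
      · filter_upwards [self_mem_nhdsWithin] with e he
        exact (lt_of_le_of_lt h0 he).ne'
    have hU := (((tendsto_add_mul_I_nhdsNE y).mono_right nhdsWithin_le_nhds).eventually
      (Metric.isClosed_closedBall.isOpen_compl.mem_nhds hy))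
    filter_upwards [hU, hnr] with e he hne
    refine (hR he ?_).le
    simp only [Set.mem_ofPred_eq, Complex.add_im, Complex.mul_im, Complex.ofReal_re, Complex.I_im,
      mul_one, Complex.ofReal_im, Complex.I_re, mul_zero, add_zero]
    intro h0
    exact hne (by linarith)
  have := fun z => hd.apply_eq_of_tendsto_cocompact z hT
  filter_upwards [(h z).eventuallyEq_fill] with y hy
  rw [hy, this]

theorem tendsto_conj_nonrealAtInfinity :
    Tendsto (fun z : ℂ => conj z) nonrealAtInfinity nonrealAtInfinity := by
  refine tendsto_inf.2 ⟨?_, ?_⟩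
  · refine Tendsto.mono_left ?_ inf_le_left
    rw [← tendsto_norm_atTop_iff_cobounded]
    simpa using tendsto_norm_cobounded_atTop
  · refine tendsto_principal.2 ?_
    filter_upwards [mem_inf_of_right (mem_principal_self _)] with z hz
    simpa using hz

theorem tendsto_inv_nonrealAtInfinity :
    Tendsto (fun z : ℂ => z⁻¹) nonrealAtInfinity (𝓝 0) :=
  tendsto_inv₀_cobounded.mono_left inf_le_left

theorem eventually_ne_nonrealAtInfinity (c : ℂ) : ∀ᶠ z in nonrealAtInfinity, z ≠ c :=
  Filter.Eventually.filter_mono inf_le_left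
    (Bornology.eventually_ne_cobounded c)

/-- `g = O(1/λ)` at infinity, off the real line. -/
def Decays (g : ℂ → ℂ) : Prop := g =O[nonrealAtInfinity] fun z : ℂ => z⁻¹

namespace Decays

variable {g g' : ℂ → ℂ}

theorem tendsto (h : Decays g) : Tendsto g nonrealAtInfinity (𝓝 0) :=
  h.trans_tendsto tendsto_inv_nonrealAtInfinity

theorem conj_conj (h : Decays g) : Decays fun z => conj (g (conj z)) := by
  have := Asymptotics.IsBigO.comp_tendsto h tendsto_conj_nonrealAtInfinity
  rw [← Asymptotics.isBigO_norm_norm] at this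
  rw [Decays, ← Asymptotics.isBigO_norm_norm]
  simpa [Function.comp_def] using this

theorem add (h : Decays g) (h' : Decays g') : Decays fun z => g z + g' z :=
  Asymptotics.IsBigO.add h h'

theorem sub (h : Decays g) (h' : Decays g') : Decays fun z => g z - g' z :=
  Asymptotics.IsBigO.sub h h'

theorem const_mul (h : Decays g) (c : ℂ) : Decays fun z => c * g z :=
  Asymptotics.IsBigO.const_mul_left h c

theorem congr (h : Decays g) (e : g' =ᶠ[nonrealAtInfinity] g) : Decays g' :=
  Asymptotics.IsBigO.congr' h e.symm EventuallyEq.rfl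

theorem sum {ι : Type*} (s : Finset ι) {G : ι → ℂ → ℂ} (h : ∀ i ∈ s, Decays (G i)) :
    Decays fun z => ∑ i ∈ s, G i z :=
  Asymptotics.IsBigO.fun_sum h

theorem mul_of_tendsto {c : ℂ} (h : Decays g) (h' : Tendsto g' nonrealAtInfinity (𝓝 c)) :
    Decays fun z => g z * g' z := by
  have := Asymptotics.IsBigO.mul h (h'.isBigO_one ℂ)
  simpa [Decays] using this

theorem inv_mul_of_tendsto {c : ℂ} (h' : Tendsto g' nonrealAtInfinity (𝓝 c)) :
    Decays fun z => z⁻¹ * g' z :=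
  mul_of_tendsto (Asymptotics.isBigO_refl _ _) h'

end Decays

/-- A row of the (reflectionless) Riemann--Hilbert problem without normalization: `n₁`, `n₂` are
regular away from the points `b k`, `a k`, respectively, and satisfy the residue conditions with
weights `w₁`, `w₂` there. -/
structure IsRow {N : ℕ} (a b : Fin N → ℂ) (m : Fin N → ℕ) (w₁ w₂ n₁ n₂ : ℂ → ℂ) : Prop where
  reg₁ : ∀ z, (∀ k, z ≠ b k) → RegAt n₁ z
  reg₂ : ∀ z, (∀ k, z ≠ a k) → RegAt n₂ z
  pole₂ : ∀ k, RegAt (fun z => n₂ z - w₁ z * n₁ z / (z - a k) ^ (m k + 1)) (a k)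
  pole₁ : ∀ k, RegAt (fun z => n₁ z - w₂ z * n₂ z / (z - b k) ^ (m k + 1)) (b k)

namespace IsRow

variable {N : ℕ} {a b : Fin N → ℂ} {m : Fin N → ℕ} {w₁ w₂ n₁ n₂ n₁' n₂' : ℂ → ℂ}

theorem swap (h : IsRow a b m w₁ w₂ n₁ n₂) : IsRow b a m w₂ w₁ n₂ n₁ :=
  ⟨h.reg₂, h.reg₁, h.pole₁, h.pole₂⟩

theorem add (h : IsRow a b m w₁ w₂ n₁ n₂) (h' : IsRow a b m w₁ w₂ n₁' n₂') :
    IsRow a b m w₁ w₂ (fun z => n₁ z + n₁' z) (fun z => n₂ z + n₂' z) where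
  reg₁ z hz := (h.reg₁ z hz).add (h'.reg₁ z hz)
  reg₂ z hz := (h.reg₂ z hz).add (h'.reg₂ z hz)
  pole₁ k := ((h.pole₁ k).add (h'.pole₁ k)).congr (Eventually.of_forall fun z => by ring)
  pole₂ k := ((h.pole₂ k).add (h'.pole₂ k)).congr (Eventually.of_forall fun z => by ring)

theorem mul {g : ℂ → ℂ} (hg : ∀ z, RegAt g z) (h : IsRow a b m w₁ w₂ n₁ n₂) :
    IsRow a b m w₁ w₂ (fun z => g z * n₁ z) (fun z => g z * n₂ z) where
  reg₁ z hz := (hg z).mul (h.reg₁ z hz)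
  reg₂ z hz := (hg z).mul (h.reg₂ z hz)
  pole₁ k := ((hg _).mul (h.pole₁ k)).congr (Eventually.of_forall fun z => by ring)
  pole₂ k := ((hg _).mul (h.pole₂ k)).congr (Eventually.of_forall fun z => by ring)

theorem const_mul (c : ℂ) (h : IsRow a b m w₁ w₂ n₁ n₂) :
    IsRow a b m w₁ w₂ (fun z => c * n₁ z) (fun z => c * n₂ z) :=
  h.mul fun _ => RegAt.const c

theorem sub (h : IsRow a b m w₁ w₂ n₁ n₂) (h' : IsRow a b m w₁ w₂ n₁' n₂') :
    IsRow a b m w₁ w₂ (fun z => n₁ z - n₁' z) (fun z => n₂ z - n₂' z) := by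
  simpa [sub_eq_add_neg] using h.add (h'.const_mul (-1))

/-- A determinant does not change when a multiple of one column is subtracted from the other. At `a
k` the multiple `w₁ / (z - a k)^(m k + 1)` of the first column removes the pole of the second, and
symmetrically at `b k`. -/
theorem regAt_det (hab : ∀ k l, a k ≠ b l) (h : IsRow a b m w₁ w₂ n₁ n₂)
    (h' : IsRow a b m w₁ w₂ n₁' n₂') (z : ℂ) :
    RegAt (fun z => n₁ z * n₂' z - n₂ z * n₁' z) z := by
  by_cases ha : ∃ k, z = a k
  · obtain ⟨k, rfl⟩ := ha
    have h1 := h.reg₁ (a k) (hab k)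
    have h1' := h'.reg₁ (a k) (hab k)
    exact ((h1.mul (h'.pole₂ k)).sub ((h.pole₂ k).mul h1')).congr
      (Eventually.of_forall fun z => by ring)
  by_cases hb : ∃ k, z = b k
  · obtain ⟨k, rfl⟩ := hb
    have h1 := h.reg₂ (b k) fun l => (hab l k).symm
    have h1' := h'.reg₂ (b k) fun l => (hab l k).symm
    exact (((h.pole₁ k).mul h1').sub (h1.mul (h'.pole₁ k))).congr
      (Eventually.of_forall fun z => by ring)
  push Not at ha hb
  exact ((h.reg₁ z hb).mul (h'.reg₂ z ha)).sub ((h.reg₂ z ha).mul (h'.reg₁ z hb))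

/-- At `a k` the poles come from `n₂` and from the reflection of `n₁'`. Their singular parts carry
the factors `z w₁` and `-(z w₁)`, by the symmetry of the weights, and cancel. -/
theorem regAt_pairing (hab : ∀ k l, a k ≠ conj (a l))
    (hw : ∀ z, w₂ z = -(z * conj (w₁ (conj z))))
    (h : IsRow a (fun k => conj (a k)) m w₁ w₂ n₁ n₂)
    (h' : IsRow a (fun k => conj (a k)) m w₁ w₂ n₁' n₂') (z : ℂ) :
    RegAt (fun z => n₁ z * conj (n₁' (conj z)) + z * (n₂ z * conj (n₂' (conj z)))) z := by
  have key : ∀ {n₁ n₂ n₁' n₂' : ℂ → ℂ}, IsRow a (fun k => conj (a k)) m w₁ w₂ n₁ n₂ →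
      IsRow a (fun k => conj (a k)) m w₁ w₂ n₁' n₂' → ∀ k,
      RegAt (fun z => n₁ z * conj (n₁' (conj z)) + z * (n₂ z * conj (n₂' (conj z)))) (a k) := by
    intro n₁ n₂ n₁' n₂' h h' k
    have h1 := h.reg₁ (a k) (hab k)
    have h2 := (h'.reg₂ (conj (a k)) fun l => (hab l k).symm).conj_conj
    have h3 := (h'.pole₁ k).conj_conj
    refine ((h1.mul h3).add ((RegAt.of_analyticAt analyticAt_id).mul
      ((h.pole₂ k).mul h2))).congr (Eventually.of_forall fun z => ?_)
    simp only [hw, map_sub, map_mul, map_div₀, map_pow, map_neg, Complex.conj_conj, id]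
    ring
  by_cases hza : ∃ k, z = a k
  · obtain ⟨k, rfl⟩ := hza
    exact key h h' k
  by_cases hzb : ∃ k, z = conj (a k)
  · obtain ⟨k, rfl⟩ := hzb
    -- Reflection `g ↦ g^*` exchanges the two rows in the pairing, so the conjugate points reduce to
    -- the points `a k`.
    have := key h' h k
    rw [← Complex.conj_conj (a k)] at this
    refine this.conj_conj.congr (Eventually.of_forall fun z => ?_)
    simp only [map_add, map_mul, Complex.conj_conj]
    ring
  push Not at hza hzb
  have hza' : ∀ k, conj z ≠ conj (a k) := fun k e => hza k ((starRingEnd ℂ).injective e)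
  have hzb' : ∀ k, conj z ≠ a k := fun k e => hzb k (by rw [← e, Complex.conj_conj])
  exact ((h.reg₁ z hzb).mul (h'.reg₁ _ hza').conj_conj).add
    ((RegAt.of_analyticAt analyticAt_id).mul ((h.reg₂ z hza).mul (h'.reg₂ _ hzb').conj_conj))

end IsRow

/-- The identity theorem: the plane without finitely many points is connected, and the zeros on the
positive half-line accumulate at the point `1`, which is not a pole. -/
theorem eventuallyEq_zero_of_fill_eq_zero {N : ℕ} {b : Fin N → ℂ} (hb : ∀ k, (b k).im ≠ 0)
    {n : ℂ → ℂ} (h : ∀ z, (∀ k, z ≠ b k) → RegAt n z) (h0 : ∀ s : ℝ, 0 < s → fill n s = 0)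
    (z : ℂ) (hz : ∀ k, z ≠ b k) : n =ᶠ[𝓝[≠] z] 0 := by
  have hset : ∀ y, y ∈ (Set.range b)ᶜ ↔ ∀ k, y ≠ b k := by simp [eq_comm]
  have hA : AnalyticOnNhd ℂ (fill n) (Set.range b)ᶜ := fun y hy =>
    (h y ((hset y).1 hy)).analyticAt_fill
  have hP : IsPreconnected (Set.range b)ᶜ :=
    ((Set.countable_range b).isPathConnected_compl_of_one_lt_rank
      (by simp [Complex.rank_real_complex])).isConnected.isPreconnected
  have h1 : (1 : ℂ) ∈ (Set.range b)ᶜ := by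
    rw [hset]; intro k e; exact hb k (by rw [← e]; simp)
  have hF : ∃ᶠ y in 𝓝[≠] (1 : ℂ), fill n y = 0 := by
    have ht : Tendsto (fun s : ℝ => (s : ℂ)) (𝓝[>] 1) (𝓝[≠] 1) := by
      refine tendsto_nhdsWithin_iff.2 ⟨?_, ?_⟩
      · simpa using (Complex.continuous_ofReal.tendsto 1).mono_left nhdsWithin_le_nhds
      · filter_upwards [self_mem_nhdsWithin] with s hs
        have : (1 : ℝ) < s := hs
        simpa using this.ne'
    refine ht.frequently (Eventually.frequently ?_)
    filter_upwards [self_mem_nhdsWithin] with s hs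
    exact h0 s (lt_trans one_pos hs)
  have hE := hA.eqOn_zero_of_preconnected_of_frequently_eq_zero hP h1 hF
  have hO : IsOpen (Set.range b)ᶜ := (Set.finite_range b).isClosed.isOpen_compl
  filter_upwards [(h z hz).eventuallyEq_fill, mem_nhdsWithin_of_mem_nhds
    (hO.mem_nhds ((hset z).2 hz))] with y hy hy'
  rw [hy, hE hy']

/-- The vanishing lemma. The pairing of the row with itself has only removable singularities and
tends to zero at infinity: its second term is of size `z · z⁻²`. Hence it is zero, and positivity on
a half-line finishes the argument. -/
theorem IsRow.eventuallyEq_zero {N : ℕ} {a : Fin N → ℂ} {m : Fin N → ℕ} {w₁ w₂ n₁ n₂ : ℂ → ℂ}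
    (ha : ∀ k, 0 < (a k).im)
    (hw : ∀ z, w₂ z = -(z * conj (w₁ (conj z))))
    (h : IsRow a (fun k => conj (a k)) m w₁ w₂ n₁ n₂) (h1 : Decays n₁) (h2 : Decays n₂) :
    (∀ z, (∀ k, z ≠ conj (a k)) → n₁ =ᶠ[𝓝[≠] z] 0) ∧
      ∀ z, (∀ k, z ≠ a k) → n₂ =ᶠ[𝓝[≠] z] 0 := by
  have hab : ∀ k l, a k ≠ conj (a l) := fun k l e => by
    have := congrArg Complex.im e
    simp only [Complex.conj_im] at this
    linarith [ha k, ha l]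
  have hP := eventuallyEq_const_of_tendsto (L := 0)
    (h.regAt_pairing hab hw h) (by
      have t1 : Tendsto (fun z => n₁ z * conj (n₁ (conj z))) nonrealAtInfinity (𝓝 0) := by
        simpa using h1.tendsto.mul h1.conj_conj.tendsto
      have t2 : Tendsto (fun z => z * (n₂ z * conj (n₂ (conj z)))) nonrealAtInfinity (𝓝 0) := by
        have := Asymptotics.IsBigO.mul (Asymptotics.isBigO_refl (fun z : ℂ => z) nonrealAtInfinity)
          (Asymptotics.IsBigO.mul h2 h2.conj_conj)
        refine (this.trans (Asymptotics.IsBigO.of_bound 1 ?_)).trans_tendsto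
          tendsto_inv_nonrealAtInfinity
        filter_upwards [eventually_ne_nonrealAtInfinity 0] with z hz
        rw [← mul_assoc, mul_inv_cancel₀ hz]
        simp
      simpa using t1.add t2)
  -- Conjugation fixes `s`, so the pairing is `|n₁|² + s |n₂|²` there. The form is indefinite for `s
  -- < 0`, so only positive `s` can be used.
  have hreal : ∀ s : ℝ, 0 < s → fill n₁ s = 0 ∧ fill n₂ s = 0 := by
    intro s hs
    have ra : ∀ k, (s : ℂ) ≠ a k := fun k e => (ha k).ne' (by rw [← e]; simp)
    have rb : ∀ k, (s : ℂ) ≠ conj (a k) := fun k e => (ha k).ne' (by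
      have := congrArg Complex.im e; simpa using this.symm)
    have c1 := (h.reg₁ s rb).tendsto_fill
    have c2 := (h.reg₂ s ra).tendsto_fill
    have hcj : Tendsto (fun z : ℂ => conj z) (𝓝[≠] (s : ℂ)) (𝓝[≠] (s : ℂ)) := by
      simpa using tendsto_conj_nhdsNE (s : ℂ)
    have d1 := (Complex.continuous_conj.tendsto _).comp (c1.comp hcj)
    have d2 := (Complex.continuous_conj.tendsto _).comp (c2.comp hcj)
    have hid : Tendsto (fun z : ℂ => z) (𝓝[≠] (s : ℂ)) (𝓝 s) := nhdsWithin_le_nhds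
    have hlim := (c1.mul d1).add (hid.mul (c2.mul d2))
    have h0 : Tendsto (fun _ : ℂ => (0 : ℂ)) (𝓝[≠] (s : ℂ)) (𝓝 0) := tendsto_const_nhds
    have heq := tendsto_nhds_unique (hlim.congr' (hP s)) h0
    rw [Complex.mul_conj, Complex.mul_conj] at heq
    have heq' : Complex.normSq (fill n₁ s) + s * Complex.normSq (fill n₂ s) = 0 := by
      exact_mod_cast heq
    have p1 := Complex.normSq_nonneg (fill n₁ s)
    have p2 := mul_nonneg hs.le (Complex.normSq_nonneg (fill n₂ s))
    constructor
    · exact Complex.normSq_eq_zero.1 (by linarith)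
    · have : s * Complex.normSq (fill n₂ s) = 0 := by linarith
      exact Complex.normSq_eq_zero.1 ((mul_eq_zero.1 this).resolve_left hs.ne')
  exact ⟨eventuallyEq_zero_of_fill_eq_zero (fun k => by simpa using (ha k).ne') h.reg₁
      fun s hs => (hreal s hs).1,
    eventuallyEq_zero_of_fill_eq_zero (fun k => (ha k).ne') h.reg₂ fun s hs => (hreal s hs).2⟩

end

/-! ### The linear system for the partial fraction coefficients. -/

noncomputable section

/-- The index set of the coefficients of the principal parts of order `m k + 1`, `k < N`. -/
abbrev Idx {N : ℕ} (m : Fin N → ℕ) : Type := Σ k : Fin N, Fin (m k + 1)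

variable {N : ℕ} {a b : Fin N → ℂ} {m : Fin N → ℕ}

/-- The elementary fraction `(z - a k)^(-(n+1))`. -/
def frac (a : Fin N → ℂ) (m : Fin N → ℕ) (i : Idx m) (z : ℂ) : ℂ :=
  ((z - a i.1) ^ (i.2.1 + 1))⁻¹

/-- The partial fraction sum with coefficients `c`. -/
def partialFrac (a : Fin N → ℂ) (m : Fin N → ℕ) (c : Idx m → ℂ) (z : ℂ) : ℂ :=
  ∑ i, c i * frac a m i z

/-- The Taylor coefficients of `g` at the points `a k`, up to order `m k`, in descending order. -/
def jet (a : Fin N → ℂ) (m : Fin N → ℕ) (g : ℂ → ℂ) (i : Idx m) : ℂ :=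
  iteratedDeriv (m i.1 - i.2.1) g (a i.1) / ((m i.1 - i.2.1).factorial : ℂ)

theorem partialFrac_jet (g : ℂ → ℂ) (z : ℂ) :
    partialFrac a m (jet a m g) z = ∑ k, princ (a k) (m k) g z := by
  unfold partialFrac princ
  rw [Fintype.sum_sigma]
  refine Finset.sum_congr rfl fun k _ => ?_
  rw [← Fin.sum_univ_eq_sum_range (fun n => iteratedDeriv (m k - n) g (a k) /
    ((m k - n).factorial : ℂ) * ((z - a k) ^ (n + 1))⁻¹)]
  rfl

theorem jet_eq_iff {g g' : ℂ → ℂ} : jet a m g = jet a m g' ↔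
    ∀ k, ∀ j ≤ m k, iteratedDeriv j g (a k) = iteratedDeriv j g' (a k) := by
  constructor
  · intro h k j hj
    have := congrFun h ⟨k, ⟨m k - j, by omega⟩⟩
    have e : m k - (m k - j) = j := by omega
    simp only [jet, e] at this
    exact (div_left_inj' (Nat.cast_ne_zero.2 (Nat.factorial_ne_zero j))).1 this
  · intro h
    ext i
    simp only [jet]
    rw [h _ _ (Nat.sub_le _ _)]

theorem jet_congr {g g' : ℂ → ℂ} (h : ∀ k, g =ᶠ[𝓝 (a k)] g') : jet a m g = jet a m g' :=
  jet_eq_iff.2 fun k j _ => (h k).iteratedDeriv_eq j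

theorem jet_add {g g' : ℂ → ℂ} (h : ∀ k, AnalyticAt ℂ g (a k))
    (h' : ∀ k, AnalyticAt ℂ g' (a k)) :
    jet a m (fun z => g z + g' z) = jet a m g + jet a m g' := by
  ext i
  simp only [jet, Pi.add_apply]
  rw [iteratedDeriv_fun_add (h _).contDiffAt (h' _).contDiffAt, add_div]

theorem jet_const_mul (c : ℂ) (g : ℂ → ℂ) :
    jet a m (fun z => c * g z) = c • jet a m g := by
  ext i
  simp only [jet, Pi.smul_apply, smul_eq_mul]
  rw [iteratedDeriv_const_mul_field, mul_div_assoc]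

theorem jet_sum {ι : Type*} (s : Finset ι) {G : ι → ℂ → ℂ}
    (h : ∀ i ∈ s, ∀ k, AnalyticAt ℂ (G i) (a k)) :
    jet a m (fun z => ∑ i ∈ s, G i z) = ∑ i ∈ s, jet a m (G i) := by
  ext i
  simp only [jet, Finset.sum_apply]
  rw [iteratedDeriv_fun_sum fun j hj => (h j hj _).contDiffAt, Finset.sum_div]

theorem analyticAt_frac (i : Idx m) {z : ℂ} (hz : ∀ k, z ≠ a k) : AnalyticAt ℂ (frac a m i) z := by
  unfold frac
  exact AnalyticAt.fun_inv (by fun_prop) (pow_ne_zero _ (sub_ne_zero.2 (hz i.1)))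

theorem analyticAt_partialFrac (c : Idx m → ℂ) {z : ℂ} (hz : ∀ k, z ≠ a k) :
    AnalyticAt ℂ (partialFrac a m c) z := by
  unfold partialFrac
  exact Finset.analyticAt_fun_sum _ fun i _ => analyticAt_const.fun_mul (analyticAt_frac i hz)

theorem regAt_partialFrac_jet_sub (ha : Function.Injective a) {g : ℂ → ℂ} {k : Fin N}
    (hg : AnalyticAt ℂ g (a k)) :
    RegAt (fun z => partialFrac a m (jet a m g) z - g z / (z - a k) ^ (m k + 1)) (a k) := by
  classical
  have h1 : RegAt (fun z => ∑ l ∈ Finset.univ.erase k, princ (a l) (m l) g z) (a k) := by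
    refine RegAt.sum _ fun l hl => RegAt.of_analyticAt (analyticAt_princ ?_)
    exact fun e => (Finset.ne_of_mem_erase hl) (ha e).symm
  refine (h1.add (regAt_princ_sub hg (m k))).congr (Eventually.of_forall fun z => ?_)
  simp only [partialFrac_jet]
  rw [← Finset.sum_erase_add _ _ (Finset.mem_univ k)]
  ring

/-- Write `(z - a)⁻¹ = z⁻¹ (1 + a (z - a)⁻¹)`; the remaining powers of `(z - a)⁻¹` are bounded near
infinity. -/
theorem decays_frac (i : Idx m) : Decays (frac a m i) := by
  have h1 : Tendsto (fun z : ℂ => (z - a i.1)⁻¹) nonrealAtInfinity (𝓝 0) := by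
    refine tendsto_inv₀_cobounded.comp (Tendsto.mono_left ?_ inf_le_left)
    exact tendsto_sub_const_cobounded _
  have h2 : Tendsto (fun z : ℂ => 1 + a i.1 * (z - a i.1)⁻¹) nonrealAtInfinity (𝓝 1) := by
    simpa using (h1.const_mul (a i.1)).const_add 1
  have h3 := (h2.mul (h1.pow i.2.1))
  refine (Decays.inv_mul_of_tendsto h3).congr ?_
  filter_upwards [eventually_ne_nonrealAtInfinity 0, eventually_ne_nonrealAtInfinity (a i.1)]
    with z hz hza
  have : z - a i.1 ≠ 0 := sub_ne_zero.2 hza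
  simp only [frac, pow_succ, inv_pow]
  field_simp
  ring

theorem decays_partialFrac (c : Idx m → ℂ) : Decays (partialFrac a m c) :=
  Decays.sum _ fun i _ => (decays_frac i).const_mul (c i)

/-- The coefficient of `1/z` of a partial fraction sum at infinity. -/
def leadCoeff (c : Idx m → ℂ) : ℂ := ∑ k, c ⟨k, 0⟩

/-- Writing `z = (z - a) + a` lowers the order of each fraction by one and leaves a decaying term.
Only the simple poles contribute a constant. -/
theorem decays_mul_partialFrac_sub (c : Idx m → ℂ) :
    Decays fun z => z * partialFrac a m c z - leadCoeff c := by
  have key : ∀ i : Idx m, Decays fun z => z * frac a m i z - if i.2 = 0 then 1 else 0 := by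
    rintro ⟨k, ⟨n, hn⟩⟩
    rcases n with _ | n
    · refine ((decays_frac (a := a) ⟨k, ⟨0, hn⟩⟩).const_mul (a k)).congr ?_
      filter_upwards [eventually_ne_nonrealAtInfinity (a k)] with z hza
      have : z - a k ≠ 0 := sub_ne_zero.2 hza
      simp only [frac]
      simp
      field_simp
      ring
    · refine ((decays_frac (a := a) (m := m) ⟨k, ⟨n, by omega⟩⟩).add
        ((decays_frac (a := a) ⟨k, ⟨n + 1, hn⟩⟩).const_mul (a k))).congr ?_
      filter_upwards [eventually_ne_nonrealAtInfinity (a k)] with z hza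
      have : z - a k ≠ 0 := sub_ne_zero.2 hza
      have h0 : (⟨n + 1, hn⟩ : Fin (m k + 1)) ≠ 0 := by
        intro h; simpa using congrArg Fin.val h
      simp only [frac, h0, if_false]
      field_simp
      ring
  refine (Decays.sum Finset.univ fun i _ => (key i).const_mul (c i)).congr
    (Eventually.of_forall fun z => ?_)
  have : leadCoeff c = ∑ i : Idx m, c i * if i.2 = 0 then 1 else 0 := by
    rw [Fintype.sum_sigma, leadCoeff]
    refine Finset.sum_congr rfl fun k _ => ?_
    rw [Finset.sum_eq_single (0 : Fin (m k + 1))]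
    · simp
    · intro n _ hn; simp [hn]
    · simp
  simp only [this, partialFrac, Finset.mul_sum, mul_sub, Finset.sum_sub_distrib]
  congr 1
  exact Finset.sum_congr rfl fun i _ => by ring

/-- `c₁`, `c₂` are the coefficients of a row with the normalization `(δ₁, δ₂)` at infinity. -/
def IsCoeff (a b : Fin N → ℂ) (m : Fin N → ℕ) (w₁ w₂ : ℂ → ℂ) (δ₁ δ₂ : ℂ) (c₁ c₂ : Idx m → ℂ) :
    Prop :=
  c₁ = jet b m (fun z => w₂ z * (δ₂ + partialFrac a m c₂ z)) ∧
    c₂ = jet a m (fun z => w₁ z * (δ₁ + partialFrac b m c₁ z))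

/-- The matrix of the linear system for the coefficients of a row. -/
def coeffMatrix (a b : Fin N → ℂ) (m : Fin N → ℕ) (w₁ w₂ : ℂ → ℂ) :
    Matrix (Idx m ⊕ Idx m) (Idx m ⊕ Idx m) ℂ :=
  Matrix.fromBlocks 1 (-Matrix.of fun i j => jet b m (fun z => w₂ z * frac a m j z) i)
    (-Matrix.of fun i j => jet a m (fun z => w₁ z * frac b m j z) i) 1

/-- The right-hand side of the linear system for the coefficients of a row. -/
def coeffRhs (a b : Fin N → ℂ) (m : Fin N → ℕ) (w₁ w₂ : ℂ → ℂ) (δ₁ δ₂ : ℂ) :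
    Idx m ⊕ Idx m → ℂ :=
  Sum.elim (δ₂ • jet b m w₂) (δ₁ • jet a m w₁)

/-- Taylor coefficients are linear, so the residue conditions are affine equations in the
coefficients `c`, with jets of weighted fractions as matrix entries. -/
theorem jet_weight_mul {w : ℂ → ℂ} (hab : ∀ k l, a k ≠ b l) (hw : ∀ k, AnalyticAt ℂ w (a k))
    (δ : ℂ) (c : Idx m → ℂ) :
    jet a m (fun z => w z * (δ + partialFrac b m c z)) =
      δ • jet a m w + ∑ j, c j • jet a m (fun z => w z * frac b m j z) := by
  have h1 : ∀ j k, AnalyticAt ℂ (fun z => w z * frac b m j z) (a k) := fun j k =>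
    (hw k).fun_mul (analyticAt_frac j (hab k))
  have h2 : ∀ j k, AnalyticAt ℂ (fun z => c j * (w z * frac b m j z)) (a k) := fun j k =>
    analyticAt_const.fun_mul (h1 j k)
  have e : (fun z => w z * (δ + partialFrac b m c z)) =
      fun z => δ * w z + ∑ j, c j * (w z * frac b m j z) := by
    ext z
    simp only [partialFrac, mul_add, Finset.mul_sum]
    congr 1
    · ring
    · exact Finset.sum_congr rfl fun j _ => by ring
  rw [e, jet_add (fun k => analyticAt_const.fun_mul (hw k))
    (fun k => Finset.analyticAt_fun_sum _ fun j _ => h2 j k), jet_sum _ fun j _ => h2 j,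
    jet_const_mul]
  simp only [jet_const_mul]

theorem isCoeff_iff {w₁ w₂ : ℂ → ℂ} (hab : ∀ k l, a k ≠ b l) (hw₁ : ∀ k, AnalyticAt ℂ w₁ (a k))
    (hw₂ : ∀ k, AnalyticAt ℂ w₂ (b k)) {δ₁ δ₂ : ℂ} {c₁ c₂ : Idx m → ℂ} :
    IsCoeff a b m w₁ w₂ δ₁ δ₂ c₁ c₂ ↔
      (coeffMatrix a b m w₁ w₂).mulVec (Sum.elim c₁ c₂) = coeffRhs a b m w₁ w₂ δ₁ δ₂ := by
  rw [IsCoeff, jet_weight_mul (fun k l => (hab l k).symm) hw₂, jet_weight_mul hab hw₁,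
    coeffMatrix, coeffRhs, Matrix.fromBlocks_mulVec, Sum.elim_eq_iff]
  refine and_congr ?_ ?_
  · rw [← sub_eq_iff_eq_add]
    refine Eq.congr_left ?_
    ext i
    simp [Matrix.mulVec, dotProduct, sub_eq_add_neg, mul_comm]
  · rw [← sub_eq_iff_eq_add]
    refine Eq.congr_left ?_
    ext i
    simp [Matrix.mulVec, dotProduct, sub_eq_add_neg, mul_comm, add_comm]

/-- Rows with prescribed principal parts. -/
theorem isRow_of_jet {w₁ w₂ : ℂ → ℂ} (ha : Function.Injective a) (hb : Function.Injective b)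
    (hab : ∀ k l, a k ≠ b l) (hw₁ : ∀ k, AnalyticAt ℂ w₁ (a k))
    (hw₂ : ∀ k, AnalyticAt ℂ w₂ (b k)) {δ₁ δ₂ : ℂ} {c₁ c₂ : Idx m → ℂ}
    (h : IsCoeff a b m w₁ w₂ δ₁ δ₂ c₁ c₂) :
    IsRow a b m w₁ w₂ (fun z => δ₁ + partialFrac b m c₁ z)
      (fun z => δ₂ + partialFrac a m c₂ z) where
  reg₁ z hz := RegAt.of_analyticAt (analyticAt_const.fun_add (analyticAt_partialFrac _ hz))
  reg₂ z hz := RegAt.of_analyticAt (analyticAt_const.fun_add (analyticAt_partialFrac _ hz))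
  pole₂ k := by
    have := regAt_partialFrac_jet_sub (m := m) ha (k := k) ((hw₁ k).fun_mul
      (analyticAt_const.fun_add (analyticAt_partialFrac (m := m) c₁ (hab k)) : AnalyticAt ℂ
        (fun z => δ₁ + partialFrac b m c₁ z) (a k)))
    rw [← h.2] at this
    exact ((RegAt.const δ₂).add this).congr (Eventually.of_forall fun z => by ring)
  pole₁ k := by
    have := regAt_partialFrac_jet_sub (m := m) hb (k := k) ((hw₂ k).fun_mul
      (analyticAt_const.fun_add (analyticAt_partialFrac (m := m) c₂ fun l => (hab l k).symm) :
        AnalyticAt ℂ (fun z => δ₂ + partialFrac a m c₂ z) (b k)))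
    rw [← h.1] at this
    exact ((RegAt.const δ₁).add this).congr (Eventually.of_forall fun z => by ring)

theorem ne_conj_of_im_pos (ha : ∀ k, 0 < (a k).im) (k l : Fin N) : a k ≠ conj (a l) := fun e => by
  have := congrArg Complex.im e
  simp only [Complex.conj_im] at this
  linarith [ha k, ha l]

theorem eventually_eq_zero_of_eventuallyEq {n : ℂ → ℂ} {z : ℂ} (h : n =ᶠ[𝓝[≠] z] 0)
    (hc : ContinuousAt n z) : n =ᶠ[𝓝 z] 0 :=
  (hc.eventuallyEq_nhds_iff_eventuallyEq_nhdsNE continuousAt_const).1 h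

/-- A kernel vector gives a row with normalization `(0, 0)`, which decays and therefore vanishes.
Its coefficients are jets of weights times its entries, so they vanish as well. -/
theorem coeffMatrix_det_ne_zero {w₁ w₂ : ℂ → ℂ} (ha : ∀ k, 0 < (a k).im)
    (hi : Function.Injective a) (hw₁ : ∀ k, AnalyticAt ℂ w₁ (a k))
    (hw₂ : ∀ k, AnalyticAt ℂ w₂ (conj (a k)))
    (hw : ∀ z, w₂ z = -(z * conj (w₁ (conj z)))) :
    (coeffMatrix a (fun k => conj (a k)) m w₁ w₂).det ≠ 0 := by
  intro h0
  obtain ⟨v, hv, hv0⟩ := Matrix.exists_mulVec_eq_zero_iff.2 h0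
  apply hv
  let b : Fin N → ℂ := fun k => conj (a k)
  have hab := ne_conj_of_im_pos ha
  have hib : Function.Injective b := fun k l e => hi ((starRingEnd ℂ).injective e)
  have hC : IsCoeff a b m w₁ w₂ 0 0 (v ∘ Sum.inl) (v ∘ Sum.inr) := by
    rw [isCoeff_iff hab hw₁ hw₂]
    rw [Sum.elim_comp_inl_inr, coeffRhs, zero_smul, zero_smul]
    refine hv0.trans ?_
    ext i; rcases i with i | i <;> rfl
  have hz := (isRow_of_jet hi hib hab hw₁ hw₂ hC).eventuallyEq_zero ha hw
    (by simpa using decays_partialFrac _) (by simpa using decays_partialFrac _)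
  have jz : ∀ (q : Fin N → ℂ), jet q m (fun _ => 0) = 0 := fun q => by
    simpa using jet_const_mul (a := q) (m := m) 0 (fun _ => 0)
  have z1 : v ∘ Sum.inl = 0 := by
    rw [hC.1, ← jz b]
    refine jet_congr fun k => ?_
    have hk : ∀ l, b k ≠ a l := fun l => (hab l k).symm
    filter_upwards [eventually_eq_zero_of_eventuallyEq (hz.2 (b k) hk)
      (analyticAt_const.fun_add (analyticAt_partialFrac _ hk)).continuousAt] with z h
    simp only [Pi.zero_apply] at h
    rw [h, mul_zero]
  have z2 : v ∘ Sum.inr = 0 := by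
    rw [hC.2, ← jz a]
    refine jet_congr fun k => ?_
    filter_upwards [eventually_eq_zero_of_eventuallyEq (hz.1 (a k) (hab k))
      (analyticAt_const.fun_add (analyticAt_partialFrac _ (hab k))).continuousAt] with z h
    simp only [Pi.zero_apply] at h
    rw [h, mul_zero]
  rw [← Sum.elim_comp_inl_inr v, z1, z2]
  ext i; rcases i with i | i <;> rfl

/-- The coefficients of the row with normalization `(δ₁, δ₂)`, by Cramer's rule. -/
def rowCoeff (a b : Fin N → ℂ) (m : Fin N → ℕ) (w₁ w₂ : ℂ → ℂ) (δ₁ δ₂ : ℂ)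
    (i : Idx m ⊕ Idx m) : ℂ :=
  (coeffMatrix a b m w₁ w₂).det⁻¹ *
    (coeffMatrix a b m w₁ w₂).cramer (coeffRhs a b m w₁ w₂ δ₁ δ₂) i

theorem isCoeff_rowCoeff {w₁ w₂ : ℂ → ℂ} (hab : ∀ k l, a k ≠ b l)
    (hw₁ : ∀ k, AnalyticAt ℂ w₁ (a k)) (hw₂ : ∀ k, AnalyticAt ℂ w₂ (b k))
    (hdet : (coeffMatrix a b m w₁ w₂).det ≠ 0) (δ₁ δ₂ : ℂ) :
    IsCoeff a b m w₁ w₂ δ₁ δ₂ (rowCoeff a b m w₁ w₂ δ₁ δ₂ ∘ Sum.inl)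
      (rowCoeff a b m w₁ w₂ δ₁ δ₂ ∘ Sum.inr) := by
  rw [isCoeff_iff hab hw₁ hw₂, Sum.elim_comp_inl_inr]
  have e : rowCoeff a b m w₁ w₂ δ₁ δ₂ = (coeffMatrix a b m w₁ w₂).det⁻¹ •
      (coeffMatrix a b m w₁ w₂).cramer (coeffRhs a b m w₁ w₂ δ₁ δ₂) := rfl
  rw [e, Matrix.mulVec_smul, Matrix.mulVec_cramer, smul_smul, inv_mul_cancel₀ hdet, one_smul]

end

/-! ### Smooth dependence of the coefficients on `(x, t)`. -/

noncomputable section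

/-- `F` is continuously differentiable on the plane and `F'` is its derivative in the
direction `v`. -/
def HasDir (v : ℝ × ℝ) (F F' : ℝ × ℝ → ℂ) : Prop :=
  ContDiff ℝ 1 F ∧ ∀ p, fderiv ℝ F p v = F' p

namespace HasDir

variable {v : ℝ × ℝ} {F F' G G' : ℝ × ℝ → ℂ}

theorem differentiableAt (h : HasDir v F F') (p : ℝ × ℝ) : DifferentiableAt ℝ F p :=
  h.1.differentiable one_ne_zero p

theorem fderiv_eq (h : HasDir v F F') (p : ℝ × ℝ) : fderiv ℝ F p v = F' p := h.2 p

theorem exists_of_contDiff {ι : Type*} {c : ℝ × ℝ → ι → ℂ}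
    (h : ∀ i, ContDiff ℝ 1 fun p => c p i) :
    ∃ c' : ℝ × ℝ → ι → ℂ, ∀ i, HasDir v (fun p => c p i) fun p => c' p i :=
  ⟨fun p i => fderiv ℝ (fun p => c p i) p v, fun i => ⟨h i, fun _ => rfl⟩⟩

theorem unique (h : HasDir v F F') (h' : HasDir v F G') : F' = G' :=
  funext fun p => (h.2 p).symm.trans (h'.2 p)

theorem const (c : ℂ) : HasDir v (fun _ => c) fun _ => 0 :=
  ⟨contDiff_const, fun p => by simp⟩

theorem add (h : HasDir v F F') (h' : HasDir v G G') :
    HasDir v (fun p => F p + G p) fun p => F' p + G' p :=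
  ⟨h.1.add h'.1, fun p => by
    rw [fderiv_fun_add (h.differentiableAt p) (h'.differentiableAt p),
      add_apply, h.2, h'.2]⟩

theorem mul (h : HasDir v F F') (h' : HasDir v G G') :
    HasDir v (fun p => F p * G p) fun p => F' p * G p + F p * G' p :=
  ⟨h.1.mul h'.1, fun p => by
    rw [fderiv_fun_mul (h.differentiableAt p) (h'.differentiableAt p)]
    simp only [add_apply, smul_apply, h.2, h'.2,
      smul_eq_mul]
    ring⟩

theorem mul_const (h : HasDir v F F') (c : ℂ) :
    HasDir v (fun p => F p * c) fun p => F' p * c := by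
  simpa using h.mul (const c)

theorem sum {ι : Type*} (s : Finset ι) {F F' : ι → ℝ × ℝ → ℂ}
    (h : ∀ i ∈ s, HasDir v (F i) (F' i)) :
    HasDir v (fun p => ∑ i ∈ s, F i p) fun p => ∑ i ∈ s, F' i p := by
  classical
  induction s using Finset.induction_on with
  | empty => simpa using const 0
  | insert i s hi ih =>
    simp only [Finset.sum_insert hi]
    exact (h i (by simp)).add (ih fun j hj => h j (by simp [hj]))

theorem star (h : HasDir v F F') :
    HasDir v (fun p => conj (F p)) fun p => conj (F' p) := by
  refine ⟨Complex.conjCLE.contDiff.comp h.1, fun p => ?_⟩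
  have := (Complex.conjCLE.toContinuousLinearMap.hasFDerivAt.comp p
    (h.differentiableAt p).hasFDerivAt).fderiv
  have e : (fun p => starRingEnd ℂ (F p)) = ⇑Complex.conjCLE.toContinuousLinearMap ∘ F := rfl
  rw [e, this]
  simp [h.2]

theorem fst : HasDir v (fun p => (p.1 : ℂ)) fun _ => (v.1 : ℂ) := by
  refine ⟨Complex.ofRealCLM.contDiff.comp contDiff_fst, fun p => ?_⟩
  have := (Complex.ofRealCLM.hasFDerivAt.comp p (hasFDerivAt_fst (𝕜 := ℝ) (p := p))).fderiv
  have e : (fun p : ℝ × ℝ => (p.1 : ℂ)) = ⇑Complex.ofRealCLM ∘ Prod.fst := rfl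
  rw [e, this]
  simp

theorem snd : HasDir v (fun p => (p.2 : ℂ)) fun _ => (v.2 : ℂ) := by
  refine ⟨Complex.ofRealCLM.contDiff.comp contDiff_snd, fun p => ?_⟩
  have := (Complex.ofRealCLM.hasFDerivAt.comp p (hasFDerivAt_snd (𝕜 := ℝ) (p := p))).fderiv
  have e : (fun p : ℝ × ℝ => (p.2 : ℂ)) = ⇑Complex.ofRealCLM ∘ Prod.snd := rfl
  rw [e, this]
  simp

theorem cexp (h : HasDir v F F') :
    HasDir v (fun p => Complex.exp (F p)) fun p => F' p * Complex.exp (F p) := by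
  refine ⟨h.1.cexp, fun p => ?_⟩
  rw [(h.differentiableAt p).hasFDerivAt.cexp.fderiv]
  simp [h.2, mul_comm]

end HasDir

/-- The weight `g e^{x A + t B}`. -/
def expWeight (g A B : ℂ → ℂ) (p : ℝ × ℝ) (z : ℂ) : ℂ :=
  g z * Complex.exp (p.1 * A z + p.2 * B z)

theorem analyticAt_expWeight {g A B : ℂ → ℂ} {a : ℂ} (hg : AnalyticAt ℂ g a)
    (hA : AnalyticAt ℂ A a) (hB : AnalyticAt ℂ B a) (p : ℝ × ℝ) :
    AnalyticAt ℂ (expWeight g A B p) a :=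
  hg.fun_mul ((analyticAt_const.fun_mul hA).fun_add (analyticAt_const.fun_mul hB)).cexp

/-- One derivative in `z` is traded for a change of the prefactor `g` and explicit factors `x` and
`t`. This recursion allows induction on the order with `g` arbitrary. -/
theorem iteratedDeriv_succ_expWeight {g A B : ℂ → ℂ} {a : ℂ} (hg : AnalyticAt ℂ g a)
    (hA : AnalyticAt ℂ A a) (hB : AnalyticAt ℂ B a) (p : ℝ × ℝ) (j : ℕ) :
    iteratedDeriv (j + 1) (expWeight g A B p) a =
      iteratedDeriv j (expWeight (deriv g) A B p) a
      + p.1 * iteratedDeriv j (expWeight (fun z => g z * deriv A z) A B p) a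
      + p.2 * iteratedDeriv j (expWeight (fun z => g z * deriv B z) A B p) a := by
  have e : deriv (expWeight g A B p) =ᶠ[𝓝 a] fun z => expWeight (deriv g) A B p z
      + p.1 * expWeight (fun z => g z * deriv A z) A B p z
      + p.2 * expWeight (fun z => g z * deriv B z) A B p z := by
    filter_upwards [hg.eventually_analyticAt, hA.eventually_analyticAt,
      hB.eventually_analyticAt] with z h1 h2 h3
    have d1 := h1.differentiableAt.hasDerivAt
    have d2 := h2.differentiableAt.hasDerivAt
    have d3 := h3.differentiableAt.hasDerivAt
    have := (d1.fun_mul ((d2.const_mul (p.1 : ℂ)).fun_add (d3.const_mul (p.2 : ℂ))).cexp).deriv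
    unfold expWeight
    rw [this]
    ring
  have a1 := analyticAt_expWeight hg.deriv hA hB p
  have a2 := analyticAt_expWeight (hg.fun_mul hA.deriv) hA hB p
  have a3 := analyticAt_expWeight (hg.fun_mul hB.deriv) hA hB p
  rw [iteratedDeriv_succ', e.iteratedDeriv_eq,
    iteratedDeriv_fun_add (a1.fun_add (analyticAt_const.fun_mul a2)).contDiffAt
      (analyticAt_const.fun_mul a3).contDiffAt,
    iteratedDeriv_fun_add a1.contDiffAt (analyticAt_const.fun_mul a2).contDiffAt,
    iteratedDeriv_const_mul_field, iteratedDeriv_const_mul_field]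

theorem iteratedDeriv_expWeight_add {g g' A B : ℂ → ℂ} {a : ℂ} (hg : AnalyticAt ℂ g a)
    (hg' : AnalyticAt ℂ g' a) (hA : AnalyticAt ℂ A a) (hB : AnalyticAt ℂ B a) (p : ℝ × ℝ)
    (j : ℕ) :
    iteratedDeriv j (expWeight (fun z => g z + g' z) A B p) a =
      iteratedDeriv j (expWeight g A B p) a + iteratedDeriv j (expWeight g' A B p) a := by
  rw [← iteratedDeriv_fun_add (analyticAt_expWeight hg hA hB p).contDiffAt
    (analyticAt_expWeight hg' hA hB p).contDiffAt]
  congr 1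
  ext z
  simp only [expWeight]
  ring

theorem iteratedDeriv_expWeight_const_mul (c : ℂ) (g A B : ℂ → ℂ) (a : ℂ) (p : ℝ × ℝ) (j : ℕ) :
    iteratedDeriv j (expWeight (fun z => c * g z) A B p) a =
      c * iteratedDeriv j (expWeight g A B p) a := by
  rw [← iteratedDeriv_const_mul_field]
  congr 1
  ext z
  simp only [expWeight]
  ring

/-- Parameter derivatives commute with derivatives in `z`. The induction uses the recursion on both
sides, so that no general theorem on mixed derivatives is needed. -/
theorem hasDir_iteratedDeriv_expWeight {A B : ℂ → ℂ} {a : ℂ} (hA : AnalyticAt ℂ A a)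
    (hB : AnalyticAt ℂ B a) (v : ℝ × ℝ) (j : ℕ) {g : ℂ → ℂ} (hg : AnalyticAt ℂ g a) :
    HasDir v (fun p => iteratedDeriv j (expWeight g A B p) a) fun p =>
      iteratedDeriv j (expWeight (fun z => (v.1 * A z + v.2 * B z) * g z) A B p) a := by
  induction j generalizing g with
  | zero =>
    simp only [iteratedDeriv_zero, expWeight]
    refine ⟨?_, fun p => ?_⟩
    · exact ((HasDir.const (v := v) (g a)).mul
        ((HasDir.fst.mul_const (A a)).add (HasDir.snd.mul_const (B a))).cexp).1
    · rw [((HasDir.const (v := v) (g a)).mul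
        ((HasDir.fst.mul_const (A a)).add (HasDir.snd.mul_const (B a))).cexp).2]
      ring
  | succ j ih =>
    let K : ℂ → ℂ := fun z => v.1 * A z + v.2 * B z
    have hKa : AnalyticAt ℂ K a := (analyticAt_const.fun_mul hA).fun_add
      (analyticAt_const.fun_mul hB)
    have e1 : (fun p => iteratedDeriv (j + 1) (expWeight g A B p) a) = fun p =>
      iteratedDeriv j (expWeight (deriv g) A B p) a
      + p.1 * iteratedDeriv j (expWeight (fun z => g z * deriv A z) A B p) a
      + p.2 * iteratedDeriv j (expWeight (fun z => g z * deriv B z) A B p) a :=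
      funext fun p => iteratedDeriv_succ_expWeight hg hA hB p j
    rw [e1]
    have ih' : ∀ {g : ℂ → ℂ}, AnalyticAt ℂ g a → HasDir v
        (fun p => iteratedDeriv j (expWeight g A B p) a)
        fun p => iteratedDeriv j (expWeight (fun z => K z * g z) A B p) a := ih
    have hD := ((ih' hg.deriv).add (HasDir.fst.mul (ih' (hg.fun_mul hA.deriv)))).add
      (HasDir.snd.mul (ih' (hg.fun_mul hB.deriv)))
    refine ⟨hD.1, fun p => (hD.2 p).trans ?_⟩
    change _ = iteratedDeriv (j + 1) (expWeight (fun z => K z * g z) A B p) a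
    rw [iteratedDeriv_succ_expWeight (hKa.fun_mul hg) hA hB]
    have hd : deriv (fun z => K z * g z) =ᶠ[𝓝 a] fun z => K z * deriv g z
        + (v.1 * (g z * deriv A z) + v.2 * (g z * deriv B z)) := by
      filter_upwards [hg.eventually_analyticAt, hA.eventually_analyticAt,
        hB.eventually_analyticAt] with z h1 h2 h3
      have d1 := h1.differentiableAt.hasDerivAt
      have d2 := h2.differentiableAt.hasDerivAt
      have d3 := h3.differentiableAt.hasDerivAt
      rw [(((d2.const_mul (v.1 : ℂ)).fun_add (d3.const_mul (v.2 : ℂ))).fun_mul d1).deriv]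
      ring
    have hd' : expWeight (deriv fun z => K z * g z) A B p =ᶠ[𝓝 a]
        expWeight (fun z => K z * deriv g z
        + (v.1 * (g z * deriv A z) + v.2 * (g z * deriv B z))) A B p := by
      filter_upwards [hd] with z hz
      simp only [expWeight, hz]
    have gA := hg.fun_mul hA.deriv
    have gB := hg.fun_mul hB.deriv
    rw [hd'.iteratedDeriv_eq, iteratedDeriv_expWeight_add (hKa.fun_mul hg.deriv)
      ((analyticAt_const.fun_mul gA).fun_add (analyticAt_const.fun_mul gB)) hA hB,
      iteratedDeriv_expWeight_add (analyticAt_const.fun_mul gA) (analyticAt_const.fun_mul gB) hA hB,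
      iteratedDeriv_expWeight_const_mul, iteratedDeriv_expWeight_const_mul]
    have c1 : (fun z => K z * g z * deriv A z) = fun z => K z * (g z * deriv A z) := by
      ext z; ring
    have c2 : (fun z => K z * g z * deriv B z) = fun z => K z * (g z * deriv B z) := by
      ext z; ring
    rw [c1, c2]
    ring

variable {N : ℕ} {a b : Fin N → ℂ} {m : Fin N → ℕ}

/-- The family of weights `w p`, analytic at the points `a k`, depends smoothly on `p` and has the
derivative `κ w` in the direction `v`. -/
structure SmoothWeight (v : ℝ × ℝ) (a : Fin N → ℂ) (κ : ℂ → ℂ) (w : ℝ × ℝ → ℂ → ℂ) : Prop where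
  analyticAt : ∀ p k, AnalyticAt ℂ (w p) (a k)
  analyticAt_rate : ∀ k, AnalyticAt ℂ κ (a k)
  hasDir : ∀ (g : ℂ → ℂ) (k : Fin N), AnalyticAt ℂ g (a k) → ∀ j,
    HasDir v (fun p => iteratedDeriv j (fun z => w p z * g z) (a k))
      fun p => iteratedDeriv j (fun z => κ z * w p z * g z) (a k)

theorem smoothWeight_expWeight (v : ℝ × ℝ) {g A B : ℂ → ℂ} (hg : ∀ k, AnalyticAt ℂ g (a k))
    (hA : ∀ k, AnalyticAt ℂ A (a k)) (hB : ∀ k, AnalyticAt ℂ B (a k)) :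
    SmoothWeight v a (fun z => v.1 * A z + v.2 * B z) (expWeight g A B) where
  analyticAt p k := analyticAt_expWeight (hg k) (hA k) (hB k) p
  analyticAt_rate k := (analyticAt_const.fun_mul (hA k)).fun_add
    (analyticAt_const.fun_mul (hB k))
  hasDir g' k hg' j := by
    have := hasDir_iteratedDeriv_expWeight (hA k) (hB k) v j ((hg k).fun_mul hg')
    have e1 : ∀ p, (fun z => expWeight g A B p z * g' z) =
        expWeight (fun z => g z * g' z) A B p := fun p => by
      ext z; simp only [expWeight]; ring
    have e2 : ∀ p, (fun z => (v.1 * A z + v.2 * B z) * expWeight g A B p z * g' z) =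
        expWeight (fun z => (v.1 * A z + v.2 * B z) * (g z * g' z)) A B p := fun p => by
      ext z; simp only [expWeight]; ring
    simpa only [e1, e2] using this

theorem SmoothWeight.hasDir_jet {v : ℝ × ℝ} {κ : ℂ → ℂ} {w : ℝ × ℝ → ℂ → ℂ}
    (h : SmoothWeight v a κ w) {g : ℂ → ℂ} (hg : ∀ k, AnalyticAt ℂ g (a k)) (i : Idx m) :
    HasDir v (fun p => jet a m (fun z => w p z * g z) i)
      fun p => jet a m (fun z => κ z * w p z * g z) i := by
  simpa only [jet, div_eq_mul_inv] using (h.hasDir g i.1 (hg _) _).mul_const _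

theorem contDiff_det {n : Type*} [Fintype n] [DecidableEq n] {M : ℝ × ℝ → Matrix n n ℂ}
    (h : ∀ i j, ContDiff ℝ 1 fun p => M p i j) : ContDiff ℝ 1 fun p => (M p).det := by
  simp only [Matrix.det_apply']
  exact ContDiff.sum fun σ _ => contDiff_const.mul (contDiff_prod fun i _ => h _ _)

variable {v : ℝ × ℝ} {κ₁ κ₂ : ℂ → ℂ} {w₁ w₂ : ℝ × ℝ → ℂ → ℂ}

/-- By Cramer's rule the coefficients are quotients of determinants whose entries are jets of the
weights, hence C¹, and the denominator never vanishes. -/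
theorem contDiff_rowCoeff (hab : ∀ k l, a k ≠ b l)
    (h₁ : SmoothWeight v a κ₁ w₁) (h₂ : SmoothWeight v b κ₂ w₂)
    (hdet : ∀ p, (coeffMatrix a b m (w₁ p) (w₂ p)).det ≠ 0) (δ₁ δ₂ : ℂ) (i : Idx m ⊕ Idx m) :
    ContDiff ℝ 1 fun p => rowCoeff a b m (w₁ p) (w₂ p) δ₁ δ₂ i := by
  have hM : ∀ i j, ContDiff ℝ 1 fun p => coeffMatrix a b m (w₁ p) (w₂ p) i j := by
    rintro (i | i) (j | j)
    · exact contDiff_const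
    · exact (h₂.hasDir_jet (m := m) (fun k => analyticAt_frac j fun l => (hab l k).symm) i).1.neg
    · exact (h₁.hasDir_jet (m := m) (fun k => analyticAt_frac j (hab k)) i).1.neg
    · exact contDiff_const
  have hr : ∀ i, ContDiff ℝ 1 fun p => coeffRhs a b m (w₁ p) (w₂ p) δ₁ δ₂ i := by
    rintro (i | i)
    · have := (h₂.hasDir_jet (m := m) (g := fun _ => 1) (fun k => analyticAt_const) i).1
      simp only [mul_one] at this
      exact contDiff_const.mul this
    · have := (h₁.hasDir_jet (m := m) (g := fun _ => 1) (fun k => analyticAt_const) i).1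
      simp only [mul_one] at this
      exact contDiff_const.mul this
  simp only [rowCoeff, Matrix.cramer_apply]
  refine ((contDiff_det hM).inv hdet).mul (contDiff_det fun i' j => ?_)
  simp only [Matrix.updateCol_apply]
  split_ifs
  · exact hr i'
  · exact hM i' j

/-- The derivative of the coefficients of a row. -/
theorem hasDir_coeff (hab : ∀ k l, a k ≠ b l)
    (h₁ : SmoothWeight v a κ₁ w₁) {δ₁ δ₂ : ℂ} {c₁ c₂ : ℝ × ℝ → Idx m → ℂ}
    {c₁' c₂' : ℝ × ℝ → Idx m → ℂ}
    (hc : ∀ p, IsCoeff a b m (w₁ p) (w₂ p) δ₁ δ₂ (c₁ p) (c₂ p))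
    (hc₁ : ∀ i, HasDir v (fun p => c₁ p i) fun p => c₁' p i)
    (hc₂ : ∀ i, HasDir v (fun p => c₂ p i) fun p => c₂' p i) (p : ℝ × ℝ) :
    c₂' p = jet a m (fun z => κ₁ z * w₁ p z * (δ₁ + partialFrac b m (c₁ p) z)
      + w₁ p z * partialFrac b m (c₁' p) z) := by
  have hκ : ∀ p k, AnalyticAt ℂ (fun z => κ₁ z * w₁ p z) (a k) := fun p k =>
    (h₁.analyticAt_rate k).fun_mul (h₁.analyticAt p k)
  have hz : ∀ c : Idx m → ℂ, jet a m (fun z => w₁ p z * partialFrac b m c z) =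
      ∑ j, c j • jet a m (fun z => w₁ p z * frac b m j z) := fun c => by
    simpa using jet_weight_mul hab (h₁.analyticAt p) 0 c
  rw [jet_add (fun k => (hκ p k).fun_mul (analyticAt_const.fun_add
    (analyticAt_partialFrac _ (hab k)))) (fun k => (h₁.analyticAt p k).fun_mul
    (analyticAt_partialFrac _ (hab k))), jet_weight_mul hab (hκ p), hz]
  ext i
  have e : (fun p => c₂ p i) = fun p => jet a m (fun z => w₁ p z * 1) i * δ₁ +
      ∑ j, c₁ p j * jet a m (fun z => w₁ p z * frac b m j z) i := by
    ext p
    conv_lhs => rw [(hc p).2, jet_weight_mul hab (h₁.analyticAt p)]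
    simp [mul_comm]
  have h := hc₂ i
  rw [e] at h
  have h' := ((h₁.hasDir_jet (m := m) (g := fun _ => 1) (fun k => analyticAt_const) i).mul_const
    δ₁).add (HasDir.sum Finset.univ fun j _ => (hc₁ j).mul
      (h₁.hasDir_jet (m := m) (fun k => analyticAt_frac j (hab k)) i))
  -- The coefficient is a finite sum of products of differentiable functions; its derivative by the
  -- product rule must agree with the given one.
  have := congrFun (h.unique h') p
  simp only [this, mul_one, Finset.sum_add_distrib, Pi.add_apply, Pi.smul_apply, smul_eq_mul,
    Finset.sum_apply]
  ring

end

/-! ### Differentiated rows and the massive Thirring equations. -/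

noncomputable section

variable {N : ℕ} {a b : Fin N → ℂ} {m : Fin N → ℕ}

/-- Differentiating a row with respect to the parameters. -/
theorem isRow_deriv {v : ℝ × ℝ} {κ : ℂ → ℂ} {w₁ w₂ : ℝ × ℝ → ℂ → ℂ}
    (ha : Function.Injective a) (hb : Function.Injective b) (hab : ∀ k l, a k ≠ b l)
    (h₁ : SmoothWeight v a κ w₁) (h₂ : SmoothWeight v b (fun z => -κ z) w₂) {δ₁ δ₂ : ℂ}
    {c₁ c₂ c₁' c₂' : ℝ × ℝ → Idx m → ℂ}
    (hc : ∀ p, IsCoeff a b m (w₁ p) (w₂ p) δ₁ δ₂ (c₁ p) (c₂ p))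
    (hc₁ : ∀ i, HasDir v (fun p => c₁ p i) fun p => c₁' p i)
    (hc₂ : ∀ i, HasDir v (fun p => c₂ p i) fun p => c₂' p i) (p : ℝ × ℝ) {g h : ℂ → ℂ}
    (hg : ∀ z, RegAt g z) (hh : ∀ z, RegAt h z) (hgh : ∀ z ≠ 0, h z = g z * κ z)
    (ha0 : ∀ k, a k ≠ 0) (hb0 : ∀ k, b k ≠ 0) :
    IsRow a b m (w₁ p) (w₂ p) (fun z => g z * partialFrac b m (c₁' p) z)
      (fun z => g z * partialFrac a m (c₂' p) z - h z * (δ₂ + partialFrac a m (c₂ p) z)) := by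
  have hba : ∀ k l, b k ≠ a l := fun k l => (hab l k).symm
  have e₂ := hasDir_coeff hab h₁ hc hc₁ hc₂ p
  -- The same formula with the two columns exchanged, which replaces the rate `κ` by `-κ`.
  have e₁ := hasDir_coeff hba h₂ (fun p => ⟨(hc p).2, (hc p).1⟩) hc₂ hc₁ p
  have row := isRow_of_jet ha hb hab (h₁.analyticAt p) (h₂.analyticAt p) (hc p)
  have evne : ∀ y : ℂ, y ≠ 0 → ∀ᶠ z in 𝓝[≠] y, z ≠ 0 := fun y hy =>
    (eventually_ne_nhds hy).filter_mono nhdsWithin_le_nhds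
  constructor
  · intro z hz
    exact (hg z).mul (RegAt.of_analyticAt (analyticAt_partialFrac _ hz))
  · intro z hz
    exact ((hg z).mul (RegAt.of_analyticAt (analyticAt_partialFrac _ hz))).sub ((hh z).mul
      (RegAt.of_analyticAt (analyticAt_const.fun_add (analyticAt_partialFrac _ hz))))
  · intro k
    have r := regAt_partialFrac_jet_sub (m := m) ha (k := k)
      ((((h₁.analyticAt_rate k).fun_mul (h₁.analyticAt p k)).fun_mul
        (analyticAt_const.fun_add (analyticAt_partialFrac (c₁ p) (hab k)) :
          AnalyticAt ℂ (fun z => δ₁ + partialFrac b m (c₁ p) z) (a k))).fun_add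
        ((h₁.analyticAt p k).fun_mul (analyticAt_partialFrac (m := m) (c₁' p) (hab k))))
    rw [← e₂] at r
    -- Differentiating the weight adds the term `κ w₁ n₁`. Since `h = g κ`, subtracting `h n₂`
    -- removes it, because `n₂` itself has the principal part of `w₁ n₁ / (z - a k)^(m k + 1)`. The
    -- factor `g` clears a possible pole of `κ` at the origin.
    refine (((hg (a k)).mul r).sub ((hh (a k)).mul (row.pole₂ k))).congr ?_
    filter_upwards [evne _ (ha0 k)] with z hz
    rw [hgh z hz]
    ring
  · intro k
    have r := regAt_partialFrac_jet_sub (m := m) hb (k := k)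
      ((((h₂.analyticAt_rate k).fun_mul (h₂.analyticAt p k)).fun_mul
        (analyticAt_const.fun_add (analyticAt_partialFrac (c₂ p) (hba k)) :
          AnalyticAt ℂ (fun z => δ₂ + partialFrac a m (c₂ p) z) (b k))).fun_add
        ((h₂.analyticAt p k).fun_mul (analyticAt_partialFrac (m := m) (c₂' p) (hba k))))
    rw [← e₁] at r
    refine ((hg (b k)).mul r).congr ?_
    filter_upwards [evne _ (hb0 k)] with z hz
    rw [hgh z hz]
    ring

/-- The zeros at the origin absorb the pole of `z⁻¹`, which is regular at all other points, so the
residue conditions survive. This gains one order of decay at infinity. -/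
theorem IsRow.inv_mul {w₁ w₂ n₁ n₂ : ℂ → ℂ} (h : IsRow a b m w₁ w₂ n₁ n₂)
    (ha0 : ∀ k, a k ≠ 0) (hb0 : ∀ k, b k ≠ 0) (h₁ : AnalyticAt ℂ n₁ 0) (h₂ : AnalyticAt ℂ n₂ 0)
    (h₁0 : n₁ 0 = 0) (h₂0 : n₂ 0 = 0) :
    IsRow a b m w₁ w₂ (fun z => z⁻¹ * n₁ z) (fun z => z⁻¹ * n₂ z) := by
  have hinv : ∀ z : ℂ, z ≠ 0 → RegAt (fun z => z⁻¹) z := fun z hz =>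
    RegAt.of_analyticAt (analyticAt_inv hz)
  have h0 : ∀ {n : ℂ → ℂ}, AnalyticAt ℂ n 0 → n 0 = 0 → RegAt (fun z => z⁻¹ * n z) 0 := by
    intro n hn hn0
    refine ((regAt_div_pow_iff hn 1).2 fun j hj => ?_).congr
      (Eventually.of_forall fun z => by simp [div_eq_inv_mul])
    obtain rfl : j = 0 := by omega
    simpa using hn0
  constructor
  · intro z hz
    rcases eq_or_ne z 0 with rfl | hz0
    · exact h0 h₁ h₁0
    · exact (hinv z hz0).mul (h.reg₁ z hz)
  · intro z hz
    rcases eq_or_ne z 0 with rfl | hz0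
    · exact h0 h₂ h₂0
    · exact (hinv z hz0).mul (h.reg₂ z hz)
  · intro k
    exact ((hinv _ (ha0 k)).mul (h.pole₂ k)).congr (Eventually.of_forall fun z => by ring)
  · intro k
    exact ((hinv _ (hb0 k)).mul (h.pole₁ k)).congr (Eventually.of_forall fun z => by ring)

theorem eq_of_eventuallyEq_nhdsNE {f g : ℂ → ℂ} {z : ℂ} (h : f =ᶠ[𝓝[≠] z] g)
    (hf : ContinuousAt f z) (hg : ContinuousAt g z) : f z = g z :=
  ((hf.eventuallyEq_nhds_iff_eventuallyEq_nhdsNE hg).1 h).eq_of_nhds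

theorem Decays.tendsto_of_sub {g : ℂ → ℂ} {c : ℂ} (h : Decays fun z => g z - c) :
    Tendsto g nonrealAtInfinity (𝓝 c) := by
  simpa using h.tendsto.add_const c

theorem continuousAt_conj_conj {g : ℂ → ℂ} {a : ℂ} (h : ContinuousAt g (conj a)) :
    ContinuousAt (fun z => conj (g (conj z))) a :=
  Complex.continuous_conj.continuousAt.comp
    (ContinuousAt.comp (f := fun z : ℂ => conj z) h Complex.continuous_conj.continuousAt)

theorem tendsto_conj_conj {g : ℂ → ℂ} {c : ℂ} (h : Tendsto g nonrealAtInfinity (𝓝 c)) :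
    Tendsto (fun z => conj (g (conj z))) nonrealAtInfinity (𝓝 (conj c)) :=
  (Complex.continuous_conj.tendsto c).comp (h.comp tendsto_conj_nonrealAtInfinity)

/-- The determinant of a solution matrix is one. -/
theorem IsRow.det_eventuallyEq_one {w₁ w₂ n₁ n₂ n₁' n₂' : ℂ → ℂ} (hab : ∀ k l, a k ≠ b l)
    (h : IsRow a b m w₁ w₂ n₁ n₂) (h' : IsRow a b m w₁ w₂ n₁' n₂')
    (d₁ : Decays fun z => n₁ z - 1) (d₂ : Decays n₂) (d₁' : Decays n₁')
    (d₂' : Decays fun z => n₂' z - 1) (z : ℂ) :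
    (fun z => n₁ z * n₂' z - n₂ z * n₁' z) =ᶠ[𝓝[≠] z] fun _ => 1 := by
  refine eventuallyEq_const_of_tendsto (h.regAt_det hab h') ?_ z
  simpa using (d₁.tendsto_of_sub.mul d₂'.tendsto_of_sub).sub (d₂.tendsto.mul d₁'.tendsto)

/-- The algebraic relations between the values at the origin. -/
theorem IsRow.relations {w₁ w₂ n₁ n₂ n₁' n₂' : ℂ → ℂ} {β : ℂ} (ha : ∀ k, 0 < (a k).im)
    (hw : ∀ z, w₂ z = -(z * conj (w₁ (conj z))))
    (h : IsRow a (fun k => conj (a k)) m w₁ w₂ n₁ n₂)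
    (h' : IsRow a (fun k => conj (a k)) m w₁ w₂ n₁' n₂')
    (d₁ : Decays fun z => n₁ z - 1) (d₂ : Decays n₂) (d₁' : Decays n₁')
    (d₂' : Decays fun z => n₂' z - 1) (dβ : Decays fun z => z * n₂ z - β)
    (c₁ : ContinuousAt n₁ 0) (c₂ : ContinuousAt n₂ 0) (c₁' : ContinuousAt n₁' 0)
    (c₂' : ContinuousAt n₂' 0) :
    n₁ 0 * n₂' 0 - n₂ 0 * n₁' 0 = 1 ∧ n₁ 0 * conj (n₁ 0) = 1 ∧
      n₁' 0 * conj (n₁ 0) = conj β ∧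
      ∀ᶠ z in 𝓝[≠] 0, (n₁' 0 * n₁ z - n₁ 0 * n₁' z) * conj (n₁ (conj z)) =
        z * (conj (n₂ (conj z)) * (n₁ 0 * n₂' z - n₁' 0 * n₂ z)) := by
  have hab := ne_conj_of_im_pos ha
  have s₁ : ContinuousAt (fun z => conj (n₁ (conj z))) 0 := continuousAt_conj_conj (by simpa)
  have s₂ : ContinuousAt (fun z => conj (n₂ (conj z))) 0 := continuousAt_conj_conj (by simpa)
  have E1 := h.det_eventuallyEq_one hab h' d₁ d₂ d₁' d₂' 0
  have E2 := eventuallyEq_const_of_tendsto (L := 1) (h.regAt_pairing hab hw h) (by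
    have t := ((d₁.tendsto_of_sub.mul (tendsto_conj_conj d₁.tendsto_of_sub)).add
      (dβ.tendsto_of_sub.mul (tendsto_conj_conj d₂.tendsto)))
    simpa [mul_assoc] using t) 0
  -- In the pairing of the second row with the first, only `z n₂' n₂^*` survives at infinity. Its
  -- limit is `conj β`, since `z n₂` tends to `β`.
  have E3 := eventuallyEq_const_of_tendsto (L := conj β) (h'.regAt_pairing hab hw h) (by
    have t := ((d₁'.tendsto.mul (tendsto_conj_conj d₁.tendsto_of_sub)).add
      (d₂'.tendsto_of_sub.mul (tendsto_conj_conj dβ.tendsto_of_sub)))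
    simp only [map_mul, Complex.conj_conj, zero_mul, one_mul, zero_add] at t
    refine t.congr fun z => ?_
    ring) 0
  have r1 := eq_of_eventuallyEq_nhdsNE E1 (by fun_prop) continuousAt_const
  have r2 := eq_of_eventuallyEq_nhdsNE E2 (by fun_prop) continuousAt_const
  have r3 := eq_of_eventuallyEq_nhdsNE E3 (by fun_prop) continuousAt_const
  simp only [map_zero, zero_mul, add_zero] at r1 r2 r3
  refine ⟨r1, r2, r3, ?_⟩
  filter_upwards [E2, E3] with z h2 h3
  -- The combination of the two pairing identities whose constant `n₁' 0 - n₁ 0 * conj β` vanishes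
  -- by their values at the origin.
  linear_combination n₁' 0 * h2 - n₁ 0 * h3 - n₁' 0 * r2 + n₁ 0 * r3

/-- The two rows of the solution matrix as functions of the parameters, together with the
dependence of the weights on the parameters in the light-cone directions. -/
structure LaxData (a : Fin N → ℂ) (m : Fin N → ℕ) (w₁ w₂ : ℝ × ℝ → ℂ → ℂ)
    (c₁ c₂ e₁ e₂ : ℝ × ℝ → Idx m → ℂ) : Prop where
  im_pos : ∀ k, 0 < (a k).im
  injective : Function.Injective a
  symm : ∀ p z, w₂ p z = -(z * conj (w₁ p (conj z)))
  weight₁ : SmoothWeight (1, 1) a (fun z => Complex.I * z) w₁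
  weight₂ : SmoothWeight (1, 1) (fun k => conj (a k)) (fun z => -(Complex.I * z)) w₂
  weight₁' : SmoothWeight (-1, 1) a (fun z => Complex.I * z⁻¹) w₁
  weight₂' : SmoothWeight (-1, 1) (fun k => conj (a k)) (fun z => -(Complex.I * z⁻¹)) w₂
  coeff : ∀ p, IsCoeff a (fun k => conj (a k)) m (w₁ p) (w₂ p) 1 0 (c₁ p) (c₂ p)
  coeff' : ∀ p, IsCoeff a (fun k => conj (a k)) m (w₁ p) (w₂ p) 0 1 (e₁ p) (e₂ p)
  contDiff₁ : ∀ i, ContDiff ℝ 1 fun p => c₁ p i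
  contDiff₂ : ∀ i, ContDiff ℝ 1 fun p => c₂ p i
  contDiff₁' : ∀ i, ContDiff ℝ 1 fun p => e₁ p i

theorem hasDir_partialFrac {v : ℝ × ℝ} {c c' : ℝ × ℝ → Idx m → ℂ}
    (h : ∀ i, HasDir v (fun p => c p i) fun p => c' p i) (z : ℂ) :
    HasDir v (fun p => partialFrac a m (c p) z) fun p => partialFrac a m (c' p) z :=
  HasDir.sum _ fun i _ => (h i).mul_const _

theorem hasDir_leadCoeff {v : ℝ × ℝ} {c c' : ℝ × ℝ → Idx m → ℂ}
    (h : ∀ i, HasDir v (fun p => c p i) fun p => c' p i) :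
    HasDir v (fun p => leadCoeff (c p)) fun p => leadCoeff (c' p) :=
  HasDir.sum _ fun _ _ => h _

namespace LaxData

variable {w₁ w₂ : ℝ × ℝ → ℂ → ℂ} {c₁ c₂ e₁ e₂ : ℝ × ℝ → Idx m → ℂ}

theorem ne_zero (h : LaxData a m w₁ w₂ c₁ c₂ e₁ e₂) (k : Fin N) : a k ≠ 0 := fun e => by
  have := h.im_pos k
  simp [e] at this

theorem conj_ne_zero (h : LaxData a m w₁ w₂ c₁ c₂ e₁ e₂) (k : Fin N) : conj (a k) ≠ 0 :=
  (map_ne_zero _).2 (h.ne_zero k)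

theorem conj_injective (h : LaxData a m w₁ w₂ c₁ c₂ e₁ e₂) :
    Function.Injective fun k => conj (a k) :=
  fun _ _ e => h.injective ((starRingEnd ℂ).injective e)

theorem row (h : LaxData a m w₁ w₂ c₁ c₂ e₁ e₂) (p : ℝ × ℝ) :
    IsRow a (fun k => conj (a k)) m (w₁ p) (w₂ p)
      (fun z => 1 + partialFrac (fun k => conj (a k)) m (c₁ p) z)
      (fun z => partialFrac a m (c₂ p) z) := by
  simpa using isRow_of_jet h.injective h.conj_injective (ne_conj_of_im_pos h.im_pos)
    (h.weight₁.analyticAt p) (h.weight₂.analyticAt p) (h.coeff p)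

theorem row' (h : LaxData a m w₁ w₂ c₁ c₂ e₁ e₂) (p : ℝ × ℝ) :
    IsRow a (fun k => conj (a k)) m (w₁ p) (w₂ p)
      (fun z => partialFrac (fun k => conj (a k)) m (e₁ p) z)
      (fun z => 1 + partialFrac a m (e₂ p) z) := by
  simpa using isRow_of_jet h.injective h.conj_injective (ne_conj_of_im_pos h.im_pos)
    (h.weight₁.analyticAt p) (h.weight₂.analyticAt p) (h.coeff' p)

theorem analyticAt_zero (h : LaxData a m w₁ w₂ c₁ c₂ e₁ e₂) (c : Idx m → ℂ) :
    AnalyticAt ℂ (partialFrac a m c) 0 :=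
  analyticAt_partialFrac c fun k => (h.ne_zero k).symm

theorem analyticAt_zero' (h : LaxData a m w₁ w₂ c₁ c₂ e₁ e₂) (c : Idx m → ℂ) :
    AnalyticAt ℂ (partialFrac (fun k => conj (a k)) m c) 0 :=
  analyticAt_partialFrac c fun k => (h.conj_ne_zero k).symm

theorem relations (h : LaxData a m w₁ w₂ c₁ c₂ e₁ e₂) (p : ℝ × ℝ) :
    let n₁ := fun z => 1 + partialFrac (fun k => conj (a k)) m (c₁ p) z
    let n₂ := fun z => partialFrac a m (c₂ p) z
    let n₁' := fun z => partialFrac (fun k => conj (a k)) m (e₁ p) z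
    let n₂' := fun z => 1 + partialFrac a m (e₂ p) z
    n₁ 0 * n₂' 0 - n₂ 0 * n₁' 0 = 1 ∧ n₁ 0 * conj (n₁ 0) = 1 ∧
      n₁' 0 * conj (n₁ 0) = conj (leadCoeff (c₂ p)) ∧
      ∀ᶠ z in 𝓝[≠] 0, (n₁' 0 * n₁ z - n₁ 0 * n₁' z) * conj (n₁ (conj z)) =
        z * (conj (n₂ (conj z)) * (n₁ 0 * n₂' z - n₁' 0 * n₂ z)) :=
  (h.row p).relations (β := leadCoeff (c₂ p)) h.im_pos (h.symm p) (h.row' p)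
    (by simpa using decays_partialFrac _) (decays_partialFrac _) (decays_partialFrac _)
    (by simpa using decays_partialFrac _) (decays_mul_partialFrac_sub _)
    (analyticAt_const.fun_add (h.analyticAt_zero' _)).continuousAt
    (h.analyticAt_zero _).continuousAt (h.analyticAt_zero' _).continuousAt
    (analyticAt_const.fun_add (h.analyticAt_zero _)).continuousAt

/-- Let `β` be the limit of `z n₂` and `∂` the derivative along `(1, 1)`, where the rate is `iz`.
The row `(∂n₁, ∂n₂ - iz n₂)` tends to `(0, -iβ)`, so adding `iβ` times the second row gives a
decaying row, hence zero. Its second entry at the origin is the claim. -/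
theorem deriv_xi (h : LaxData a m w₁ w₂ c₁ c₂ e₁ e₂) (p : ℝ × ℝ) :
    fderiv ℝ (fun p => partialFrac a m (c₂ p) 0) p (1, 1) =
      -(Complex.I * leadCoeff (c₂ p) * (1 + partialFrac a m (e₂ p) 0)) := by
  obtain ⟨c₁', hd₁⟩ := HasDir.exists_of_contDiff (v := (1, 1)) h.contDiff₁
  obtain ⟨c₂', hd₂⟩ := HasDir.exists_of_contDiff (v := (1, 1)) h.contDiff₂
  rw [(hasDir_partialFrac hd₂ 0).fderiv_eq p]
  have R := isRow_deriv h.injective h.conj_injective (ne_conj_of_im_pos h.im_pos) h.weight₁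
    h.weight₂ h.coeff hd₁ hd₂ p (g := fun _ => 1) (h := fun z => Complex.I * z)
    (fun _ => RegAt.const 1) (fun z => RegAt.of_analyticAt (by fun_prop)) (fun z _ => by simp)
    h.ne_zero h.conj_ne_zero
  have Z := (R.add ((h.row' p).const_mul (Complex.I * leadCoeff (c₂ p)))).eventuallyEq_zero
    h.im_pos (h.symm p)
    (by simpa using (decays_partialFrac _).add ((decays_partialFrac _).const_mul _))
    (by
      refine (((decays_partialFrac (a := a) (c₂' p)).sub
        ((decays_mul_partialFrac_sub (a := a) (c₂ p)).const_mul Complex.I)).add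
        ((decays_partialFrac (a := a) (e₂ p)).const_mul (Complex.I * leadCoeff (c₂ p)))).congr
        (Eventually.of_forall fun z => ?_)
      ring)
  have A := h.analyticAt_zero (c₂' p)
  have B := h.analyticAt_zero (c₂ p)
  have C := h.analyticAt_zero (e₂ p)
  have := eq_of_eventuallyEq_nhdsNE (Z.2 0 fun k => (h.ne_zero k).symm)
    (AnalyticAt.continuousAt (𝕜 := ℂ) (by fun_prop)) continuousAt_const
  simp only [one_mul, mul_zero, zero_mul, sub_zero, Pi.zero_apply] at this
  linear_combination this

/-- Along `(-1, 1)` the rate is `i/z`, and `(z ∂n₁, z ∂n₂ - i n₂)` is a row without a pole at the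
origin. A combination of the two original rows corrects its value there to zero; division by `z`
then gives a decaying row, hence zero. The second entry at infinity yields the first equation, and
the first entry at the origin yields the second. -/
theorem deriv_eta (h : LaxData a m w₁ w₂ c₁ c₂ e₁ e₂) (p : ℝ × ℝ) :
    fderiv ℝ (fun p => leadCoeff (c₂ p)) p (-1, 1) =
        -(Complex.I * (1 + partialFrac (fun k => conj (a k)) m (c₁ p) 0)
          * partialFrac a m (c₂ p) 0) ∧
      fderiv ℝ (fun p => 1 + partialFrac (fun k => conj (a k)) m (c₁ p) 0) p (-1, 1)
          * conj (1 + partialFrac (fun k => conj (a k)) m (c₁ p) 0) =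
        Complex.I * (partialFrac a m (c₂ p) 0 * conj (partialFrac a m (c₂ p) 0)) := by
  obtain ⟨c₁', hd₁⟩ := HasDir.exists_of_contDiff (v := (-1, 1)) h.contDiff₁
  obtain ⟨c₂', hd₂⟩ := HasDir.exists_of_contDiff (v := (-1, 1)) h.contDiff₂
  rw [(hasDir_leadCoeff hd₂).fderiv_eq p, ((HasDir.const 1).add (hasDir_partialFrac hd₁ 0)).fderiv_eq p]
  obtain ⟨q1, -, -, q4⟩ := h.relations p
  have R := isRow_deriv h.injective h.conj_injective (ne_conj_of_im_pos h.im_pos) h.weight₁'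
    h.weight₂' h.coeff hd₁ hd₂ p (g := fun z => z) (h := fun _ => Complex.I)
    (fun z => RegAt.of_analyticAt (by fun_prop)) (fun _ => RegAt.const _)
    (fun z hz => by field_simp) h.ne_zero h.conj_ne_zero
  set n₁ : ℂ → ℂ := fun z => 1 + partialFrac (fun k => conj (a k)) m (c₁ p) z
  set n₂ : ℂ → ℂ := fun z => partialFrac a m (c₂ p) z
  set n₁' : ℂ → ℂ := fun z => partialFrac (fun k => conj (a k)) m (e₁ p) z
  set n₂' : ℂ → ℂ := fun z => 1 + partialFrac a m (e₂ p) z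
  -- The two constants solve the linear equations for vanishing at the origin, by inverting the
  -- matrix there with `det = 1`.
  have T := (R.add ((h.row p).const_mul (-(Complex.I * (n₂ 0 * n₁' 0))))).add
    ((h.row' p).const_mul (Complex.I * (n₁ 0 * n₂ 0)))
  have A₁ : AnalyticAt ℂ (partialFrac (fun k => conj (a k)) m (c₁' p)) 0 := h.analyticAt_zero' _
  have A₂ : AnalyticAt ℂ (partialFrac a m (c₂' p)) 0 := h.analyticAt_zero _
  have B₁ : AnalyticAt ℂ n₁ 0 := analyticAt_const.fun_add (h.analyticAt_zero' _)
  have B₂ : AnalyticAt ℂ n₂ 0 := h.analyticAt_zero _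
  have B₁' : AnalyticAt ℂ n₁' 0 := h.analyticAt_zero' _
  have B₂' : AnalyticAt ℂ n₂' 0 := analyticAt_const.fun_add (h.analyticAt_zero _)
  have b₁ := h.analyticAt_zero' (c₁ p)
  have b₂ := h.analyticAt_zero (c₂ p)
  have b₁' := h.analyticAt_zero' (e₁ p)
  have b₂' := h.analyticAt_zero (e₂ p)
  have D := T.inv_mul h.ne_zero h.conj_ne_zero (by fun_prop) (by
    simp only [zero_add]; fun_prop) (by ring) (by
    simp only [zero_add]
    linear_combination Complex.I * n₂ 0 * q1)
  have t₁ : Tendsto n₁ nonrealAtInfinity (𝓝 1) :=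
    Decays.tendsto_of_sub (by simpa [n₁] using decays_partialFrac _)
  have t₂ : Tendsto n₂ nonrealAtInfinity (𝓝 0) := (decays_partialFrac _).tendsto
  have t₁' : Tendsto n₁' nonrealAtInfinity (𝓝 0) := (decays_partialFrac _).tendsto
  have t₂' : Tendsto n₂' nonrealAtInfinity (𝓝 1) :=
    Decays.tendsto_of_sub (by simpa [n₂'] using decays_partialFrac _)
  have Z := D.eventuallyEq_zero h.im_pos (h.symm p)
    (by
      refine ((decays_partialFrac (a := fun k => conj (a k)) (c₁' p)).add
        (Decays.inv_mul_of_tendsto ((t₁.const_mul (-(Complex.I * (n₂ 0 * n₁' 0)))).add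
          (t₁'.const_mul (Complex.I * (n₁ 0 * n₂ 0)))))).congr ?_
      filter_upwards [eventually_ne_nonrealAtInfinity 0] with z hz
      field_simp
      ring)
    (by
      refine ((decays_partialFrac (a := a) (c₂' p)).add
        (Decays.inv_mul_of_tendsto (((t₂.const_mul (-Complex.I)).add
          (t₂.const_mul (-(Complex.I * (n₂ 0 * n₁' 0))))).add
          (t₂'.const_mul (Complex.I * (n₁ 0 * n₂ 0)))))).congr ?_
      filter_upwards [eventually_ne_nonrealAtInfinity 0] with z hz
      field_simp
      simp only [n₂]
      ring)
  constructor
  · have ev : ∀ᶠ z in nonrealAtInfinity, z * partialFrac a m (c₂' p) z - Complex.I * n₂ z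
        + -(Complex.I * (n₂ 0 * n₁' 0)) * n₂ z + Complex.I * (n₁ 0 * n₂ 0) * n₂' z = 0 := by
      have hall : ∀ᶠ z in nonrealAtInfinity, ∀ k, z ≠ a k :=
        eventually_all.2 fun k => eventually_ne_nonrealAtInfinity (a k)
      filter_upwards [eventually_ne_nonrealAtInfinity 0, hall] with z hz hza
      have i₁ := analyticAt_partialFrac (m := m) (c₂' p) hza
      have i₂ := analyticAt_partialFrac (m := m) (c₂ p) hza
      have i₃ := analyticAt_partialFrac (m := m) (e₂ p) hza
      have hinv : AnalyticAt ℂ (fun z : ℂ => z⁻¹) z := analyticAt_inv hz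
      have := eq_of_eventuallyEq_nhdsNE (Z.2 z hza)
        (AnalyticAt.continuousAt (𝕜 := ℂ) (by simp only [zero_add]; fun_prop)) continuousAt_const
      simp only [zero_add, Pi.zero_apply] at this
      exact (mul_eq_zero.1 this).resolve_left (inv_ne_zero hz)
    have lim := ((((decays_mul_partialFrac_sub (a := a) (c₂' p)).tendsto_of_sub).sub
      (t₂.const_mul Complex.I)).add (t₂.const_mul (-(Complex.I * (n₂ 0 * n₁' 0))))).add
      (t₂'.const_mul (Complex.I * (n₁ 0 * n₂ 0)))
    have hne : nonrealAtInfinity.NeBot := by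
      have : Tendsto (fun s : ℝ => (s : ℂ) * Complex.I) atTop nonrealAtInfinity := by
        refine tendsto_inf.2 ⟨?_, tendsto_principal.2 ?_⟩
        · rw [← tendsto_norm_atTop_iff_cobounded]
          simpa using tendsto_abs_atTop_atTop
        · filter_upwards [eventually_ne_atTop 0] with s hs
          simpa using hs
      exact this.neBot
    have := tendsto_nhds_unique (lim.congr' ev) tendsto_const_nhds
    simp only [mul_zero, sub_zero, add_zero, mul_one] at this
    linear_combination this
  -- The vanishing row expresses `z ∂n₁` by `n₁' 0 * n₁ z - n₁ 0 * n₁' z`. The last of the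
  -- `relations` exhibits a factor `z` in that difference times `n₁^*`, so `z` cancels and no
  -- derivative in `z` at the origin is needed.
  · have ev : ∀ᶠ z in 𝓝[≠] (0 : ℂ), partialFrac (fun k => conj (a k)) m (c₁' p) z
        * conj (n₁ (conj z)) =
        Complex.I * n₂ 0 * (conj (n₂ (conj z)) * (n₁ 0 * n₂' z - n₁' 0 * n₂ z)) := by
      filter_upwards [Z.1 0 fun k => (h.conj_ne_zero k).symm, q4, self_mem_nhdsWithin]
        with z hz hq hne
      have hne' : z ≠ 0 := hne
      have h1 := (mul_eq_zero.1 hz).resolve_left (inv_ne_zero hne')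
      refine mul_left_cancel₀ hne' ?_
      linear_combination conj (n₁ (conj z)) * h1 + Complex.I * n₂ 0 * hq
    have s₁ : ContinuousAt (fun z => conj (n₁ (conj z))) 0 :=
      continuousAt_conj_conj (by simpa using B₁.continuousAt)
    have s₂ : ContinuousAt (fun z => conj (n₂ (conj z))) 0 :=
      continuousAt_conj_conj (by simpa using B₂.continuousAt)
    have k₁ := A₁.continuousAt
    have k₂ := B₂.continuousAt
    have k₃ := B₂'.continuousAt
    have := eq_of_eventuallyEq_nhdsNE ev (by fun_prop) (by fun_prop)
    simp only [map_zero] at this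
    rw [zero_add]
    change partialFrac (fun k => conj (a k)) m (c₁' p) 0 * conj (n₁ 0) =
      Complex.I * (n₂ 0 * conj (n₂ 0))
    linear_combination this + Complex.I * n₂ 0 * conj (n₂ 0) * q1

theorem fderiv_add_eq {F : ℝ × ℝ → ℂ} (hF : ContDiff ℝ 1 F) (x t : ℝ) :
    deriv (fun s => F (x, s)) t + deriv (fun y => F (y, t)) x = fderiv ℝ F (x, t) (1, 1) ∧
      deriv (fun s => F (x, s)) t - deriv (fun y => F (y, t)) x = fderiv ℝ F (x, t) (-1, 1) := by
  have hd := (hF.differentiable one_ne_zero (x, t)).hasFDerivAt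
  have h1 : HasDerivAt (fun s : ℝ => (x, s)) ((0 : ℝ), (1 : ℝ)) t :=
    (hasDerivAt_const t x).prodMk (hasDerivAt_id t)
  have h2 : HasDerivAt (fun y : ℝ => (y, t)) ((1 : ℝ), (0 : ℝ)) x :=
    (hasDerivAt_id x).prodMk (hasDerivAt_const x t)
  have d1 := (hd.comp_hasDerivAt t h1).deriv
  have d2 := (hd.comp_hasDerivAt x h2).deriv
  simp only [Function.comp_def] at d1 d2
  rw [d1, d2, ← map_add, ← map_sub]
  simp

/-- The values of the solution matrix at the origin solve the massive Thirring model. -/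
theorem isMTMSolution (h : LaxData a m w₁ w₂ c₁ c₂ e₁ e₂) :
    IsMTMSolution (fun x t => conj (partialFrac a m (c₂ (x, t)) 0))
      (fun x t => partialFrac (fun k => conj (a k)) m (e₁ (x, t)) 0) := by
  obtain ⟨_, hξ⟩ := HasDir.exists_of_contDiff (v := (1, 1)) h.contDiff₂
  obtain ⟨_, hη₁⟩ := HasDir.exists_of_contDiff (v := (-1, 1)) h.contDiff₁
  obtain ⟨_, hη₂⟩ := HasDir.exists_of_contDiff (v := (-1, 1)) h.contDiff₂
  obtain ⟨_, hη₁'⟩ := HasDir.exists_of_contDiff (v := (-1, 1)) h.contDiff₁'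
  have hU := hasDir_partialFrac (a := a) hξ 0
  have hV := hasDir_partialFrac (a := fun k => conj (a k)) hη₁' 0
  have hα := (HasDir.const 1).add (hasDir_partialFrac (a := fun k => conj (a k)) hη₁ 0)
  have hβ := hasDir_leadCoeff hη₂
  have normSq : ∀ w : ℂ, (‖w‖ : ℂ) ^ 2 = w * conj w := fun w => (Complex.mul_conj' w).symm
  refine ⟨hU.star.1, hV.1, fun x t => ?_, fun x t => ?_⟩
  · have e := (fderiv_add_eq hU.star.1 x t).1
    rw [hU.star.fderiv_eq, ← hU.fderiv_eq (x, t), h.deriv_xi] at e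
    obtain ⟨q1, q2, q3, -⟩ := h.relations (x, t)
    have q1' := congrArg conj q1
    simp only [map_sub, map_mul, map_add, map_one] at q1'
    simp only [e, normSq, map_neg, map_mul, map_add, map_one, Complex.conj_I]
    simp only [map_add, map_one] at q3
    set V := partialFrac (fun k => conj (a k)) m (e₁ (x, t)) 0
    set U := partialFrac a m (c₂ (x, t)) 0
    set δ := partialFrac a m (e₂ (x, t)) 0
    -- With `α = n₁ 0` and `β = leadCoeff`, `q3` reads `V conj α = conj β`, and the conjugated
    -- determinant relation rewrites `conj α (1 + conj δ)` as `1 + conj (U V)`.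
    linear_combination conj (leadCoeff (c₂ (x, t))) * (1 + conj δ) * Complex.I_sq - V * q1'
      + (1 + conj δ) * q3
  · have e := (fderiv_add_eq hV.1 x t).2
    -- Since `n₁ 0` is unimodular, `v = n₁(0) * conj β`. This reduces the derivative of `v` to the
    -- two first-row quantities in `deriv_eta`.
    have hVe : (fun p => partialFrac (fun k => conj (a k)) m (e₁ p) 0) = fun p =>
        (1 + partialFrac (fun k => conj (a k)) m (c₁ p) 0) * conj (leadCoeff (c₂ p)) := by
      ext p
      obtain ⟨-, q2, q3, -⟩ := h.relations p
      linear_combination (-partialFrac (fun k => conj (a k)) m (e₁ p) 0) * q2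
        + (1 + partialFrac (fun k => conj (a k)) m (c₁ p) 0) * q3
    have e' : fderiv ℝ (fun p => partialFrac (fun k => conj (a k)) m (e₁ p) 0) (x, t) (-1, 1) =
        fderiv ℝ (fun p => 1 + partialFrac (fun k => conj (a k)) m (c₁ p) 0) (x, t) (-1, 1)
          * conj (leadCoeff (c₂ (x, t)))
        + (1 + partialFrac (fun k => conj (a k)) m (c₁ (x, t)) 0)
          * conj (fderiv ℝ (fun p => leadCoeff (c₂ p)) (x, t) (-1, 1)) := by
      rw [hVe, (hα.mul hβ.star).fderiv_eq, ← hα.fderiv_eq, ← hβ.fderiv_eq]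
    obtain ⟨-, q2, q3, -⟩ := h.relations (x, t)
    obtain ⟨p1, p2⟩ := h.deriv_eta (x, t)
    rw [e'] at e
    simp only [e, normSq, p1, Complex.conj_conj]
    set α' := fderiv ℝ (fun p => 1 + partialFrac (fun k => conj (a k)) m (c₁ p) 0) (x, t) (-1, 1)
    set α := 1 + partialFrac (fun k => conj (a k)) m (c₁ (x, t)) 0
    set V := partialFrac (fun k => conj (a k)) m (e₁ (x, t)) 0
    set U := partialFrac a m (c₂ (x, t)) 0
    simp only [map_neg, map_mul, Complex.conj_I]
    linear_combination Complex.I * V * p2 - Complex.I * α' * q3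
      + Complex.I ^ 2 * conj U * q2 + (V * U * conj U + conj U) * Complex.I_sq

end LaxData

end

/-! ### Residues, and extension across the real line. -/

noncomputable section

open MeasureTheory in
/-- The boundary integral over the rectangle with corners `(x₁, y₁)` and `(x₂, y₂)`. -/
def rectIntegral (g : ℂ → ℂ) (x₁ x₂ y₁ y₂ : ℝ) : ℂ :=
  (∫ x : ℝ in x₁..x₂, g (x + y₁ * Complex.I)) - (∫ x : ℝ in x₁..x₂, g (x + y₂ * Complex.I)) +
    Complex.I • (∫ y : ℝ in y₁..y₂, g (x₂ + y * Complex.I)) -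
    Complex.I • (∫ y : ℝ in y₁..y₂, g (x₁ + y * Complex.I))

/-- Cauchy's theorem asks for holomorphy in the open rectangle and continuity on the closed one
only, so the real line may contain an edge. -/
theorem rectIntegral_eq_zero {g : ℂ → ℂ} {U : Set ℂ} (hc : ContinuousOn g U)
    (hd : ∀ z ∈ U, z.im ≠ 0 → DifferentiableAt ℂ g z) {x₁ x₂ y₁ y₂ : ℝ}
    (hU : Set.uIcc x₁ x₂ ×ℂ Set.uIcc y₁ y₂ ⊆ U)
    (h0 : (0 : ℝ) ∉ Set.Ioo (min y₁ y₂) (max y₁ y₂)) : rectIntegral g x₁ x₂ y₁ y₂ = 0 := by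
  have := Complex.integral_boundary_rect_eq_zero_of_continuousOn_of_differentiableOn g
    ⟨x₁, y₁⟩ ⟨x₂, y₂⟩ (hc.mono hU) (fun z hz => ?_)
  · simpa [rectIntegral] using this
  · rw [Complex.mem_reProdIm] at hz
    have hzU : z ∈ U := hU (Complex.mem_reProdIm.2
      ⟨Set.Ioo_subset_Icc_self hz.1, Set.Ioo_subset_Icc_self hz.2⟩)
    refine (hd z hzU ?_).differentiableWithinAt
    intro e
    rw [e] at hz
    exact h0 hz.2

/-- A continuous function that is holomorphic off the real line is holomorphic. -/
theorem differentiableOn_of_differentiableAt_nonreal {g : ℂ → ℂ} {c : ℂ} {r : ℝ}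
    (hc : ContinuousOn g (Metric.ball c r))
    (hd : ∀ z ∈ Metric.ball c r, z.im ≠ 0 → DifferentiableAt ℂ g z) :
    DifferentiableOn ℂ g (Metric.ball c r) := by
  refine (Complex.isConservativeOn_and_continuousOn_iff_isDifferentiableOn
    Metric.isOpen_ball).1 ⟨?_, hc⟩
  intro z w hzw
  rw [← add_eq_zero_iff_eq_neg, Complex.wedgeIntegral_add_wedgeIntegral_eq]
  change rectIntegral g z.re w.re z.im w.im = 0
  change Set.uIcc z.re w.re ×ℂ Set.uIcc z.im w.im ⊆ _ at hzw
  by_cases h0 : (0 : ℝ) ∈ Set.Ioo (min z.im w.im) (max z.im w.im)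
  -- A rectangle across the real line is cut along it. Both halves have integral zero, and the
  -- contributions of the common edge cancel.
  · have h0' : (0 : ℝ) ∈ Set.uIcc z.im w.im := Set.Ioo_subset_Icc_self h0
    have s1 : Set.uIcc z.re w.re ×ℂ Set.uIcc z.im 0 ⊆ Metric.ball c r := fun y hy => by
      rw [Complex.mem_reProdIm] at hy
      exact hzw (Complex.mem_reProdIm.2 ⟨hy.1, Set.uIcc_subset_uIcc_left h0' hy.2⟩)
    have s2 : Set.uIcc z.re w.re ×ℂ Set.uIcc 0 w.im ⊆ Metric.ball c r := fun y hy => by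
      rw [Complex.mem_reProdIm] at hy
      exact hzw (Complex.mem_reProdIm.2 ⟨hy.1, Set.uIcc_subset_uIcc_right h0' hy.2⟩)
    have r1 := rectIntegral_eq_zero hc hd s1 (by
      rcases le_total z.im 0 with h | h <;> simp [h])
    have r2 := rectIntegral_eq_zero hc hd s2 (by
      rcases le_total w.im 0 with h | h <;> simp [h])
    have vert : ∀ x ∈ Set.uIcc z.re w.re, ∀ y₁ ∈ Set.uIcc z.im w.im, ∀ y₂ ∈ Set.uIcc z.im w.im,
        IntervalIntegrable (fun y : ℝ => g (x + y * Complex.I)) MeasureTheory.volume y₁ y₂ := by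
      intro x hx y₁ hy₁ y₂ hy₂
      refine ContinuousOn.intervalIntegrable (hc.comp (by fun_prop) fun y hy => hzw ?_)
      refine Complex.mem_reProdIm.2 ⟨by simpa using hx, ?_⟩
      simpa using Set.uIcc_subset_uIcc hy₁ hy₂ hy
    have hl := Set.left_mem_uIcc (a := z.re) (b := w.re)
    have hr := Set.right_mem_uIcc (a := z.re) (b := w.re)
    have tl := Set.left_mem_uIcc (a := z.im) (b := w.im)
    have tr := Set.right_mem_uIcc (a := z.im) (b := w.im)
    have a1 := intervalIntegral.integral_add_adjacent_intervals (vert _ hl _ tl _ h0')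
      (vert _ hl _ h0' _ tr)
    have a2 := intervalIntegral.integral_add_adjacent_intervals (vert _ hr _ tl _ h0')
      (vert _ hr _ h0' _ tr)
    rw [rectIntegral] at r1 r2 ⊢
    rw [← a1, ← a2]
    simp only [smul_eq_mul] at r1 r2 ⊢
    linear_combination r1 + r2
  · exact rectIntegral_eq_zero hc hd hzw h0

theorem HasResidueAt.unique {g : ℂ → ℂ} {a c c' : ℂ} (h : HasResidueAt g a c)
    (h' : HasResidueAt g a c') : c = c' := by
  obtain ⟨r, h1, h2⟩ := (Eventually.and h h').exists
  exact h1.symm.trans h2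

/-- Cauchy's integral formula for the derivative of order `m - n` of the numerator `G`. -/
theorem hasResidueAt_of_pole {g G : ℂ → ℂ} {a : ℂ} {m n : ℕ} (hn : n ≤ m)
    (hG : AnalyticAt ℂ G a) (e : g =ᶠ[𝓝[≠] a] fun z => G z / (z - a) ^ (m + 1)) :
    HasResidueAt (fun z => (z - a) ^ n * g z) a
      (iteratedDeriv (m - n) G a / ((m - n).factorial : ℂ)) := by
  have e' := hG.eventually_analyticAt.and (eventually_nhdsWithin_iff.1 e)
  obtain ⟨ε, hε, hb⟩ := Metric.eventually_nhds_iff_ball.1 e'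
  filter_upwards [Ioo_mem_nhdsGT hε] with r hr
  have hsub : Metric.closedBall a r ⊆ Metric.ball a ε := Metric.closedBall_subset_ball hr.2
  have key := Complex.circleIntegral_one_div_sub_center_pow_smul_of_differentiable_on_off_countable
    (f := G) (c := a) hr.1 (m - n) Set.countable_empty
    (fun z hz => (hb z (hsub hz)).1.continuousAt.continuousWithinAt)
    (fun z hz => (hb z (hsub (Metric.ball_subset_closedBall hz.1))).1.differentiableAt)
  have hcongr : (∮ z in C(a, r), (z - a) ^ n * g z) =
      ∮ z in C(a, r), (1 / (z - a) ^ (m - n + 1)) • G z := by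
    refine circleIntegral.integral_congr hr.1.le fun z hz => ?_
    have hza : z ≠ a := by
      rintro rfl
      simp [hr.1.ne] at hz
    have hz0 : z - a ≠ 0 := sub_ne_zero.2 hza
    have := (hb z (hsub (Metric.sphere_subset_closedBall hz))).2 hza
    simp only [this, smul_eq_mul]
    have hp : (z - a) ^ (m + 1) = (z - a) ^ n * (z - a) ^ (m - n + 1) := by
      rw [← pow_add]; congr 1; omega
    rw [hp]
    field_simp
  rw [hcongr, key, smul_eq_mul]
  have hpi := Complex.two_pi_I_ne_zero
  field_simp

theorem hasResidueAt_zero {g : ℂ → ℂ} {a : ℂ} (hg : AnalyticAt ℂ g a) (n : ℕ) :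
    HasResidueAt (fun z => (z - a) ^ n * g z) a 0 := by
  -- A regular function is treated as a simple pole whose numerator vanishes at `a`.
  have hG : AnalyticAt ℂ (fun z => (z - a) * ((z - a) ^ n * g z)) a := by fun_prop
  have := hasResidueAt_of_pole (g := fun z => (z - a) ^ n * g z) (m := 0) (n := 0) le_rfl hG (by
    filter_upwards [self_mem_nhdsWithin] with z hz
    have : z - a ≠ 0 := sub_ne_zero.2 hz
    simp only [zero_add, pow_one]
    field_simp)
  simpa using this

namespace DiscreteData

variable {N : ℕ} (D : DiscreteData N)

/-- The conjugate points. -/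
def lamBar (k : Fin N) : ℂ := conj (D.lam k)

/-- The negative of `weightBar`: the weight at the conjugate points. -/
def weightNeg (x t : ℝ) (z : ℂ) : ℂ := -D.weightBar x t z

theorem Theta_conj (x t : ℝ) (z : ℂ) : Theta x t (conj z) = conj (Theta x t z) := by
  simp [Theta, map_inv₀, map_ofNat]

theorem weightBar_eq (x t : ℝ) (z : ℂ) :
    D.weightBar x t z = z * conj (D.weight x t (conj z)) := by
  simp only [weightBar, weight, map_mul, ← Complex.exp_conj, Theta_conj, Complex.conj_conj,
    Complex.conj_I, map_ofNat]
  rw [mul_assoc]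
  congr 3
  ring

theorem weightNeg_eq (x t : ℝ) (z : ℂ) :
    D.weightNeg x t z = -(z * conj (D.weight x t (conj z))) := by
  rw [weightNeg, weightBar_eq]

theorem analyticAt_Theta (x t : ℝ) {z : ℂ} (hz : z ≠ 0) : AnalyticAt ℂ (Theta x t) z := by
  have : AnalyticAt ℂ (fun z : ℂ => z⁻¹) z := analyticAt_inv hz
  unfold Theta
  fun_prop

theorem analyticAt_weight (x t : ℝ) {z : ℂ} (hz : z ≠ 0) (hf : AnalyticAt ℂ D.f z) :
    AnalyticAt ℂ (D.weight x t) z :=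
  hf.fun_mul (analyticAt_const.fun_mul (analyticAt_Theta x t hz)).cexp

theorem analyticAt_weightBar (x t : ℝ) {z : ℂ} (hz : z ≠ 0) (hf : AnalyticAt ℂ D.f (conj z)) :
    AnalyticAt ℂ (D.weightBar x t) z :=
  (analyticAt_id.fun_mul (analyticAt_conj_conj hf)).fun_mul
    (analyticAt_const.fun_mul (analyticAt_Theta x t hz)).fun_neg.cexp

theorem analyticAt_weightNeg (x t : ℝ) {z : ℂ} (hz : z ≠ 0) (hf : AnalyticAt ℂ D.f (conj z)) :
    AnalyticAt ℂ (D.weightNeg x t) z :=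
  (D.analyticAt_weightBar x t hz hf).fun_neg

theorem isOpen_compl_singularSet : IsOpen D.singularSetᶜ := by
  have : IsClosed D.singularSet := ((isClosed_eq Complex.continuous_im continuous_const).union
    (Set.finite_range _).isClosed).union (Set.finite_range _).isClosed
  exact this.isOpen_compl

theorem notMem_singularSet {z : ℂ} : z ∉ D.singularSet ↔
    z.im ≠ 0 ∧ (∀ k, z ≠ D.lam k) ∧ ∀ k, z ≠ D.lamBar k := by
  simp [singularSet, lamBar, eq_comm, not_or, and_assoc]

end DiscreteData

theorem exists_pole_of_meromorphicOrderAt {g : ℂ → Fin 2 → ℂ} {a : ℂ} {m : ℕ}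
    (h : meromorphicOrderAt g a = ((-((m : ℤ) + 1) : ℤ) : WithTop ℤ)) (i : Fin 2) :
    ∃ G : ℂ → ℂ, AnalyticAt ℂ G a ∧
      (fun z => g z i) =ᶠ[𝓝[≠] a] fun z => G z / (z - a) ^ (m + 1) := by
  -- The order of a non-meromorphic function is zero by convention, so a non-zero order already
  -- implies meromorphy.
  have hm : MeromorphicAt g a := by
    refine meromorphicAt_of_meromorphicOrderAt_ne_zero ?_
    rw [h, Ne, ← WithTop.coe_zero, WithTop.coe_inj]
    omega
  obtain ⟨G, hG, -, e⟩ := (meromorphicOrderAt_eq_int_iff hm).1 h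
  refine ⟨fun z => G z i, analyticAt_pi_iff.1 hG i, ?_⟩
  filter_upwards [e] with z hz
  have e1 : (-((m : ℤ) + 1)) = -((m + 1 : ℕ) : ℤ) := by push_cast; ring
  rw [hz, e1, zpow_neg, zpow_natCast, Pi.smul_apply, smul_eq_mul, div_eq_inv_mul]

/-- The `m + 1` residues determine the Taylor coefficients of `G` up to order `m`, and so the whole
principal part of `g`. -/
theorem regAt_sub_of_residues {g n w G : ℂ → ℂ} {a : ℂ} {m : ℕ} (hG : AnalyticAt ℂ G a)
    (e : g =ᶠ[𝓝[≠] a] fun z => G z / (z - a) ^ (m + 1)) (hw : AnalyticAt ℂ w a)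
    (hn : AnalyticAt ℂ n a)
    (hres : ∀ j ≤ m, HasResidueAt (fun z => (z - a) ^ j * g z) a
      (iteratedDeriv (m - j) (fun z => w z * n z) a / ((m - j).factorial : ℂ))) :
    RegAt (fun z => g z - w z * n z / (z - a) ^ (m + 1)) a := by
  have hwn := hw.fun_mul hn
  refine ((regAt_div_pow_iff (hG.fun_sub hwn) (m + 1)).2 fun j hj => ?_).congr ?_
  · have h1 := (hasResidueAt_of_pole (Nat.sub_le m j) hG e).unique (hres _ (Nat.sub_le m j))
    have e1 : m - (m - j) = j := by omega
    rw [e1, div_left_inj' (Nat.cast_ne_zero.2 (Nat.factorial_ne_zero j))] at h1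
    rw [iteratedDeriv_fun_sub hG.contDiffAt hwn.contDiffAt, h1, sub_self]
  · filter_upwards [e] with z hz
    rw [hz, sub_div]

/-- A solution of the Riemann--Hilbert problem with its values on the real line replaced by the
boundary values from above. -/
def fillReal (Mp : ℝ → Matrix (Fin 2) (Fin 2) ℂ) (M : ℂ → Matrix (Fin 2) (Fin 2) ℂ) (z : ℂ) :
    Matrix (Fin 2) (Fin 2) ℂ :=
  if z.im = 0 then Mp z.re else M z

theorem fillReal_of_im_ne {Mp : ℝ → Matrix (Fin 2) (Fin 2) ℂ}
    {M : ℂ → Matrix (Fin 2) (Fin 2) ℂ} {z : ℂ} (h : z.im ≠ 0) : fillReal Mp M z = M z :=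
  if_neg h

theorem fillReal_eventuallyEq {Mp : ℝ → Matrix (Fin 2) (Fin 2) ℂ}
    {M : ℂ → Matrix (Fin 2) (Fin 2) ℂ} {z : ℂ} (h : z.im ≠ 0) : fillReal Mp M =ᶠ[𝓝 z] M := by
  filter_upwards [(Complex.continuous_im.continuousAt (x := z)).eventually_ne h] with y hy
  exact fillReal_of_im_ne hy

theorem tendsto_fillReal {Mp : ℝ → Matrix (Fin 2) (Fin 2) ℂ}
    {M : ℂ → Matrix (Fin 2) (Fin 2) ℂ} (hc : Continuous Mp)
    (hp : ∀ s : ℝ, Tendsto M (𝓝[{z : ℂ | 0 < z.im}] (s : ℂ)) (𝓝 (Mp s)))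
    (hm : ∀ s : ℝ, Tendsto M (𝓝[{z : ℂ | z.im < 0}] (s : ℂ)) (𝓝 (Mp s))) (s : ℝ) :
    Tendsto (fillReal Mp M) (𝓝 (s : ℂ)) (𝓝 (Mp s)) := by
  have hu : (Set.univ : Set ℂ) = {z | 0 < z.im} ∪ {z | z.im < 0} ∪ {z | z.im = 0} := by
    ext z
    rcases lt_trichotomy z.im 0 with h | h | h <;> simp [h]
  rw [← nhdsWithin_univ, hu, nhdsWithin_union, nhdsWithin_union]
  refine ((hp s).congr' ?_).sup ((hm s).congr' ?_) |>.sup ?_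
  · filter_upwards [self_mem_nhdsWithin] with z hz
    exact (fillReal_of_im_ne (ne_of_gt hz)).symm
  · filter_upwards [self_mem_nhdsWithin] with z hz
    exact (fillReal_of_im_ne (ne_of_lt hz)).symm
  · have : Tendsto (fun z : ℂ => Mp z.re) (𝓝[{z : ℂ | z.im = 0}] (s : ℂ)) (𝓝 (Mp s)) := by
      have h1 : Continuous fun z : ℂ => Mp z.re := hc.comp Complex.continuous_re
      simpa using (h1.tendsto (s : ℂ)).mono_left nhdsWithin_le_nhds
    refine this.congr' ?_
    filter_upwards [self_mem_nhdsWithin] with z hz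
    exact (if_pos hz).symm

/-- A reflectionless solution of the Riemann--Hilbert problem extends across the real line. -/
theorem DiscreteData.IsRHPSolution.exists_isRow {N : ℕ} {D : DiscreteData N} {γ : ℝ → ℂ} {x t : ℝ}
    {M : ℂ → Matrix (Fin 2) (Fin 2) ℂ} (h_lam : ∀ k, 0 < (D.lam k).im)
    (h_f : ∀ k, AnalyticAt ℂ D.f (D.lam k)) (hγ : ∀ s : ℝ, s ≠ 0 → γ s = 0)
    (h : D.IsRHPSolution γ x t M) :
    ∃ M' : ℂ → Matrix (Fin 2) (Fin 2) ℂ, (∀ z, z.im ≠ 0 → M' z = M z) ∧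
      ∀ i, IsRow D.lam D.lamBar D.m (D.weight x t) (D.weightNeg x t)
        (fun z => M' z i 0) fun z => M' z i 1 := by
  obtain ⟨Mp, Mm, hcp, hcm, hp, hm, hj⟩ := h.jump
  -- The jump relation says nothing at the origin; continuity of both boundary values and density of
  -- the other points supply the equality there.
  have hEq : Mm = Mp := by
    refine Continuous.ext_on (dense_compl_singleton (0 : ℝ)) hcm hcp fun s hs => ?_
    rw [hj s hs]
    have : jumpMatrix γ x t s = 1 := by
      ext i j
      fin_cases i <;> fin_cases j <;> simp [jumpMatrix, hγ s hs]
    rw [this, mul_one]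
  subst hEq
  have him : ∀ k, (D.lam k).im ≠ 0 := fun k => (h_lam k).ne'
  have himb : ∀ k, (D.lamBar k).im ≠ 0 := fun k => by simpa [lamBar] using him k
  have hne0 : ∀ k, D.lam k ≠ 0 := fun k e => him k (by simp [e])
  have hne0b : ∀ k, D.lamBar k ≠ 0 := fun k e => himb k (by simp [e])
  have evE : ∀ {z : ℂ}, z.im ≠ 0 → ∀ i j,
      (fun y => fillReal Mm M y i j) =ᶠ[𝓝 z] fun y => M y i j := fun hz i j => by
    filter_upwards [fillReal_eventuallyEq hz] with y hy
    rw [hy]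
  have anc : ∀ {z : ℂ}, z ∉ D.singularSet → ∀ i j, AnalyticAt ℂ (fun y => M y i j) z :=
    fun hz i j => (h.analytic i j).analyticAt (D.isOpen_compl_singularSet.mem_nhds hz)
  have reg : ∀ z, (∀ k, z ≠ D.lam k) → (∀ k, z ≠ D.lamBar k) → ∀ i j,
      RegAt (fun y => fillReal Mm M y i j) z := by
    intro z hz hzb i j
    by_cases hzi : z.im = 0
    · obtain ⟨s, rfl⟩ : ∃ s : ℝ, z = s := ⟨z.re, by apply Complex.ext <;> simp [hzi]⟩
      have hO : IsOpen (Set.range D.lam ∪ Set.range D.lamBar)ᶜ :=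
        ((Set.finite_range _).isClosed.union (Set.finite_range _).isClosed).isOpen_compl
      obtain ⟨r, hr, hb⟩ := Metric.isOpen_iff.1 hO (s : ℂ) (by
        simp only [Set.mem_compl_iff, Set.mem_union, Set.mem_range, not_or, not_exists]
        exact ⟨fun k => (hz k).symm, fun k => (hzb k).symm⟩)
      have hdiff : ∀ y ∈ Metric.ball (s : ℂ) r, y.im ≠ 0 →
          DifferentiableAt ℂ (fun y => fillReal Mm M y i j) y := fun y hy hyi => by
        have hy' := hb hy
        simp only [Set.mem_compl_iff, Set.mem_union, Set.mem_range, not_or, not_exists] at hy'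
        have : y ∉ D.singularSet := D.notMem_singularSet.2
          ⟨hyi, fun k => Ne.symm (hy'.1 k), fun k => Ne.symm (hy'.2 k)⟩
        exact ((anc this i j).congr (evE hyi i j).symm).differentiableAt
      have hcont : ContinuousOn (fun y => fillReal Mm M y i j) (Metric.ball (s : ℂ) r) := by
        intro y hy
        refine ContinuousAt.continuousWithinAt ?_
        by_cases hyi : y.im = 0
        · obtain ⟨q, rfl⟩ : ∃ q : ℝ, y = q := ⟨y.re, by apply Complex.ext <;> simp [hyi]⟩
          have h1 := tendsto_fillReal hcm hp hm q
          have h2 : fillReal Mm M q = Mm q := by simp [fillReal]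
          rw [← h2] at h1
          exact ((continuous_id.matrix_elem i j).tendsto _).comp h1
        · exact (hdiff y hy hyi).continuousAt
      exact RegAt.of_analyticAt ((differentiableOn_of_differentiableAt_nonreal hcont
        hdiff).analyticAt (Metric.ball_mem_nhds _ hr))
    · exact RegAt.of_analyticAt ((anc (D.notMem_singularSet.2 ⟨hzi, hz, hzb⟩) i j).congr
        (evE hzi i j).symm)
  refine ⟨fillReal Mm M, fun z hz => fillReal_of_im_ne hz, fun i => ⟨?_, ?_, ?_, ?_⟩⟩
  · intro z hzb
    by_cases hz : ∃ k, z = D.lam k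
    · obtain ⟨k, rfl⟩ := hz
      exact RegAt.of_analyticAt ((analyticAt_pi_iff.1 (h.analytic_lam k) i).congr
        (evE (him k) i 0).symm)
    · push Not at hz
      exact reg z hz hzb i 0
  · intro z hz
    by_cases hzb : ∃ k, z = D.lamBar k
    · obtain ⟨k, rfl⟩ := hzb
      exact RegAt.of_analyticAt ((analyticAt_pi_iff.1 (h.analytic_lamBar k) i).congr
        (evE (himb k) i 1).symm)
    · push Not at hzb
      exact reg z hz hzb i 1
  · intro k
    obtain ⟨G, hG, e⟩ := exists_pole_of_meromorphicOrderAt (h.order_lam k) i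
    refine (regAt_sub_of_residues hG e (D.analyticAt_weight x t (hne0 k) (h_f k))
      (analyticAt_pi_iff.1 (h.analytic_lam k) i)
      fun j hj => (h.residue_lam k j hj i).2).congr ?_
    filter_upwards [(evE (him k) i 0).filter_mono nhdsWithin_le_nhds,
      (evE (him k) i 1).filter_mono nhdsWithin_le_nhds] with z h0 h1
    rw [h0, h1]
  · intro k
    obtain ⟨G, hG, e⟩ := exists_pole_of_meromorphicOrderAt (h.order_lamBar k) i
    refine (regAt_sub_of_residues (w := D.weightNeg x t) hG e
      (D.analyticAt_weightNeg x t (hne0b k) (by simpa [lamBar] using h_f k))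
      (analyticAt_pi_iff.1 (h.analytic_lamBar k) i) fun j hj => ?_).congr ?_
    · have := (h.residue_lamBar k j hj i).1
      rw [← neg_div, ← iteratedDeriv_fun_neg] at this
      simpa only [weightNeg, neg_mul] using this
    filter_upwards [(evE (himb k) i 0).filter_mono nhdsWithin_le_nhds,
      (evE (himb k) i 1).filter_mono nhdsWithin_le_nhds] with z h0 h1
    rw [h0, h1]
    rfl

end

/-! ### From rows back to the Riemann–Hilbert problem; uniqueness. -/

noncomputable section

namespace IsRow

variable {N : ℕ} {a b : Fin N → ℂ} {m : Fin N → ℕ} {w₁ w₂ n₁ n₂ n₁' n₂' : ℂ → ℂ}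

theorem exists_pole (h : IsRow a b m w₁ w₂ n₁ n₂) (k : Fin N) (hw : AnalyticAt ℂ w₁ (a k))
    (hn : AnalyticAt ℂ n₁ (a k)) :
    ∃ G : ℂ → ℂ, AnalyticAt ℂ G (a k) ∧
      n₂ =ᶠ[𝓝[≠] (a k)] (fun z => G z / (z - a k) ^ (m k + 1)) ∧
      ∀ j ≤ m k, iteratedDeriv j G (a k) = iteratedDeriv j (fun z => w₁ z * n₁ z) (a k) := by
  obtain ⟨r, hr, e⟩ := h.pole₂ k
  have hwn := hw.fun_mul hn
  have hG : AnalyticAt ℂ (fun z => r z * (z - a k) ^ (m k + 1) + w₁ z * n₁ z) (a k) := by fun_prop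
  have ne : ∀ z ∈ ({a k}ᶜ : Set ℂ), (z - a k) ^ (m k + 1) ≠ 0 := fun z hz =>
    pow_ne_zero _ (sub_ne_zero.2 hz)
  refine ⟨_, hG, ?_, fun j hj => ?_⟩
  · filter_upwards [e, self_mem_nhdsWithin] with z hz hne
    have := ne z hne
    rw [← hz]
    field_simp
    ring
  · have key := (regAt_div_pow_iff (hG.fun_sub hwn) (m k + 1)).1
      ((RegAt.of_analyticAt hr).congr (by
        filter_upwards [self_mem_nhdsWithin] with z hne
        have := ne z hne
        field_simp
        ring)) j (by omega)
    rw [iteratedDeriv_fun_sub hG.contDiffAt hwn.contDiffAt] at key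
    exact sub_eq_zero.1 key

/-- In the determinant the second column may be replaced by its regular part at `a k`. If both first
entries vanished there, the determinant would tend to zero. This makes the pole order exact and not
merely an upper bound. -/
theorem ne_zero_or (h : IsRow a b m w₁ w₂ n₁ n₂) (h' : IsRow a b m w₁ w₂ n₁' n₂') (k : Fin N)
    {c : ℂ} (hc : c ≠ 0)
    (hdet : (fun z => n₁ z * n₂' z - n₂ z * n₁' z) =ᶠ[𝓝[≠] (a k)] fun _ => c)
    (c₁ : ContinuousAt n₁ (a k)) (c₁' : ContinuousAt n₁' (a k)) :
    n₁ (a k) ≠ 0 ∨ n₁' (a k) ≠ 0 := by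
  by_contra! h0
  have t₁ : Tendsto n₁ (𝓝[≠] (a k)) (𝓝 0) := by
    rw [← h0.1]; exact c₁.tendsto.mono_left nhdsWithin_le_nhds
  have t₁' : Tendsto n₁' (𝓝[≠] (a k)) (𝓝 0) := by
    rw [← h0.2]; exact c₁'.tendsto.mono_left nhdsWithin_le_nhds
  have t := (t₁.mul (h'.pole₂ k).tendsto_fill).sub ((h.pole₂ k).tendsto_fill.mul t₁')
  simp only [zero_mul, mul_zero, sub_zero] at t
  refine hc (tendsto_nhds_unique ((tendsto_const_nhds.congr' hdet.symm).congr fun z => ?_) t)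
  ring

end IsRow

theorem meromorphicOrderAt_of_pole {g : ℂ → Fin 2 → ℂ} {a : ℂ} {m : ℕ} {G : Fin 2 → ℂ → ℂ}
    (hG : ∀ i, AnalyticAt ℂ (G i) a)
    (e : ∀ i, (fun z => g z i) =ᶠ[𝓝[≠] a] fun z => G i z / (z - a) ^ (m + 1))
    (h0 : ∃ i, G i a ≠ 0) :
    meromorphicOrderAt g a = ((-((m : ℤ) + 1) : ℤ) : WithTop ℤ) := by
  have hGv : AnalyticAt ℂ (fun z i => G i z) a := analyticAt_pi_iff.2 hG
  have ev : ∀ᶠ z in 𝓝[≠] a, g z = (z - a) ^ (-((m : ℤ) + 1)) • fun i => G i z := by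
    filter_upwards [eventually_all.2 e] with z hz
    have e1 : (-((m : ℤ) + 1)) = -((m + 1 : ℕ) : ℤ) := by push_cast; ring
    ext i
    rw [hz i, e1, zpow_neg, zpow_natCast, Pi.smul_apply, smul_eq_mul, div_eq_inv_mul]
  have hm : MeromorphicAt g a := by
    have h1 : MeromorphicAt (fun z : ℂ => z - a) a :=
      AnalyticAt.meromorphicAt (by fun_prop)
    exact ((h1.zpow _).smul hGv.meromorphicAt).congr (EventuallyEq.symm ev)
  refine (meromorphicOrderAt_eq_int_iff hm).2 ⟨_, hGv, ?_, ev⟩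
  obtain ⟨i, hi⟩ := h0
  exact fun h => hi (congrFun h i)

namespace DiscreteData

variable {N : ℕ} {D : DiscreteData N} {γ : ℝ → ℂ} {x t : ℝ}

theorem lam_ne_zero (h_lam : ∀ k, 0 < (D.lam k).im) (k : Fin N) : D.lam k ≠ 0 := fun e => by
  have := h_lam k
  simp [e] at this

theorem lamBar_ne_zero (h_lam : ∀ k, 0 < (D.lam k).im) (k : Fin N) : D.lamBar k ≠ 0 :=
  (map_ne_zero _).2 (lam_ne_zero h_lam k)

theorem analyticAt_weight_lam (h_lam : ∀ k, 0 < (D.lam k).im)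
    (h_f : ∀ k, AnalyticAt ℂ D.f (D.lam k)) (x t : ℝ) (k : Fin N) :
    AnalyticAt ℂ (D.weight x t) (D.lam k) :=
  D.analyticAt_weight x t (lam_ne_zero h_lam k) (h_f k)

theorem analyticAt_weightNeg_lamBar (h_lam : ∀ k, 0 < (D.lam k).im)
    (h_f : ∀ k, AnalyticAt ℂ D.f (D.lam k)) (x t : ℝ) (k : Fin N) :
    AnalyticAt ℂ (D.weightNeg x t) (D.lamBar k) :=
  D.analyticAt_weightNeg x t (lamBar_ne_zero h_lam k) (by simpa [lamBar] using h_f k)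

/-- Matrix functions whose rows satisfy the residue conditions and the normalization solve the
reflectionless Riemann--Hilbert problem. -/
theorem isRHPSolution_of_isRow {M : ℂ → Matrix (Fin 2) (Fin 2) ℂ}
    (h_lam : ∀ k, 0 < (D.lam k).im) (h_f : ∀ k, AnalyticAt ℂ D.f (D.lam k))
    (h_f0 : ∀ k, D.f (D.lam k) ≠ 0) (hγ : ∀ s : ℝ, s ≠ 0 → γ s = 0)
    (h0 : ∀ i z, (∀ k, z ≠ D.lamBar k) → AnalyticAt ℂ (fun z => M z i 0) z)
    (h1 : ∀ i z, (∀ k, z ≠ D.lam k) → AnalyticAt ℂ (fun z => M z i 1) z)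
    (hrow : ∀ i, IsRow D.lam D.lamBar D.m (D.weight x t) (D.weightNeg x t)
      (fun z => M z i 0) fun z => M z i 1)
    (hdec : ∀ i j, Decays fun z => M z i j - (1 : Matrix (Fin 2) (Fin 2) ℂ) i j) :
    D.IsRHPSolution γ x t M := by
  have hab : ∀ k l, D.lam k ≠ D.lamBar l := ne_conj_of_im_pos h_lam
  have hba : ∀ k l, D.lamBar k ≠ D.lam l := fun k l => (hab l k).symm
  have hw := analyticAt_weight_lam h_lam h_f x t
  have hwb := analyticAt_weightNeg_lamBar h_lam h_f x t
  have hw0 : ∀ k, D.weight x t (D.lam k) ≠ 0 := fun k =>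
    mul_ne_zero (h_f0 k) (Complex.exp_ne_zero _)
  have hwb0 : ∀ k, D.weightNeg x t (D.lamBar k) ≠ 0 := fun k => by
    rw [weightNeg_eq, neg_ne_zero]
    refine mul_ne_zero (lamBar_ne_zero h_lam k) ((map_ne_zero _).2 ?_)
    simpa [lamBar] using hw0 k
  have hdet := (hrow 0).det_eventuallyEq_one hab (hrow 1) (by simpa using hdec 0 0)
    (by simpa using hdec 0 1) (by simpa using hdec 1 0) (by simpa using hdec 1 1)
  have pole := fun k i => (hrow i).exists_pole k (hw k) (h0 i _ (hab k))
  have poleb := fun k i => (hrow i).swap.exists_pole k (hwb k) (h1 i _ (hba k))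
  have hreal : ∀ s : ℝ, ContinuousAt M (s : ℂ) := fun s => by
    have hs : ∀ c : Fin N → ℂ, (∀ k, (c k).im ≠ 0) → ∀ k, (s : ℂ) ≠ c k := fun c hc k e =>
      hc k (by rw [← e]; simp)
    refine continuousAt_pi.2 fun i => continuousAt_pi.2 fun j => ?_
    fin_cases j
    · exact (h0 i s (hs _ fun k => by simpa [lamBar] using (h_lam k).ne')).continuousAt
    · exact (h1 i s (hs _ fun k => (h_lam k).ne')).continuousAt
  have hMc : Continuous fun s : ℝ => M s := continuous_iff_continuousAt.2 fun s =>
    (hreal s).comp (f := fun s : ℝ => (s : ℂ)) Complex.continuous_ofReal.continuousAt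
  constructor
  · intro i j z hz
    obtain ⟨-, ha, hb⟩ := D.notMem_singularSet.1 hz
    fin_cases j
    · exact (h0 i z hb).differentiableAt.differentiableWithinAt
    · exact (h1 i z ha).differentiableAt.differentiableWithinAt
  · exact fun k => analyticAt_pi_iff.2 fun i => h0 i _ (hab k)
  · exact fun k => analyticAt_pi_iff.2 fun i => h1 i _ (hba k)
  · intro k
    choose G hG e hj using pole k
    have hv : ∀ i, G i (D.lam k) = D.weight x t (D.lam k) * M (D.lam k) i 0 := fun i => by
      simpa using hj i 0 (Nat.zero_le _)
    refine meromorphicOrderAt_of_pole hG e ?_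
    rcases (hrow 0).ne_zero_or (hrow 1) k one_ne_zero (hdet _) (h0 0 _ (hab k)).continuousAt
      (h0 1 _ (hab k)).continuousAt with h | h
    · exact ⟨0, (hv 0).trans_ne (mul_ne_zero (hw0 k) h)⟩
    · exact ⟨1, (hv 1).trans_ne (mul_ne_zero (hw0 k) h)⟩
  · intro k
    choose G hG e hj using poleb k
    have hv : ∀ i, G i (D.lamBar k) = D.weightNeg x t (D.lamBar k) * M (D.lamBar k) i 1 :=
      fun i => by simpa using hj i 0 (Nat.zero_le _)
    refine meromorphicOrderAt_of_pole hG e ?_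
    -- At the conjugate points the columns exchange roles, which changes the sign of the
    -- determinant.
    have hdet' : (fun z => M z 0 1 * M z 1 0 - M z 0 0 * M z 1 1) =ᶠ[𝓝[≠] (D.lamBar k)]
        fun _ => -1 := by
      filter_upwards [hdet (D.lamBar k)] with z hz
      linear_combination -hz
    rcases (hrow 0).swap.ne_zero_or (hrow 1).swap k (neg_ne_zero.2 one_ne_zero) hdet'
      (h1 0 _ (hba k)).continuousAt (h1 1 _ (hba k)).continuousAt with h | h
    · exact ⟨0, (hv 0).trans_ne (mul_ne_zero (hwb0 k) h)⟩
    · exact ⟨1, (hv 1).trans_ne (mul_ne_zero (hwb0 k) h)⟩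
  · intro k n hn i
    obtain ⟨G, hG, e, hj⟩ := pole k i
    refine ⟨hasResidueAt_zero (h0 i _ (hab k)) n, ?_⟩
    rw [← hj _ (Nat.sub_le _ _)]
    exact hasResidueAt_of_pole hn hG e
  · intro k n hn i
    obtain ⟨G, hG, e, hj⟩ := poleb k i
    refine ⟨?_, hasResidueAt_zero (h1 i _ (hba k)) n⟩
    have e2 : iteratedDeriv (D.m k - n) (fun z => D.weightBar x t z * M z i 1) (D.lamBar k) =
        -iteratedDeriv (D.m k - n) G (D.lamBar k) := by
      rw [hj _ (Nat.sub_le _ _), ← iteratedDeriv_fun_neg]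
      simp only [weightNeg, neg_mul, neg_neg]
    have := hasResidueAt_of_pole hn hG e
    change HasResidueAt _ _ (-(iteratedDeriv (D.m k - n) (fun z => D.weightBar x t z * M z i 1)
      (D.lamBar k) / _))
    rw [e2, neg_div, neg_neg]
    exact this
  · refine ⟨fun s => M s, fun s => M s, hMc, hMc,
      fun s => (hreal s).tendsto.mono_left nhdsWithin_le_nhds,
      fun s => (hreal s).tendsto.mono_left nhdsWithin_le_nhds, fun s hs => ?_⟩
    have : jumpMatrix γ x t s = 1 := by
      ext i j
      fin_cases i <;> fin_cases j <;> simp [jumpMatrix, hγ s hs]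
    rw [this, mul_one]
  · exact hdec

/-- Two rows with the same normalization agree. -/
theorem row_unique (h_lam : ∀ k, 0 < (D.lam k).im) {n₁ n₂ n₁' n₂' : ℂ → ℂ} {δ₁ δ₂ : ℂ}
    (h : IsRow D.lam D.lamBar D.m (D.weight x t) (D.weightNeg x t) n₁ n₂)
    (h' : IsRow D.lam D.lamBar D.m (D.weight x t) (D.weightNeg x t) n₁' n₂')
    (d₁ : Decays fun z => n₁ z - δ₁) (d₂ : Decays fun z => n₂ z - δ₂)
    (d₁' : Decays fun z => n₁' z - δ₁) (d₂' : Decays fun z => n₂' z - δ₂) :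
    (∀ z, (∀ k, z ≠ D.lamBar k) → n₁ =ᶠ[𝓝[≠] z] n₁') ∧
      ∀ z, (∀ k, z ≠ D.lam k) → n₂ =ᶠ[𝓝[≠] z] n₂' := by
  have := (h.sub h').eventuallyEq_zero h_lam (D.weightNeg_eq x t)
    (by simpa using d₁.sub d₁') (by simpa using d₂.sub d₂')
  refine ⟨fun z hz => ?_, fun z hz => ?_⟩
  · filter_upwards [this.1 z hz] with y hy
    exact sub_eq_zero.1 hy
  · filter_upwards [this.2 z hz] with y hy
    exact sub_eq_zero.1 hy

/-- The reflectionless Riemann--Hilbert problem has at most one solution. -/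
theorem IsRHPSolution.eq {M M' : ℂ → Matrix (Fin 2) (Fin 2) ℂ}
    (h_lam : ∀ k, 0 < (D.lam k).im) (h_f : ∀ k, AnalyticAt ℂ D.f (D.lam k))
    (hγ : ∀ s : ℝ, s ≠ 0 → γ s = 0) (h : D.IsRHPSolution γ x t M)
    (h' : D.IsRHPSolution γ x t M') {z : ℂ} (hz : z ∉ D.singularSet) : M z = M' z := by
  obtain ⟨L, hL, rL⟩ := h.exists_isRow h_lam h_f hγ
  obtain ⟨L', hL', rL'⟩ := h'.exists_isRow h_lam h_f hγ
  have nr : ∀ᶠ z in nonrealAtInfinity, z.im ≠ 0 := mem_inf_of_right (mem_principal_self _)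
  have dL : ∀ i j, Decays fun z => L z i j - (1 : Matrix (Fin 2) (Fin 2) ℂ) i j := fun i j =>
    Decays.congr (h.normalization i j) (by filter_upwards [nr] with z hz; rw [hL z hz])
  have dL' : ∀ i j, Decays fun z => L' z i j - (1 : Matrix (Fin 2) (Fin 2) ℂ) i j := fun i j =>
    Decays.congr (h'.normalization i j) (by filter_upwards [nr] with z hz; rw [hL' z hz])
  obtain ⟨hzi, ha, hb⟩ := D.notMem_singularSet.1 hz
  have cont : ∀ {M : ℂ → Matrix (Fin 2) (Fin 2) ℂ}, D.IsRHPSolution γ x t M → ∀ i j,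
      ContinuousAt (fun y => M y i j) z := fun h i j =>
    ((h.analytic i j).differentiableAt (D.isOpen_compl_singularSet.mem_nhds hz)).continuousAt
  have ev : ∀ᶠ y in 𝓝[≠] z, y.im ≠ 0 :=
    ((Complex.continuous_im.continuousAt (x := z)).eventually_ne hzi).filter_mono
      nhdsWithin_le_nhds
  ext i j
  refine eq_of_eventuallyEq_nhdsNE ?_ (cont h i j) (cont h' i j)
  have U := row_unique h_lam (rL i) (rL' i) (dL i 0) (dL i 1) (dL' i 0) (dL' i 1)
  fin_cases j
  · filter_upwards [ev, U.1 z hb] with y hy e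
    change M y i 0 = M' y i 0
    rw [← hL y hy, ← hL' y hy, e]
  · filter_upwards [ev, U.2 z ha] with y hy e
    change M y i 1 = M' y i 1
    rw [← hL y hy, ← hL' y hy, e]

end DiscreteData

end

/-! ### The algebraic systems and the explicit solution. -/

noncomputable section

section

variable {N : ℕ} {a b : Fin N → ℂ} {m : Fin N → ℕ} {w₁ w₂ : ℂ → ℂ}

theorem IsCoeff.unique (hab : ∀ k l, a k ≠ b l) (hw₁ : ∀ k, AnalyticAt ℂ w₁ (a k))
    (hw₂ : ∀ k, AnalyticAt ℂ w₂ (b k)) (hdet : (coeffMatrix a b m w₁ w₂).det ≠ 0) {δ₁ δ₂ : ℂ}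
    {c₁ c₂ c₁' c₂' : Idx m → ℂ} (h : IsCoeff a b m w₁ w₂ δ₁ δ₂ c₁ c₂)
    (h' : IsCoeff a b m w₁ w₂ δ₁ δ₂ c₁' c₂') : c₁ = c₁' ∧ c₂ = c₂' := by
  rw [isCoeff_iff hab hw₁ hw₂] at h h'
  have := Matrix.mulVec_injective_of_isUnit
    ((Matrix.isUnit_iff_isUnit_det _).2 (isUnit_iff_ne_zero.2 hdet)) (h.trans h'.symm)
  exact Sum.elim_eq_iff.1 this

/-- The first entry of a row, computed from the principal parts `F / (z - a k)^(m k + 1)` of the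
second. -/
def firstEntry (a b : Fin N → ℂ) (m : Fin N → ℕ) (w₂ F : ℂ → ℂ) (z : ℂ) : ℂ :=
  1 + partialFrac b m (jet b m fun μ => w₂ μ * (0 + partialFrac a m (jet a m F) μ)) z

/-- `firstEntry` satisfies one half of the coefficient system by construction. The equation on the
left is the other half, so the system has been reduced to the unknowns `c₂` by elimination. -/
theorem jet_eq_firstEntry_iff {c₁ c₂ : Idx m → ℂ} (h : IsCoeff a b m w₁ w₂ 1 0 c₁ c₂)
    (hu : ∀ c₁' c₂', IsCoeff a b m w₁ w₂ 1 0 c₁' c₂' → c₂' = c₂) (F : ℂ → ℂ) :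
    jet a m F = jet a m (fun z => w₁ z * firstEntry a b m w₂ F z) ↔ jet a m F = c₂ := by
  constructor
  · intro e
    exact hu _ _ ⟨rfl, e⟩
  · intro e
    simp only [firstEntry, e]
    rw [← h.1, ← h.2]

/-- The kernel splits as `(z - μ)⁻¹ (μ - ν)⁻¹`, so each derivative produces a principal part: first
in `ν`, for `μ` near `b` and hence away from `a`, then in `μ`. -/
theorem iteratedDeriv_iteratedDeriv_div {F B : ℂ → ℂ} {a b z : ℂ} (hF : AnalyticAt ℂ F a)
    (hB : AnalyticAt ℂ B b) (hab : b ≠ a) (hz : z ≠ b) (m n : ℕ) (c : ℂ) :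
    iteratedDeriv m (fun μ => iteratedDeriv n
        (fun ν => c * B μ * F ν / ((z - μ) * (μ - ν))) a) b =
      m.factorial * n.factorial * (c * princ b m (fun μ => B μ * princ a n F μ) z) := by
  have e : (fun μ => iteratedDeriv n (fun ν => c * B μ * F ν / ((z - μ) * (μ - ν))) a) =ᶠ[𝓝 b]
      fun μ => (c * n.factorial) * (B μ * princ a n F μ / (z - μ)) := by
    filter_upwards [eventually_ne_nhds hab] with μ hμ
    simp only [mul_div_mul_comm]
    rw [iteratedDeriv_const_mul_field, iteratedDeriv_div_const_sub hF n hμ]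
    ring
  rw [e.iteratedDeriv_eq, iteratedDeriv_const_mul_field,
    iteratedDeriv_div_const_sub (hB.fun_mul (analyticAt_princ hab)) m hz]
  ring

theorem sum_princ_mul_princ {B F : ℂ → ℂ} (hab : ∀ k l, a k ≠ b l)
    (hB : ∀ k, AnalyticAt ℂ B (b k)) (z : ℂ) :
    ∑ k, ∑ l, princ (b k) (m k) (fun μ => B μ * princ (a l) (m l) F μ) z =
      partialFrac b m (jet b m fun μ => B μ * partialFrac a m (jet a m F) μ) z := by
  rw [partialFrac_jet]
  refine Finset.sum_congr rfl fun k _ => ?_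
  simp only [partialFrac_jet, Finset.mul_sum]
  exact (princ_sum _ _ (fun l _ => (hB k).fun_mul (analyticAt_princ fun e => hab l k e.symm))
    z).symm

end

theorem partialFrac_jet_neg {N : ℕ} {a : Fin N → ℂ} {m : Fin N → ℕ} (g : ℂ → ℂ) (z : ℂ) :
    partialFrac a m (jet a m fun y => -g y) z = -partialFrac a m (jet a m g) z := by
  simp only [partialFrac_jet, princ_neg, Finset.sum_neg_distrib]

namespace DiscreteData

variable {N : ℕ} {D : DiscreteData N} {x t : ℝ}

theorem weight_mul_weightBar (x t : ℝ) (z μ : ℂ) :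
    μ * D.f z * conj (D.f (conj μ)) * Complex.exp (2 * Complex.I * (Theta x t z - Theta x t μ)) =
      D.weight x t z * D.weightBar x t μ := by
  rw [weight, weightBar, mul_sub, sub_eq_add_neg, Complex.exp_add]
  ring

theorem weightBar_mul_weight (x t : ℝ) (z ν : ℂ) :
    z * conj (D.f (conj z)) * D.f ν * Complex.exp (2 * Complex.I * (Theta x t ν - Theta x t z)) =
      D.weightBar x t z * D.weight x t ν := by
  rw [weight, weightBar, mul_sub, sub_eq_add_neg, Complex.exp_add]
  ring

theorem analyticAt_weightBar_lamBar (h_lam : ∀ k, 0 < (D.lam k).im)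
    (h_f : ∀ k, AnalyticAt ℂ D.f (D.lam k)) (x t : ℝ) (k : Fin N) :
    AnalyticAt ℂ (D.weightBar x t) (D.lamBar k) :=
  D.analyticAt_weightBar x t (lamBar_ne_zero h_lam k) (by simpa [lamBar] using h_f k)

theorem G1_eq (h_lam : ∀ k, 0 < (D.lam k).im) (h_f : ∀ k, AnalyticAt ℂ D.f (D.lam k))
    {F : ℂ → ℂ} (hF : ∀ k, AnalyticAt ℂ F (D.lam k)) {z : ℂ} (hz : ∀ k, z ≠ D.lamBar k) :
    D.G1 x t F z =
      F z - D.weight x t z * firstEntry D.lam D.lamBar D.m (D.weightNeg x t) F z := by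
  have hab : ∀ k l, D.lam k ≠ D.lamBar l := ne_conj_of_im_pos h_lam
  have hB := analyticAt_weightBar_lamBar h_lam h_f x t
  have hterm : ∀ k l, 1 / (((D.m k).factorial : ℂ) * ((D.m l).factorial : ℂ)) *
      iteratedDeriv (D.m k) (fun μ => iteratedDeriv (D.m l) (fun ν =>
          μ * D.f z * conj (D.f (conj μ))
            * Complex.exp (2 * Complex.I * (Theta x t z - Theta x t μ)) * F ν
            / ((z - μ) * (μ - ν))) (D.lam l)) (D.lamBar k) =
      D.weight x t z * princ (D.lamBar k) (D.m k)
        (fun μ => D.weightBar x t μ * princ (D.lam l) (D.m l) F μ) z := fun k l => by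
    simp only [weight_mul_weightBar]
    rw [iteratedDeriv_iteratedDeriv_div (hF l) (hB k) (hab l k).symm (hz k)]
    have h1 := Nat.factorial_ne_zero (D.m k)
    have h2 := Nat.factorial_ne_zero (D.m l)
    field_simp
  have hneg := partialFrac_jet_neg (a := D.lamBar) (m := D.m)
    (fun μ => D.weightBar x t μ * partialFrac D.lam D.m (jet D.lam D.m F) μ) z
  rw [G1]
  change F z - D.weight x t z + ∑ k, ∑ l, _ * iteratedDeriv _ _ (D.lamBar k) = _
  simp only [hterm]
  simp only [← Finset.mul_sum]
  rw [sum_princ_mul_princ hab hB, firstEntry]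
  simp only [weightNeg, zero_add, neg_mul]
  rw [hneg]
  ring

/-- The counterpart of `G1_eq` with the columns exchanged. The weight of a row at the conjugate
points is `weightNeg = -weightBar`, so `-F` plays the part of `F`. -/
theorem G2_eq (h_lam : ∀ k, 0 < (D.lam k).im) (h_f : ∀ k, AnalyticAt ℂ D.f (D.lam k))
    {F : ℂ → ℂ} (hF : ∀ k, AnalyticAt ℂ F (D.lamBar k)) {z : ℂ} (hz : ∀ k, z ≠ D.lam k) :
    D.G2 x t F z = F z + D.weightNeg x t z *
      firstEntry D.lamBar D.lam D.m (D.weight x t) (fun y => -F y) z := by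
  have hab : ∀ k l, D.lam k ≠ D.lamBar l := ne_conj_of_im_pos h_lam
  have hB := analyticAt_weight_lam h_lam h_f x t
  have hterm : ∀ k l, 1 / (((D.m k).factorial : ℂ) * ((D.m l).factorial : ℂ)) *
      iteratedDeriv (D.m l) (fun ν => iteratedDeriv (D.m k) (fun μ =>
          z * conj (D.f (conj z)) * D.f ν
            * Complex.exp (2 * Complex.I * (Theta x t ν - Theta x t z)) * F μ
            / ((z - ν) * (ν - μ))) (D.lamBar k)) (D.lam l) =
      D.weightBar x t z * princ (D.lam l) (D.m l)
        (fun μ => D.weight x t μ * princ (D.lamBar k) (D.m k) F μ) z := fun k l => by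
    simp only [weightBar_mul_weight]
    rw [iteratedDeriv_iteratedDeriv_div (hF k) (hB l) (hab l k) (hz l)]
    have h1 := Nat.factorial_ne_zero (D.m k)
    have h2 := Nat.factorial_ne_zero (D.m l)
    field_simp
  rw [G2]
  change F z - D.weightBar x t z + ∑ k, ∑ l, _ * iteratedDeriv _
    (fun ν => iteratedDeriv _ _ (D.lamBar k)) _ = _
  simp only [hterm]
  rw [Finset.sum_comm]
  simp only [← Finset.mul_sum]
  rw [sum_princ_mul_princ (fun k l => (hab l k).symm) hB, firstEntry]
  simp only [zero_add, partialFrac_jet_neg, mul_neg]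
  rw [weightNeg]
  ring

theorem analyticAt_firstEntry {a b : Fin N → ℂ} {m : Fin N → ℕ} {w F : ℂ → ℂ} {z : ℂ}
    (hz : ∀ k, z ≠ b k) : AnalyticAt ℂ (firstEntry a b m w F) z :=
  analyticAt_const.fun_add (analyticAt_partialFrac _ hz)

theorem system1_iff (h_lam : ∀ k, 0 < (D.lam k).im) (h_f : ∀ k, AnalyticAt ℂ D.f (D.lam k))
    {F : ℂ → ℂ} (hF : ∀ k, AnalyticAt ℂ F (D.lam k)) :
    D.System1 x t F ↔ jet D.lam D.m F = jet D.lam D.m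
      (fun z => D.weight x t z * firstEntry D.lam D.lamBar D.m (D.weightNeg x t) F z) := by
  rw [jet_eq_iff]
  have hab : ∀ k l, D.lam k ≠ D.lamBar l := ne_conj_of_im_pos h_lam
  refine forall_congr' fun k => forall_congr' fun j => forall_congr' fun _ => ?_
  have e : D.G1 x t F =ᶠ[𝓝 (D.lam k)] fun z =>
      F z - D.weight x t z * firstEntry D.lam D.lamBar D.m (D.weightNeg x t) F z := by
    filter_upwards [eventually_all.2 fun l => eventually_ne_nhds (hab k l)] with z hz
    exact G1_eq h_lam h_f hF hz
  rw [e.iteratedDeriv_eq, iteratedDeriv_fun_sub (hF k).contDiffAt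
    ((analyticAt_weight_lam h_lam h_f x t k).fun_mul
      (analyticAt_firstEntry (hab k))).contDiffAt, div_eq_zero_iff, sub_eq_zero]
  simp [Nat.factorial_ne_zero]

theorem system2_iff (h_lam : ∀ k, 0 < (D.lam k).im) (h_f : ∀ k, AnalyticAt ℂ D.f (D.lam k))
    {F : ℂ → ℂ} (hF : ∀ k, AnalyticAt ℂ F (D.lamBar k)) :
    D.System2 x t F ↔ jet D.lamBar D.m (fun y => -F y) = jet D.lamBar D.m
      (fun z => D.weightNeg x t z *
        firstEntry D.lamBar D.lam D.m (D.weight x t) (fun y => -F y) z) := by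
  rw [jet_eq_iff]
  have hba : ∀ k l, D.lamBar k ≠ D.lam l := fun k l => (ne_conj_of_im_pos h_lam l k).symm
  refine forall_congr' fun k => forall_congr' fun j => forall_congr' fun _ => ?_
  have e : D.G2 x t F =ᶠ[𝓝 (D.lamBar k)] fun z => F z + D.weightNeg x t z *
      firstEntry D.lamBar D.lam D.m (D.weight x t) (fun y => -F y) z := by
    filter_upwards [eventually_all.2 fun l => eventually_ne_nhds (hba k l)] with z hz
    exact G2_eq h_lam h_f hF hz
  change iteratedDeriv j _ (D.lamBar k) / _ = 0 ↔ _
  rw [e.iteratedDeriv_eq, iteratedDeriv_fun_add (hF k).contDiffAt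
    ((analyticAt_weightNeg_lamBar h_lam h_f x t k).fun_mul
      (analyticAt_firstEntry (hba k))).contDiffAt, div_eq_zero_iff, iteratedDeriv_fun_neg,
      neg_eq_iff_add_eq_zero]
  simp [Nat.factorial_ne_zero]

variable (D)

/-- The coefficients of the row of the solution matrix with normalization `(δ₁, δ₂)`. -/
def solCoeff (δ₁ δ₂ : ℂ) (p : ℝ × ℝ) : Idx D.m ⊕ Idx D.m → ℂ :=
  rowCoeff D.lam D.lamBar D.m (D.weight p.1 p.2) (D.weightNeg p.1 p.2) δ₁ δ₂

/-- The entries in a row of the solution matrix. -/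
def solEntry (δ₁ δ₂ : ℂ) (x t : ℝ) (z : ℂ) : Fin 2 → ℂ :=
  ![δ₁ + partialFrac D.lamBar D.m (D.solCoeff δ₁ δ₂ (x, t) ∘ Sum.inl) z,
    δ₂ + partialFrac D.lam D.m (D.solCoeff δ₁ δ₂ (x, t) ∘ Sum.inr) z]

/-- The solution of the reflectionless Riemann--Hilbert problem. -/
def solution (x t : ℝ) (z : ℂ) : Matrix (Fin 2) (Fin 2) ℂ :=
  Matrix.of ![D.solEntry 1 0 x t z, D.solEntry 0 1 x t z]

variable {D}

theorem coeffMatrix_det_ne_zero (h_lam : ∀ k, 0 < (D.lam k).im)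
    (h_inj : Function.Injective D.lam) (h_f : ∀ k, AnalyticAt ℂ D.f (D.lam k)) (x t : ℝ) :
    (coeffMatrix D.lam D.lamBar D.m (D.weight x t) (D.weightNeg x t)).det ≠ 0 :=
  MTM.coeffMatrix_det_ne_zero h_lam h_inj (analyticAt_weight_lam h_lam h_f x t)
    (analyticAt_weightNeg_lamBar h_lam h_f x t) (D.weightNeg_eq x t)

theorem isCoeff_solCoeff (h_lam : ∀ k, 0 < (D.lam k).im)
    (h_inj : Function.Injective D.lam) (h_f : ∀ k, AnalyticAt ℂ D.f (D.lam k)) (δ₁ δ₂ : ℂ)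
    (p : ℝ × ℝ) :
    IsCoeff D.lam D.lamBar D.m (D.weight p.1 p.2) (D.weightNeg p.1 p.2) δ₁ δ₂
      (D.solCoeff δ₁ δ₂ p ∘ Sum.inl) (D.solCoeff δ₁ δ₂ p ∘ Sum.inr) :=
  isCoeff_rowCoeff (ne_conj_of_im_pos h_lam) (analyticAt_weight_lam h_lam h_f p.1 p.2)
    (analyticAt_weightNeg_lamBar h_lam h_f p.1 p.2)
    (coeffMatrix_det_ne_zero h_lam h_inj h_f p.1 p.2) δ₁ δ₂

theorem lamBar_injective (h_inj : Function.Injective D.lam) : Function.Injective D.lamBar :=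
  fun _ _ e => h_inj ((starRingEnd ℂ).injective e)

/-- The reflectionless Riemann--Hilbert problem is solvable. -/
theorem isRHPSolution_solution {γ : ℝ → ℂ} (h_lam : ∀ k, 0 < (D.lam k).im)
    (h_inj : Function.Injective D.lam) (h_f : ∀ k, AnalyticAt ℂ D.f (D.lam k))
    (h_f0 : ∀ k, D.f (D.lam k) ≠ 0) (hγ : ∀ s : ℝ, s ≠ 0 → γ s = 0) (x t : ℝ) :
    D.IsRHPSolution γ x t (D.solution x t) := by
  have row := fun δ₁ δ₂ => isRow_of_jet h_inj (lamBar_injective h_inj) (ne_conj_of_im_pos h_lam)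
    (analyticAt_weight_lam h_lam h_f x t) (analyticAt_weightNeg_lamBar h_lam h_f x t)
    (isCoeff_solCoeff h_lam h_inj h_f δ₁ δ₂ (x, t))
  refine isRHPSolution_of_isRow h_lam h_f h_f0 hγ (fun i z hz => ?_) (fun i z hz => ?_)
    (fun i => ?_) (fun i j => ?_)
  · fin_cases i
    · exact analyticAt_const.fun_add (analyticAt_partialFrac _ hz)
    · exact analyticAt_const.fun_add (analyticAt_partialFrac _ hz)
  · fin_cases i
    · exact analyticAt_const.fun_add (analyticAt_partialFrac _ hz)
    · exact analyticAt_const.fun_add (analyticAt_partialFrac _ hz)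
  · fin_cases i
    · exact row 1 0
    · exact row 0 1
  · fin_cases i <;> fin_cases j <;>
      simpa [solution, solEntry] using decays_partialFrac _

theorem weight_eq_expWeight (p : ℝ × ℝ) : D.weight p.1 p.2 = expWeight D.f
    (fun z => Complex.I / 2 * (z - z⁻¹)) (fun z => Complex.I / 2 * (z + z⁻¹)) p := by
  ext z
  simp only [weight, expWeight, Theta]
  congr 2
  ring

theorem weightNeg_eq_expWeight (p : ℝ × ℝ) : D.weightNeg p.1 p.2 =
    expWeight (fun z => -(z * conj (D.f (conj z)))) (fun z => -(Complex.I / 2 * (z - z⁻¹)))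
      (fun z => -(Complex.I / 2 * (z + z⁻¹))) p := by
  ext z
  simp only [weightNeg, weightBar, expWeight, Theta, neg_mul]
  congr 3
  ring

theorem smoothWeight_weight (h_lam : ∀ k, 0 < (D.lam k).im)
    (h_f : ∀ k, AnalyticAt ℂ D.f (D.lam k)) (v : ℝ × ℝ) {κ : ℂ → ℂ}
    (hκ : ∀ z, κ z = v.1 * (Complex.I / 2 * (z - z⁻¹)) + v.2 * (Complex.I / 2 * (z + z⁻¹))) :
    SmoothWeight v D.lam κ (fun p => D.weight p.1 p.2) ∧
      SmoothWeight v D.lamBar (fun z => -κ z) (fun p => D.weightNeg p.1 p.2) := by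
  have hinv : ∀ z : ℂ, z ≠ 0 → AnalyticAt ℂ (fun z : ℂ => z⁻¹) z := fun z hz => analyticAt_inv hz
  have h1 : ∀ z : ℂ, z ≠ 0 → AnalyticAt ℂ (fun z : ℂ => Complex.I / 2 * (z - z⁻¹)) z :=
    fun z hz => by have := hinv z hz; fun_prop
  have h2 : ∀ z : ℂ, z ≠ 0 → AnalyticAt ℂ (fun z : ℂ => Complex.I / 2 * (z + z⁻¹)) z :=
    fun z hz => by have := hinv z hz; fun_prop
  have e1 : κ = _ := funext hκ
  have e2 : (fun z => -κ z) = fun z => v.1 * -(Complex.I / 2 * (z - z⁻¹))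
      + v.2 * -(Complex.I / 2 * (z + z⁻¹)) := by
    ext z; rw [hκ]; ring
  rw [e2, e1]
  simp only [weight_eq_expWeight, weightNeg_eq_expWeight]
  refine ⟨smoothWeight_expWeight v h_f (fun k => h1 _ (lam_ne_zero h_lam k))
    (fun k => h2 _ (lam_ne_zero h_lam k)), smoothWeight_expWeight v (fun k => ?_)
    (fun k => (h1 _ (lamBar_ne_zero h_lam k)).fun_neg)
    (fun k => (h2 _ (lamBar_ne_zero h_lam k)).fun_neg)⟩
  exact (analyticAt_id.fun_mul (analyticAt_conj_conj (by simpa [lamBar] using h_f k))).fun_neg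

/-- The light-cone directions separate the phase: `2iΘ` has derivative `iz` along `(1, 1)` and `i
z⁻¹` along `(-1, 1)`, so each rate has its only pole at infinity or at the origin. -/
theorem laxData (h_lam : ∀ k, 0 < (D.lam k).im)
    (h_inj : Function.Injective D.lam) (h_f : ∀ k, AnalyticAt ℂ D.f (D.lam k)) :
    LaxData D.lam D.m (fun p => D.weight p.1 p.2) (fun p => D.weightNeg p.1 p.2)
      (fun p => D.solCoeff 1 0 p ∘ Sum.inl) (fun p => D.solCoeff 1 0 p ∘ Sum.inr)
      (fun p => D.solCoeff 0 1 p ∘ Sum.inl) (fun p => D.solCoeff 0 1 p ∘ Sum.inr) := by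
  have hξ := smoothWeight_weight h_lam h_f (1, 1) (κ := fun z => Complex.I * z) fun z => by
    push_cast; ring
  have hη := smoothWeight_weight h_lam h_f (-1, 1) (κ := fun z => Complex.I * z⁻¹) fun z => by
    push_cast; ring
  have cd := fun δ₁ δ₂ i => contDiff_rowCoeff (m := D.m) (ne_conj_of_im_pos h_lam) hξ.1 hξ.2
    (fun p => coeffMatrix_det_ne_zero h_lam h_inj h_f p.1 p.2) δ₁ δ₂ i
  exact ⟨h_lam, h_inj, fun p => D.weightNeg_eq p.1 p.2, hξ.1, hξ.2, hη.1, hη.2,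
    isCoeff_solCoeff h_lam h_inj h_f 1 0, isCoeff_solCoeff h_lam h_inj h_f 0 1,
    fun i => cd 1 0 _, fun i => cd 1 0 _, fun i => cd 0 1 _⟩

end DiscreteData

end

/-! ### Identification of an arbitrary solution with the explicit one, and the theorem. -/

noncomputable section

theorem partialFrac_jet_zero {N : ℕ} {a : Fin N → ℂ} {m : Fin N → ℕ} (g : ℂ → ℂ) :
    partialFrac a m (jet a m g) 0 = ∑ k, ∑ n ∈ Finset.range (m k + 1),
      iteratedDeriv (m k - n) g (a k) / ((-a k) ^ (n + 1) * ((m k - n).factorial : ℂ)) := by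
  simp only [partialFrac_jet, princ, zero_sub]
  refine Finset.sum_congr rfl fun k _ => Finset.sum_congr rfl fun n _ => ?_
  rw [← div_eq_mul_inv, div_div, mul_comm]

theorem jet_neg_eq_iff {N : ℕ} {a : Fin N → ℂ} {m : Fin N → ℕ} {g g' : ℂ → ℂ} :
    (jet a m fun y => -g y) = (jet a m fun y => -g' y) ↔
      ∀ k, ∀ j ≤ m k, iteratedDeriv j g (a k) = iteratedDeriv j g' (a k) := by
  simp only [jet_eq_iff, iteratedDeriv_fun_neg, neg_inj]

namespace DiscreteData

variable {N : ℕ} {D : DiscreteData N} {γ : ℝ → ℂ} {x t : ℝ} {M : ℂ → Matrix (Fin 2) (Fin 2) ℂ}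

theorem system1_iff_jet (h_lam : ∀ k, 0 < (D.lam k).im) (h_inj : Function.Injective D.lam)
    (h_f : ∀ k, AnalyticAt ℂ D.f (D.lam k)) {F : ℂ → ℂ} (hF : ∀ k, AnalyticAt ℂ F (D.lam k)) :
    D.System1 x t F ↔ jet D.lam D.m F = D.solCoeff 1 0 (x, t) ∘ Sum.inr := by
  have h := isCoeff_solCoeff h_lam h_inj h_f 1 0 (x, t)
  rw [system1_iff h_lam h_f hF, jet_eq_firstEntry_iff h fun c₁ c₂ h' => ?_]
  exact (h'.unique (ne_conj_of_im_pos h_lam) (analyticAt_weight_lam h_lam h_f x t)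
    (analyticAt_weightNeg_lamBar h_lam h_f x t) (coeffMatrix_det_ne_zero h_lam h_inj h_f x t) h).2

theorem system2_iff_jet (h_lam : ∀ k, 0 < (D.lam k).im) (h_inj : Function.Injective D.lam)
    (h_f : ∀ k, AnalyticAt ℂ D.f (D.lam k)) {F : ℂ → ℂ}
    (hF : ∀ k, AnalyticAt ℂ F (D.lamBar k)) :
    D.System2 x t F ↔
      (jet D.lamBar D.m fun y => -F y) = D.solCoeff 0 1 (x, t) ∘ Sum.inl := by
  have h := isCoeff_solCoeff h_lam h_inj h_f 0 1 (x, t)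
  have hs : IsCoeff D.lamBar D.lam D.m (D.weightNeg x t) (D.weight x t) 1 0
    (D.solCoeff 0 1 (x, t) ∘ Sum.inr) (D.solCoeff 0 1 (x, t) ∘ Sum.inl) := ⟨h.2, h.1⟩
  rw [system2_iff h_lam h_f hF, jet_eq_firstEntry_iff hs fun c₁ c₂ h' => ?_]
  -- The second row with its columns exchanged has the normalization `(1, 0)` of the first, so the
  -- same elimination applies.
  have h'' : IsCoeff D.lam D.lamBar D.m (D.weight x t) (D.weightNeg x t) 0 1 c₂ c₁ :=
    ⟨h'.2, h'.1⟩
  exact (h''.unique (ne_conj_of_im_pos h_lam) (analyticAt_weight_lam h_lam h_f x t)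
    (analyticAt_weightNeg_lamBar h_lam h_f x t) (coeffMatrix_det_ne_zero h_lam h_inj h_f x t) h).1

namespace IsRHPSolution

theorem eventuallyEq_solution (h : D.IsRHPSolution γ x t M) (h_lam : ∀ k, 0 < (D.lam k).im)
    (h_inj : Function.Injective D.lam) (h_f : ∀ k, AnalyticAt ℂ D.f (D.lam k))
    (h_f0 : ∀ k, D.f (D.lam k) ≠ 0) (hγ : ∀ s : ℝ, s ≠ 0 → γ s = 0) (w : ℂ) :
    ∀ᶠ z in 𝓝[≠] w, z.im ≠ 0 → M z = D.solution x t z := by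
  have ne : ∀ a : ℂ, ∀ᶠ z in 𝓝[≠] w, z ≠ a := fun a => by
    rcases eq_or_ne w a with rfl | hw
    · exact self_mem_nhdsWithin
    · exact (eventually_ne_nhds hw).filter_mono nhdsWithin_le_nhds
  filter_upwards [eventually_all.2 fun k => ne (D.lam k),
    eventually_all.2 fun k => ne (D.lamBar k)] with z ha hb hz
  exact h.eq h_lam h_f hγ (isRHPSolution_solution h_lam h_inj h_f h_f0 hγ x t)
    (D.notMem_singularSet.2 ⟨hz, ha, hb⟩)

theorem tendsto_zero (h : D.IsRHPSolution γ x t M) (h_lam : ∀ k, 0 < (D.lam k).im)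
    (h_inj : Function.Injective D.lam) (h_f : ∀ k, AnalyticAt ℂ D.f (D.lam k))
    (h_f0 : ∀ k, D.f (D.lam k) ≠ 0) (hγ : ∀ s : ℝ, s ≠ 0 → γ s = 0) :
    Tendsto (fun z => M z 0 1) (𝓝[{z : ℂ | z.im ≠ 0}] 0)
        (𝓝 (partialFrac D.lam D.m (D.solCoeff 1 0 (x, t) ∘ Sum.inr) 0)) ∧
      Tendsto (fun z => M z 1 0) (𝓝[{z : ℂ | z.im ≠ 0}] 0)
        (𝓝 (partialFrac D.lamBar D.m (D.solCoeff 0 1 (x, t) ∘ Sum.inl) 0)) := by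
  have hle : 𝓝[{z : ℂ | z.im ≠ 0}] (0 : ℂ) ≤ 𝓝[≠] 0 :=
    nhdsWithin_mono _ fun z hz e => hz (by simp [Set.mem_singleton_iff.1 e])
  have ev := (h.eventuallyEq_solution h_lam h_inj h_f h_f0 hγ 0).filter_mono hle
  have c₁ := (analyticAt_partialFrac (m := D.m) (D.solCoeff 1 0 (x, t) ∘ Sum.inr)
    fun k => (lam_ne_zero h_lam k).symm).continuousAt.tendsto
  have c₂ := (analyticAt_partialFrac (m := D.m) (D.solCoeff 0 1 (x, t) ∘ Sum.inl)
    fun k => (lamBar_ne_zero h_lam k).symm).continuousAt.tendsto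
  refine ⟨(c₁.mono_left nhdsWithin_le_nhds).congr' ?_,
    (c₂.mono_left nhdsWithin_le_nhds).congr' ?_⟩
  · filter_upwards [ev, self_mem_nhdsWithin] with z hz hi
    rw [hz hi]
    simp [solution, solEntry]
  · filter_upwards [ev, self_mem_nhdsWithin] with z hz hi
    rw [hz hi]
    simp [solution, solEntry]

/-- The first column of `M` is analytic at `λ_k` and agrees nearby with the explicit solution, hence
has the same jet; by the residue conditions that jet, once weighted, is the coefficient vector of
the second column. -/
theorem jet_F1 (h : D.IsRHPSolution γ x t M) (h_lam : ∀ k, 0 < (D.lam k).im)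
    (h_inj : Function.Injective D.lam) (h_f : ∀ k, AnalyticAt ℂ D.f (D.lam k))
    (h_f0 : ∀ k, D.f (D.lam k) ≠ 0) (hγ : ∀ s : ℝ, s ≠ 0 → γ s = 0) :
    jet D.lam D.m (D.F1 x t M) = D.solCoeff 1 0 (x, t) ∘ Sum.inr := by
  refine Eq.trans (jet_congr fun k => ?_) (isCoeff_solCoeff h_lam h_inj h_f 1 0 (x, t)).2.symm
  have hab : ∀ k l, D.lam k ≠ D.lamBar l := ne_conj_of_im_pos h_lam
  have hA : AnalyticAt ℂ (fun z => M z 0 0) (D.lam k) :=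
    analyticAt_pi_iff.1 (h.analytic_lam k) 0
  have hB : AnalyticAt ℂ (fun z => 1 + partialFrac D.lamBar D.m
      (D.solCoeff 1 0 (x, t) ∘ Sum.inl) z) (D.lam k) :=
    analyticAt_const.fun_add (analyticAt_partialFrac _ (hab k))
  have hi : ∀ᶠ z in 𝓝[≠] (D.lam k), z.im ≠ 0 :=
    (Complex.continuous_im.continuousAt.eventually_ne (h_lam k).ne').filter_mono nhdsWithin_le_nhds
  have e := (hA.frequently_eq_iff_eventually_eq hB).1 (Eventually.frequently (by
    filter_upwards [hi, h.eventuallyEq_solution h_lam h_inj h_f h_f0 hγ (D.lam k)] with z hz e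
    rw [e hz]
    rfl))
  filter_upwards [e] with z hz
  rw [F1, hz]

theorem jet_F2 (h : D.IsRHPSolution γ x t M) (h_lam : ∀ k, 0 < (D.lam k).im)
    (h_inj : Function.Injective D.lam) (h_f : ∀ k, AnalyticAt ℂ D.f (D.lam k))
    (h_f0 : ∀ k, D.f (D.lam k) ≠ 0) (hγ : ∀ s : ℝ, s ≠ 0 → γ s = 0) :
    (jet D.lamBar D.m fun y => -D.F2 x t M y) = D.solCoeff 0 1 (x, t) ∘ Sum.inl := by
  refine Eq.trans (jet_congr fun k => ?_) (isCoeff_solCoeff h_lam h_inj h_f 0 1 (x, t)).1.symm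
  have hba : ∀ k l, D.lamBar k ≠ D.lam l := fun k l => (ne_conj_of_im_pos h_lam l k).symm
  have hA : AnalyticAt ℂ (fun z => M z 1 1) (D.lamBar k) :=
    analyticAt_pi_iff.1 (h.analytic_lamBar k) 1
  have hB : AnalyticAt ℂ (fun z => 1 + partialFrac D.lam D.m
      (D.solCoeff 0 1 (x, t) ∘ Sum.inr) z) (D.lamBar k) :=
    analyticAt_const.fun_add (analyticAt_partialFrac _ (hba k))
  have hi : ∀ᶠ z in 𝓝[≠] (D.lamBar k), z.im ≠ 0 :=
    (Complex.continuous_im.continuousAt.eventually_ne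
      (by simpa [lamBar] using (h_lam k).ne')).filter_mono nhdsWithin_le_nhds
  have e := (hA.frequently_eq_iff_eventually_eq hB).1 (Eventually.frequently (by
    filter_upwards [hi, h.eventuallyEq_solution h_lam h_inj h_f h_f0 hγ (D.lamBar k)] with z hz e
    rw [e hz]
    rfl))
  filter_upwards [e] with z hz
  rw [F2, hz, weightNeg, neg_mul]

theorem analyticAt_F1 (h : D.IsRHPSolution γ x t M) (h_lam : ∀ k, 0 < (D.lam k).im)
    (h_f : ∀ k, AnalyticAt ℂ D.f (D.lam k)) (k : Fin N) :
    AnalyticAt ℂ (D.F1 x t M) (D.lam k) :=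
  (analyticAt_weight_lam h_lam h_f x t k).fun_mul (analyticAt_pi_iff.1 (h.analytic_lam k) 0)

theorem analyticAt_F2 (h : D.IsRHPSolution γ x t M) (h_lam : ∀ k, 0 < (D.lam k).im)
    (h_f : ∀ k, AnalyticAt ℂ D.f (D.lam k)) (k : Fin N) :
    AnalyticAt ℂ (D.F2 x t M) (D.lamBar k) :=
  (analyticAt_weightBar_lamBar h_lam h_f x t k).fun_mul
    (analyticAt_pi_iff.1 (h.analytic_lamBar k) 1)

end IsRHPSolution

end DiscreteData

end

end MTM

theorem mainTheorem4 {N : ℕ} (D : MTM.DiscreteData N) (γ : ℝ → ℂ)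
    (h_lam : ∀ k, 0 < (D.lam k).im) (h_inj : Function.Injective D.lam)
    (h_f : ∀ k, AnalyticAt ℂ D.f (D.lam k)) (h_f0 : ∀ k, D.f (D.lam k) ≠ 0)
    (hγ : ∀ s : ℝ, s ≠ 0 → γ s = 0) :
    -- for every `(x,t)` the Riemann--Hilbert problem has a solution, and only one
    (∀ x t : ℝ, ∃ M, D.IsRHPSolution γ x t M) ∧
    (∀ (x t : ℝ) (M M' : ℂ → Matrix (Fin 2) (Fin 2) ℂ),
      D.IsRHPSolution γ x t M → D.IsRHPSolution γ x t M' → ∀ z ∉ D.singularSet, M z = M' z) ∧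
    -- it yields a solution of the massive Thirring model, given by the explicit formulas
    ∀ M : ℝ → ℝ → ℂ → Matrix (Fin 2) (Fin 2) ℂ, (∀ x t, D.IsRHPSolution γ x t (M x t)) →
      ∃ u v : ℝ → ℝ → ℂ, MTM.IsMTMSolution u v ∧ ∀ x t : ℝ,
        Tendsto (fun z => conj (M x t z 0 1)) (𝓝[{z : ℂ | z.im ≠ 0}] 0) (𝓝 (u x t)) ∧
        Tendsto (fun z => M x t z 1 0) (𝓝[{z : ℂ | z.im ≠ 0}] 0) (𝓝 (v x t)) ∧
        u x t = conj (∑ k : Fin N, ∑ n ∈ Finset.range (D.m k + 1),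
          iteratedDeriv (D.m k - n) (D.F1 x t (M x t)) (D.lam k)
            / ((-D.lam k) ^ (n + 1) * ((D.m k - n).factorial : ℂ))) ∧
        v x t = -∑ k : Fin N, ∑ n ∈ Finset.range (D.m k + 1),
          iteratedDeriv (D.m k - n) (D.F2 x t (M x t)) (conj (D.lam k))
            / ((-conj (D.lam k)) ^ (n + 1) * ((D.m k - n).factorial : ℂ)) ∧
        -- the derivatives of `F₁` and `F₂` are the solutions of the two algebraic systems
        D.System1 x t (D.F1 x t (M x t)) ∧
        D.System2 x t (D.F2 x t (M x t)) ∧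
        (∀ F : ℂ → ℂ, (∀ k, AnalyticAt ℂ F (D.lam k)) →
          (D.System1 x t F ↔ ∀ k, ∀ j ≤ D.m k,
            iteratedDeriv j F (D.lam k) = iteratedDeriv j (D.F1 x t (M x t)) (D.lam k))) ∧
        (∀ F : ℂ → ℂ, (∀ k, AnalyticAt ℂ F (conj (D.lam k))) →
          (D.System2 x t F ↔ ∀ k, ∀ j ≤ D.m k,
            iteratedDeriv j F (conj (D.lam k))
              = iteratedDeriv j (D.F2 x t (M x t)) (conj (D.lam k)))) := by
  refine ⟨fun x t => ⟨_, MTM.DiscreteData.isRHPSolution_solution h_lam h_inj h_f h_f0 hγ x t⟩,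
    fun x t M M' h h' z hz => h.eq h_lam h_f hγ h' hz, fun M hM => ⟨_, _,
      (MTM.DiscreteData.laxData h_lam h_inj h_f).isMTMSolution, fun x t => ?_⟩⟩
  have h := hM x t
  have j₁ := h.jet_F1 h_lam h_inj h_f h_f0 hγ
  have j₂ := h.jet_F2 h_lam h_inj h_f h_f0 hγ
  have T := h.tendsto_zero h_lam h_inj h_f h_f0 hγ
  refine ⟨(Complex.continuous_conj.tendsto _).comp T.1, T.2, ?_, ?_, ?_, ?_, fun F hF => ?_,
    fun F hF => ?_⟩
  · rw [← MTM.partialFrac_jet_zero, j₁]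
  -- The minus sign in the formula for `v` is that of `weightNeg`: the coefficients of the first
  -- column are the jets of `-F₂`.
  · refine Eq.trans ?_ (congrArg Neg.neg (MTM.partialFrac_jet_zero (a := D.lamBar) _))
    rw [← MTM.partialFrac_jet_neg, j₂]
    rfl
  · exact (MTM.DiscreteData.system1_iff_jet h_lam h_inj h_f (h.analyticAt_F1 h_lam h_f)).2 j₁
  · exact (MTM.DiscreteData.system2_iff_jet h_lam h_inj h_f (h.analyticAt_F2 h_lam h_f)).2 j₂
  · rw [MTM.DiscreteData.system1_iff_jet h_lam h_inj h_f hF, ← j₁, MTM.jet_eq_iff]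
  · rw [MTM.DiscreteData.system2_iff_jet h_lam h_inj h_f hF, ← j₂, MTM.jet_neg_eq_iff]
    rfl
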